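/- Let $N\ge 3$, $2<q<2+\frac4N$, $\mu>0$, $2^*=\frac{2N}{N-2}$, $\gamma_q=\frac{N(q-2)}{2q}$. Let $H^1=H^1(\mathbb R^N)$ be the Sobolev space of real-valued (or of complex-valued) functions, regarded as a real Hilbert space, with $\|u\|^2=\|u\|_2^2+\|\nabla u\|_2^2$, and let $H^1_r$ be its subspace of functions radially symmetric with respect to $0$. For $u\in H^1$ put $$F_\mu(u)=\tfrac12\|\nabla u\|_2^2-\tfrac{\mu}{q}\|u\|_q^q-\tfrac1{2^*}\|u\|_{2^*}^{2^*},\qquad Q_\mu(u)=\|\nabla u\|_2^2-\mu\gamma_q\|u\|_q^q-\|u\|_{2^*}^{2^*},$$ and for $c>0$ let $S(c)=\{u\in H^1:\|u\|_2^2=c\}$, $S_r(c)=S(c)\cap H^1_r$ and $T_uS(c)=\{v\in H^1:\langle u,v\rangle_{L^2}=0\}$ (with the real $L^2$ inner product). Let $\mathcal S$ and $C_{N,q}$ be the best constants in the inequalities $\mathcal S\|u\|_{2^*}^2\le\|\nabla u\|_2^2$ and $\|u\|_q\le C_{N,q}\|\nabla u\|_2^{\gamma_q}\|u\|_2^{1-\gamma_q}$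 on $H^1$. With $$\alpha_0=\tfrac{N(q-2)}4-1,\quad \alpha_1=\tfrac{2N-q(N-2)}4,\quad \alpha_2=\tfrac2{N-2},\quad b=-\frac{\alpha_0}{\alpha_2}\cdot\frac{\mu\, C_{N,q}^q\,\mathcal S^{2^*/2}\,2^*}{q},$$ $$K=\frac{\mu}{q}C_{N,q}^q\,b^{\frac{\alpha_0}{\alpha_2-\alpha_0}}+\frac1{2^*\mathcal S^{2^*/2}}\,b^{\frac{\alpha_2}{\alpha_2-\alpha_0}},$$ set $$c_0=\Big(\frac1{2K}\Big)^{N/2},\qquad \rho_0=b^{\frac1{\alpha_2-\alpha_0}}\,c_0^{\frac{\alpha_1}{\alpha_2-\alpha_0}} .$$ Let $$V(c)=\{u\in S(c):\|\nabla u\|_2^2<\rho_0\},\quad m(c)=\inf_{V(c)}F_\mu,\quad E_c=\{u\in S(c):F_\mu(u)<2m(c)\},$$ $$\Lambda^-_r(c)=\{u\in S_r(c):Q_\mu(u)=0,\ F_\mu(u)<0\},$$ $$\Gamma^0(c)=\{g\in C([0,\infty),S_r(c)):\ g(0)\in\Lambda^-_r(c),\ \exists\, t_g\ \text{such that}\ g(t)\in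 E_c\ \text{for all}\ t\ge t_g\},$$ $$M^0(c)=\inf_{g\in\Gamma^0(c)}\ \max_{t\in[0,\infty)}F_\mu(g(t)).$$ A Palais–Smale sequence for $F_\mu$ restricted to $S(c)$ at the level $M^0(c)$ is a sequence $(u_n)\subset S(c)$ with $F_\mu(u_n)\to M^0(c)$ such that $F_\mu$ is differentiable at every $u_n$ and $\|F_\mu'(u_n)|_{T_{u_n}S(c)}\|_{(T_{u_n}S(c))^*}\to0$. **Proposition 1.6.** For every $c\in(0,c_0)$ there is a Palais–Smale sequence $(u_n)\subset S_r(c)$ for $F_\mu$ restricted to $S(c)$ at the level $M^0(c)$ such that $Q_\mu(u_n)\to0$. Moreover, every Palais–Smale sequence $(u_n)$ for $F_\mu$ restricted to $S(c)$ at the level $M^0(c)$ with $Q_\mu(u_n)\to0$ is bounded in $H^1$. -/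

import Mathlib

open MeasureTheory Filter Topology
open scoped NNReal ENNReal ContDiff

noncomputable section

namespace NormalizedNLS

/-- `g` is the weak partial derivative `∂ᵢ u` of `u` on `ℝᴺ`
(both locally integrable in every use below). -/
def IsWeakPartialDeriv {𝕜 : Type*} [RCLike 𝕜] {N : ℕ} (i : Fin N)
    (u g : EuclideanSpace ℝ (Fin N) → 𝕜) : Prop :=
  ∀ φ : EuclideanSpace ℝ (Fin N) → ℝ, ContDiff ℝ ∞ φ → HasCompactSupport φ →
    ∫ x, (fderiv ℝ φ x (EuclideanSpace.single i 1)) • u x = -∫ x, φ x • g x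

/-- The real or complex space `L²(ℝᴺ)`. -/
abbrev L2 (𝕜 : Type*) [RCLike 𝕜] (N : ℕ) : Type _ :=
  Lp 𝕜 2 (volume : Measure (EuclideanSpace ℝ (Fin N)))

theorem integrable_smul_of_test {𝕜 : Type*} [RCLike 𝕜] {N : ℕ}
    {φ : EuclideanSpace ℝ (Fin N) → ℝ} (hφ : Continuous φ) (hc : HasCompactSupport φ)
    (u : L2 𝕜 N) : Integrable (fun x => φ x • u x) := by
  have h1 : MemLp φ 2 volume := hφ.memLp_of_hasCompactSupport hc
  have h2 : MemLp u 2 volume := Lp.memLp u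
  have h3 := MemLp.smul (r := 1) h2 h1
  exact memLp_one_iff_integrable.mp h3

theorem integrable_deriv_smul_of_test {𝕜 : Type*} [RCLike 𝕜] {N : ℕ} (i : Fin N)
    {φ : EuclideanSpace ℝ (Fin N) → ℝ} (hφ : ContDiff ℝ ∞ φ) (hc : HasCompactSupport φ)
    (u : L2 𝕜 N) :
    Integrable (fun x => (fderiv ℝ φ x (EuclideanSpace.single i 1)) • u x) :=
  integrable_smul_of_test
    ((hφ.continuous_fderiv (by simp)).clm_apply continuous_const)
    (hc.fderiv_apply (𝕜 := ℝ) (EuclideanSpace.single i 1)) u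

theorem IsWeakPartialDeriv.add {𝕜 : Type*} [RCLike 𝕜] {N : ℕ} {i : Fin N} {u v g h : L2 𝕜 N}
    (hu : IsWeakPartialDeriv i u g) (hv : IsWeakPartialDeriv i v h) :
    IsWeakPartialDeriv i (u + v : L2 𝕜 N) (g + h : L2 𝕜 N) := by
  intro φ hφ hc
  have e1 : ∫ x, (fderiv ℝ φ x (EuclideanSpace.single i 1)) • (u + v : L2 𝕜 N) x
      = ∫ x, ((fderiv ℝ φ x (EuclideanSpace.single i 1)) • u x
        + (fderiv ℝ φ x (EuclideanSpace.single i 1)) • v x) := by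
    refine integral_congr_ae ?_
    filter_upwards [Lp.coeFn_add u v] with x hx
    rw [hx, Pi.add_apply, smul_add]
  have e2 : ∫ x, φ x • (g + h : L2 𝕜 N) x = ∫ x, (φ x • g x + φ x • h x) := by
    refine integral_congr_ae ?_
    filter_upwards [Lp.coeFn_add g h] with x hx
    rw [hx, Pi.add_apply, smul_add]
  rw [e1, e2, integral_add (integrable_deriv_smul_of_test i hφ hc u)
    (integrable_deriv_smul_of_test i hφ hc v),
    integral_add (integrable_smul_of_test hφ.continuous hc g)
      (integrable_smul_of_test hφ.continuous hc h), hu φ hφ hc, hv φ hφ hc]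
  abel

theorem IsWeakPartialDeriv.smul {𝕜 : Type*} [RCLike 𝕜] {N : ℕ} {i : Fin N} {u g : L2 𝕜 N}
    (a : ℝ) (hu : IsWeakPartialDeriv i u g) :
    IsWeakPartialDeriv i (a • u : L2 𝕜 N) (a • g : L2 𝕜 N) := by
  intro φ hφ hc
  have e1 : ∫ x, (fderiv ℝ φ x (EuclideanSpace.single i 1)) • (a • u : L2 𝕜 N) x
      = ∫ x, a • ((fderiv ℝ φ x (EuclideanSpace.single i 1)) • u x) := by
    refine integral_congr_ae ?_
    filter_upwards [Lp.coeFn_smul a u] with x hx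
    rw [hx, Pi.smul_apply, smul_comm]
  have e2 : ∫ x, φ x • (a • g : L2 𝕜 N) x = ∫ x, a • (φ x • g x) := by
    refine integral_congr_ae ?_
    filter_upwards [Lp.coeFn_smul a g] with x hx
    rw [hx, Pi.smul_apply, smul_comm]
  rw [e1, e2, integral_smul, integral_smul, hu φ hφ hc, smul_neg]

theorem IsWeakPartialDeriv.zero {𝕜 : Type*} [RCLike 𝕜] {N : ℕ} (i : Fin N) :
    IsWeakPartialDeriv i (0 : L2 𝕜 N) (0 : L2 𝕜 N) := by
  intro φ hφ hc
  have e (ψ : EuclideanSpace ℝ (Fin N) → ℝ) : ∫ x, ψ x • (0 : L2 𝕜 N) x = 0 := by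
    refine integral_eq_zero_of_ae ?_
    filter_upwards [Lp.coeFn_zero 𝕜 2 (volume : Measure (EuclideanSpace ℝ (Fin N)))] with x hx
    rw [hx]
    simp
  rw [e φ, e (fun x => fderiv ℝ φ x (EuclideanSpace.single i 1)), neg_zero]

/-- The graph of the weak gradient on `L²(ℝᴺ)`: all pairs `(u, (∂₁u, …, ∂_N u))` of square
integrable classes, where `∂ᵢ u` is the weak partial derivative of `u`. -/
def h1Graph (𝕜 : Type*) [RCLike 𝕜] (N : ℕ) :
    Submodule ℝ (WithLp 2 (L2 𝕜 N × PiLp 2 (fun _ : Fin N => L2 𝕜 N))) where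
  carrier := {p | ∀ i, IsWeakPartialDeriv i p.fst (p.snd i)}
  add_mem' hp hp' i := (hp i).add (hp' i)
  zero_mem' i := IsWeakPartialDeriv.zero i
  smul_mem' a _ hp i := (hp i).smul a

/-- The Sobolev space `H¹(ℝᴺ)` of real (`𝕜 = ℝ`) or complex (`𝕜 = ℂ`) functions, as a real vector
space, with the norm `‖u‖² = ‖u‖₂² + ∑ᵢ ‖∂ᵢ u‖₂²`. The weak gradient being unique,
`u` determines the pair `(u, ∇u)`. -/
abbrev H1 (𝕜 : Type*) [RCLike 𝕜] (N : ℕ) : Type _ := h1Graph 𝕜 N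

section

variable {𝕜 : Type*} [RCLike 𝕜] {N : ℕ}

/-- The function (class) underlying an element of `H¹`. -/
def H1.fn (u : H1 𝕜 N) : L2 𝕜 N := u.1.fst

/-- The weak gradient of an element of `H¹`, with norm `‖∇u‖₂² = ∑ᵢ ‖∂ᵢ u‖₂²`. -/
def H1.grad (u : H1 𝕜 N) : PiLp 2 (fun _ : Fin N => L2 𝕜 N) := u.1.snd

/-- `‖u‖_p ^ p = ∫ |u|^p`. -/
def powInt (p : ℝ) (u : H1 𝕜 N) : ℝ := ∫ x, ‖u.fn x‖ ^ p

/-- `‖u‖_p = (∫ |u|^p)^{1/p}`. -/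
def lpNorm (p : ℝ) (u : H1 𝕜 N) : ℝ := (powInt p u) ^ (1 / p)

end

/-- The critical Sobolev exponent `2* = 2N/(N-2)`. -/
def critExp (N : ℕ) : ℝ := 2 * N / (N - 2)

/-- `γ_q = N(q-2)/(2q)`. -/
def gammaExp (N : ℕ) (q : ℝ) : ℝ := N * (q - 2) / (2 * q)

section

variable {𝕜 : Type*} [RCLike 𝕜] {N : ℕ}

/-- The energy `F_μ(u) = ½‖∇u‖₂² - (μ/q)‖u‖_q^q - (1/2*)‖u‖_{2*}^{2*}`. -/
def energy (q μ : ℝ) (u : H1 𝕜 N) : ℝ :=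
  1 / 2 * ‖u.grad‖ ^ 2 - μ / q * powInt q u - 1 / critExp N * powInt (critExp N) u

/-- The Pohozaev functional `Q_μ(u) = ‖∇u‖₂² - μ γ_q ‖u‖_q^q - ‖u‖_{2*}^{2*}`. -/
def pohozaev (q μ : ℝ) (u : H1 𝕜 N) : ℝ :=
  ‖u.grad‖ ^ 2 - μ * gammaExp N q * powInt q u - powInt (critExp N) u

variable (𝕜 N)

/-- The mass constraint `S(c) = {u ∈ H¹ : ‖u‖₂² = c}`. -/
def massSphere (c : ℝ) : Set (H1 𝕜 N) := {u | ‖u.fn‖ ^ 2 = c}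

/-- `H¹_r`: the functions in `H¹` that are radially symmetric with respect to `0`, that is,
invariant (almost everywhere) under every linear isometry of `ℝᴺ`. -/
def radialSet : Set (H1 𝕜 N) :=
  {u | ∀ R : EuclideanSpace ℝ (Fin N) ≃ₗᵢ[ℝ] EuclideanSpace ℝ (Fin N),
    ∀ᵐ x, u.fn (R x) = u.fn x}

/-- `S_r(c) = S(c) ∩ H¹_r`. -/
def radialMassSphere (c : ℝ) : Set (H1 𝕜 N) := massSphere 𝕜 N c ∩ radialSet 𝕜 N

/-- The best constant `𝒮` in the Sobolev inequality `𝒮 ‖u‖_{2*}² ≤ ‖∇u‖₂²`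
(`H¹` being dense in the homogeneous space, both spaces give the same constant). -/
def sobolevConst : ℝ :=
  sSup {A : ℝ | ∀ u : H1 𝕜 N, A * lpNorm (critExp N) u ^ 2 ≤ ‖u.grad‖ ^ 2}

/-- The best constant `C_{N,q}` in the Gagliardo–Nirenberg inequality
`‖u‖_q ≤ C ‖∇u‖₂^β ‖u‖₂^{1-β}`, where `β = N(1/2 - 1/q)`. -/
def gagliardoConst (q : ℝ) : ℝ :=
  sInf {C : ℝ | 0 ≤ C ∧ ∀ u : H1 𝕜 N,
    lpNorm q u ≤ C * ‖u.grad‖ ^ (N * (1 / 2 - 1 / q) : ℝ)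
      * ‖u.fn‖ ^ (1 - N * (1 / 2 - 1 / q) : ℝ)}

end

/-! ### The mass threshold `c₀` and the radius `ρ₀`

The two inequalities above give `F_μ(u) ≥ ρ f(c, ρ)` for `u ∈ S(c)`, `ρ = ‖∇u‖₂²`, with
`f(c, ρ) = 1/2 - (μ/q) C^q ρ^{α₀} c^{α₁} - (1/2*) 𝒮^{-2*/2} ρ^{α₂}`. For every `c > 0` the
function `f(c, ·)` has a unique maximum point, and the maximum is positive, zero or negative
according as `c < c₀`, `c = c₀` or `c > c₀`; `ρ₀` is the maximum point of `f(c₀, ·)`. -/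

/-- `α₀ = N(q-2)/4 - 1`. -/
def alphaZero (N : ℕ) (q : ℝ) : ℝ := N * (q - 2) / 4 - 1

/-- `α₁ = (2N - q(N-2))/4`. -/
def alphaOne (N : ℕ) (q : ℝ) : ℝ := (2 * N - q * (N - 2)) / 4

/-- `α₂ = 2/(N-2)`. -/
def alphaTwo (N : ℕ) : ℝ := 2 / (N - 2)

section

variable (𝕜 : Type*) [RCLike 𝕜] (N : ℕ)

/-- `-(α₀/α₂) · μ C^q 𝒮^{2*/2} 2*/q`. -/
def thresholdBase (q μ : ℝ) : ℝ :=
  -(alphaZero N q / alphaTwo N) *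
    (μ * gagliardoConst 𝕜 N q ^ q * sobolevConst 𝕜 N ^ (critExp N / 2) * critExp N / q)

/-- The constant `K` for which `max_ρ f(c, ρ) = 1/2 - K c^{2/N}`. -/
def thresholdK (q μ : ℝ) : ℝ :=
  μ / q * gagliardoConst 𝕜 N q ^ q
      * thresholdBase 𝕜 N q μ ^ (alphaZero N q / (alphaTwo N - alphaZero N q))
    + 1 / critExp N * (1 / sobolevConst 𝕜 N ^ (critExp N / 2))
      * thresholdBase 𝕜 N q μ ^ (alphaTwo N / (alphaTwo N - alphaZero N q))

/-- The threshold mass `c₀ = c₀(μ) = (1/(2K))^{N/2}`. -/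
def massThreshold (q μ : ℝ) : ℝ := (1 / (2 * thresholdK 𝕜 N q μ)) ^ ((N : ℝ) / 2)

/-- The radius `ρ₀`. -/
def rhoZero (q μ : ℝ) : ℝ :=
  thresholdBase 𝕜 N q μ ^ (1 / (alphaTwo N - alphaZero N q))
    * massThreshold 𝕜 N q μ ^ (alphaOne N q / (alphaTwo N - alphaZero N q))

/-- `V(c) = {u ∈ S(c) : ‖∇u‖₂² < ρ₀}`. -/
def wellSet (q μ c : ℝ) : Set (H1 𝕜 N) :=
  {u | u ∈ massSphere 𝕜 N c ∧ ‖u.grad‖ ^ 2 < rhoZero 𝕜 N q μ}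

/-- `m(c) = inf_{V(c)} F_μ`. -/
def wellLevel (q μ c : ℝ) : ℝ := sInf (energy q μ '' wellSet 𝕜 N q μ c)

/-- `Λ(c) = {u ∈ S(c) : Q_μ(u) = 0}`. -/
def pohozaevSet (q μ c : ℝ) : Set (H1 𝕜 N) :=
  {u | u ∈ massSphere 𝕜 N c ∧ pohozaev q μ u = 0}

/-- `Λ⁻_r(c) = {u ∈ Λ(c) : F_μ(u) < 0} ∩ H¹_r`. -/
def radialLambdaMinus (q μ c : ℝ) : Set (H1 𝕜 N) :=
  {u | u ∈ pohozaevSet 𝕜 N q μ c ∧ energy q μ u < 0} ∩ radialSet 𝕜 N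

/-- `E_c = {u ∈ S(c) : F_μ(u) < 2 m(c)}`. -/
def lowEnergySet (q μ c : ℝ) : Set (H1 𝕜 N) :=
  {u | u ∈ massSphere 𝕜 N c ∧ energy q μ u < 2 * wellLevel 𝕜 N q μ c}

/-- `Γ⁰(c)`: the continuous paths `g : [0, ∞) → S_r(c)` with `g(0) ∈ Λ⁻_r(c)` that stay in `E_c`
from some time on. -/
def radialPaths (q μ c : ℝ) : Set C(ℝ≥0, H1 𝕜 N) :=
  {g | (∀ t, g t ∈ radialMassSphere 𝕜 N c) ∧ g 0 ∈ radialLambdaMinus 𝕜 N q μ c ∧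
    ∃ T : ℝ≥0, ∀ t, T ≤ t → g t ∈ lowEnergySet 𝕜 N q μ c}

/-- The mountain pass level `M⁰(c) = inf_{g ∈ Γ⁰(c)} max_{t ∈ [0,∞)} F_μ(g(t))`. -/
def mountainPassLevel (q μ c : ℝ) : ℝ :=
  sInf ((fun g : C(ℝ≥0, H1 𝕜 N) => ⨆ t : ℝ≥0, energy q μ (g t)) '' radialPaths 𝕜 N q μ c)

end

section

variable {𝕜 : Type*} [RCLike 𝕜] {N : ℕ}

/-- The tangent space `T_u S(c) = {v ∈ H¹ : ⟨u, v⟩_{L²} = 0}`; for complex functions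
`⟨u, v⟩_{L²}` is the real inner product `Re ∫ ū v`. -/
def tangentSpace (u : H1 𝕜 N) : Submodule ℝ (H1 𝕜 N) where
  carrier := {v | RCLike.re (inner 𝕜 u.fn v.fn) = 0}
  add_mem' {v w} hv hw := by
    have h : (v + w).fn = v.fn + w.fn := rfl
    simp only [Set.mem_ofPred_eq] at *
    rw [h, inner_add_right, map_add, hv, hw, add_zero]
  zero_mem' := by
    have h : (0 : H1 𝕜 N).fn = 0 := rfl
    simp [h]
  smul_mem' a v hv := by
    have h : (a • v).fn = a • v.fn := rfl
    simp only [Set.mem_ofPred_eq] at *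
    rw [h, inner_smul_right_eq_smul, RCLike.smul_re, hv, mul_zero]

/-- `u` is a Palais–Smale sequence at level `l` for `F_μ` restricted to `S(c)`: it lies in `S(c)`,
`F_μ(uₙ) → l`, and the differential of `F_μ` at `uₙ`, restricted to `T_{uₙ} S(c)`, tends to `0` in
the norm of the dual space `(T_{uₙ} S(c))*`. -/
def IsPalaisSmale (q μ c l : ℝ) (u : ℕ → H1 𝕜 N) : Prop :=
  (∀ n, u n ∈ massSphere 𝕜 N c) ∧
  Tendsto (fun n => energy q μ (u n)) atTop (𝓝 l) ∧
  (∀ n, DifferentiableAt ℝ (energy q μ) (u n)) ∧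
  Tendsto (fun n => ‖(fderiv ℝ (energy q μ) (u n)).comp (tangentSpace (u n)).subtypeL‖)
    atTop (𝓝 0)

end

end NormalizedNLS

end

noncomputable section

namespace NormalizedNLS

/-! On `S(c)` the Sobolev and Gagliardo–Nirenberg inequalities bound the energy below by `wellFun`,
a function of `c` and `ρ = ‖∇u‖₂²`. The constants are tuned so that this bound vanishes at `c = c₀`,
`ρ = ρ₀`. It is strictly decreasing in `c`, so for `c < c₀` the energy has a positive lower bound on
the barrier `‖∇u‖₂² = ρ₀`. A point of `Λ⁻_r(c)` lies inside the barrier, since otherwise dilating it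
down to the barrier would keep its energy negative. A point of `E_c` does not lie inside, because `2
m(c) < m(c) < 0`. Hence every path of `Γ⁰(c)` crosses the barrier, and `M⁰(c) > 0` while the energy
is negative at both ends (`Regime.mountainPassLevel_pos`).

To obtain `Q_μ(uₙ) → 0` as well, the minimax is carried out, following Jeanjean, for `Φ(u, s) =
F_μ(s ⋆ u)` on `S_r(c) × ℝ`, where `(s ⋆ u)(x) = e^{Ns/2} u(e^s x)`. The map `(u, s) ↦ s ⋆ u` sends
admissible paths to admissible paths, so the level cannot drop, and `∂ₛΦ(u, s) = Q_μ(s ⋆ u)`.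
Ekeland's principle in the space of paths (`exists_almost_critical`), started from a nearly optimal
path with `s = 0`, gives almost critical points `(u, s)` of `Φ` with `s` small. Then `s ⋆ u` is
almost critical for `F_μ` and `Q_μ(s ⋆ u)` is small.

This controls the differential in radial directions only. By symmetric criticality
(`abs_le_of_invariant`), the Riesz representative of the differential on the tangent space is itself
radial, so the radial directions suffice.

The energy is `C¹` because `f ↦ ∫ |f|^r` has a quadratic remainder on `Lʳ` for `r > 2` and `H¹`
embeds into the relevant spaces. The Sobolev inequality on `H¹` follows from the smooth compactly
supported case by mollification and truncation.

Boundedness: `F_μ - Q_μ / 2*` contains no critical term. It equals `‖∇u‖₂² / N` up to a multiple of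
`‖u‖_q^q`, which is at most a constant times `(‖∇u‖₂²)^{1+α₀}` with `1 + α₀ < 1`. -/

/-! ### Ekeland's variational principle and a constrained minimax principle -/

/-- Ekeland's variational principle for a continuous function bounded from below. -/
theorem ekeland {X : Type*} [MetricSpace X] [CompleteSpace X] {f : X → ℝ}
    (hf : Continuous f) {l : ℝ} (hl : ∀ x, l ≤ f x) {ε : ℝ} (hε : 0 < ε) (x₀ : X) :
    ∃ x, f x + ε * dist x₀ x ≤ f x₀ ∧ ∀ y, f x ≤ f y + ε * dist x y := by
  -- Membership `y ∈ S x` is a preorder; the point sought attains the least value of `f` on its own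
  -- `S x`.
  let S : X → Set X := fun x => {y | f y + ε * dist x y ≤ f x}
  have hself : ∀ x, x ∈ S x := fun x => by simp [S]
  have htrans : ∀ x y z, y ∈ S x → z ∈ S y → z ∈ S x := by
    intro x y z hy hz
    simp only [S, Set.mem_ofPred_eq] at *
    nlinarith [dist_triangle x y z]
  have hbdd : ∀ x, BddBelow (f '' S x) := fun x => ⟨l, by rintro _ ⟨y, -, rfl⟩; exact hl y⟩
  have hstep : ∀ (n : ℕ) (x : X), ∃ y, y ∈ S x ∧ ∀ z ∈ S x, f y ≤ f z + (1 / 2) ^ n := by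
    intro n x
    obtain ⟨_, ⟨y, hy, rfl⟩, hlt⟩ := exists_lt_of_csInf_lt (s := f '' S x) ⟨_, x, hself x, rfl⟩
      (lt_add_of_pos_right (sInf (f '' S x)) (show (0 : ℝ) < (1 / 2) ^ n by positivity))
    refine ⟨y, hy, fun z hz => ?_⟩
    have := csInf_le (hbdd x) ⟨z, hz, rfl⟩
    linarith
  choose next hnext hnext' using hstep
  let u : ℕ → X := fun n => Nat.rec x₀ (fun n x => next n x) n
  have hu : ∀ n, u (n + 1) = next n (u n) := fun n => rfl
  have hmem : ∀ n m, n ≤ m → u m ∈ S (u n) := by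
    intro n m hnm
    induction m, hnm using Nat.le_induction with
    | base => exact hself _
    | succ m _ ih => exact htrans _ _ _ ih (by rw [hu]; exact hnext m (u m))
  have hanti : Antitone (fun n => f (u n)) := by
    intro n m hnm
    have h : f (u m) + ε * dist (u n) (u m) ≤ f (u n) := hmem n m hnm
    have : 0 ≤ ε * dist (u n) (u m) := by positivity
    show f (u m) ≤ f (u n)
    linarith
  have hconv := tendsto_atTop_ciInf hanti ⟨l, by rintro _ ⟨n, rfl⟩; exact hl _⟩
  have hcau : CauchySeq u := by
    rw [Metric.cauchySeq_iff']
    intro δ hδ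
    have hc := hconv.cauchySeq
    rw [Metric.cauchySeq_iff'] at hc
    obtain ⟨n, hn⟩ := hc (ε * δ) (by positivity)
    refine ⟨n, fun m hm => ?_⟩
    have h1 := hn m hm
    have h2 : f (u m) + ε * dist (u n) (u m) ≤ f (u n) := hmem n m hm
    rw [Real.dist_eq, abs_lt] at h1
    rw [dist_comm]
    have : ε * dist (u n) (u m) < ε * δ := by linarith [h1.1]
    exact lt_of_mul_lt_mul_left this hε.le
  obtain ⟨x, hx⟩ := cauchySeq_tendsto_of_complete hcau
  have hxS : ∀ n, x ∈ S (u n) := by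
    intro n
    have hclosed : IsClosed (S (u n)) :=
      isClosed_le (hf.add (continuous_const.mul (continuous_const.dist continuous_id)))
        continuous_const
    exact hclosed.mem_of_tendsto hx (eventually_atTop.2 ⟨n, fun m hm => hmem n m hm⟩)
  refine ⟨x, hxS 0, fun y => ?_⟩
  -- A point `y` of `S x` belongs to every `S (u n)`, so the near minimality of `u (n + 1)` there
  -- gives `f x ≤ f y`. For other points the failure of membership is the claim.
  by_cases hy : y ∈ S x
  · have h1 : ∀ n, f x ≤ f y + (1 / 2) ^ n := by
      intro n
      have h2 := hnext' n (u n) y (htrans _ _ _ (hxS n) hy)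
      rw [← hu] at h2
      have h3 : f x + ε * dist (u (n + 1)) x ≤ f (u (n + 1)) := hxS (n + 1)
      have : 0 ≤ ε * dist (u (n + 1)) x := by positivity
      linarith
    have h4 : Tendsto (fun n : ℕ => f y + (1 / 2 : ℝ) ^ n) atTop (𝓝 (f y + 0)) :=
      tendsto_const_nhds.add (tendsto_pow_atTop_nhds_zero_of_lt_one (by norm_num) (by norm_num))
    have h5 := ge_of_tendsto' h4 h1
    have : 0 ≤ ε * dist x y := by positivity
    linarith
  · simp only [S, Set.mem_ofPred_eq, not_le] at hy
    exact hy.le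

/-- Composition with `Φ` is continuous for the compact-open topology without any uniform continuity
of `Φ`, and the supremum is 1-Lipschitz on `C(T, ℝ)`. -/
theorem continuous_iSup_comp {T E : Type*} [TopologicalSpace T] [CompactSpace T] [Nonempty T]
    [MetricSpace E] {Φ : E → ℝ} (hΦ : Continuous Φ) :
    Continuous (fun g : C(T, E) => ⨆ t, Φ (g t)) := by
  have h1 : Continuous (fun g : C(T, E) => (⟨Φ, hΦ⟩ : C(E, ℝ)).comp g) :=
    ContinuousMap.continuous_postcomp _
  have h2 : LipschitzWith 1 (fun g : C(T, ℝ) => ⨆ t, g t) := by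
    refine LipschitzWith.of_le_add fun f g => ?_
    refine ciSup_le fun t => ?_
    have hb : BddAbove (Set.range fun t => g t) := (isCompact_range g.continuous).bddAbove
    have h3 := le_ciSup hb t
    have h4 := (abs_le.1 ((Real.dist_eq _ _).symm ▸ ContinuousMap.dist_apply_le_dist (f := f) (g := g) t)).2
    linarith
  exact h2.continuous.comp h1

/-- If the paths `G n`, equal to `g + hₙ X` up to second order in `hₙ → 0`, do not decrease the
maximum of `Φ` along `g` by more than `ε hₙ` to first order, then `Φ'(g t) (X t) ≥ -ε` at some
maximum point `t`. -/
theorem exists_max_fderiv_ge {T E : Type*} [MetricSpace T] [CompactSpace T]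
    [NormedAddCommGroup E] [NormedSpace ℝ E] {Φ : E → ℝ} (hΦ : ContDiff ℝ 1 Φ)
    (g X : C(T, E)) (G : ℕ → T → E) {h : ℕ → ℝ} (hh : ∀ n, 0 < h n)
    (hlim : Tendsto h atTop (𝓝 0)) {K ε : ℝ}
    (hG : ∀ n t, ‖G n t - g t - h n • X t‖ ≤ K * h n ^ 2)
    (hmax : ∀ n, ∃ t, ∀ s, Φ (g s) ≤ Φ (G n t) + ε * (h n + K * h n ^ 2)) :
    ∃ t, (∀ s, Φ (g s) ≤ Φ (g t)) ∧ -ε ≤ fderiv ℝ Φ (g t) (X t) := by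
  -- Points where the moved path `G n` almost reaches the maximum of `Φ` along `g`. They vary with
  -- `n`, and `t` is a cluster point of them.
  choose τ hτ using hmax
  obtain ⟨t, -, φ, hφ, hφt⟩ := isCompact_univ.tendsto_subseq (fun n => Set.mem_univ (τ n))
  have hh0 : Tendsto (fun n => h (φ n)) atTop (𝓝 0) := hlim.comp hφ.tendsto_atTop
  have hg : Tendsto (fun n => g (τ (φ n))) atTop (𝓝 (g t)) := (g.continuous.tendsto t).comp hφt
  have hX : Tendsto (fun n => X (τ (φ n))) atTop (𝓝 (X t)) := (X.continuous.tendsto t).comp hφt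
  have hq : Tendsto (fun n => (h (φ n))⁻¹ • (G (φ n) (τ (φ n)) - g (τ (φ n)))) atTop
      (𝓝 (X t)) := by
    have h1 : Tendsto (fun n => (h (φ n))⁻¹ • (G (φ n) (τ (φ n)) - g (τ (φ n)))
        - X (τ (φ n))) atTop (𝓝 0) := by
      refine squeeze_zero_norm (a := fun n => K * h (φ n)) (fun n => ?_) (by simpa using hh0.const_mul K)
      have hp := hh (φ n)
      have e : (h (φ n))⁻¹ • (G (φ n) (τ (φ n)) - g (τ (φ n))) - X (τ (φ n))
          = (h (φ n))⁻¹ • (G (φ n) (τ (φ n)) - g (τ (φ n)) - h (φ n) • X (τ (φ n))) := by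
        rw [smul_sub _ _ (h (φ n) • _), smul_smul, inv_mul_cancel₀ hp.ne', one_smul]
      rw [e, norm_smul, norm_inv, Real.norm_of_nonneg hp.le, inv_mul_le_iff₀ hp]
      have := hG (φ n) (τ (φ n))
      linarith [this, show h (φ n) * (K * h (φ n)) = K * h (φ n) ^ 2 by ring]
    simpa using h1.add hX
  have hd : Tendsto (fun n => G (φ n) (τ (φ n)) - g (τ (φ n))) atTop (𝓝 0) := by
    have := hh0.smul hq
    simp only [zero_smul] at this
    refine this.congr fun n => ?_
    rw [smul_smul, mul_inv_cancel₀ (hh _).ne', one_smul]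
  have hG' : Tendsto (fun n => G (φ n) (τ (φ n))) atTop (𝓝 (g t)) := by
    simpa using hd.add hg
  have herr : Tendsto (fun n => ε * (h (φ n) + K * h (φ n) ^ 2)) atTop (𝓝 0) := by
    have := ((hh0.add ((hh0.pow 2).const_mul K)).const_mul ε)
    simpa using this
  refine ⟨t, fun s => ?_, ?_⟩
  · have h1 : Tendsto (fun n => Φ (G (φ n) (τ (φ n))) + ε * (h (φ n) + K * h (φ n) ^ 2)) atTop
        (𝓝 (Φ (g t) + 0)) := ((hΦ.continuous.tendsto _).comp hG').add herr
    rw [add_zero] at h1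
    exact ge_of_tendsto' h1 fun n => hτ (φ n) s
  · set A := fderiv ℝ Φ (g t)
    -- Strict differentiability is needed because both ends of the increment from `g (τ n)` to `G n
    -- (τ n)` move with `n`.
    have hs : HasStrictFDerivAt Φ A (g t) := hΦ.contDiffAt.hasStrictFDerivAt one_ne_zero
    have ho := (hasStrictFDerivAt_iff_isLittleO.1 hs).comp_tendsto (hG'.prodMk_nhds hg)
    have hO : (fun n => G (φ n) (τ (φ n)) - g (τ (φ n))) =O[atTop] fun n => h (φ n) := by
      have h1 := (hq.isBigO_one ℝ)
      have h2 := (Asymptotics.isBigO_refl (fun n => h (φ n)) atTop).smul h1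
      refine (h2.congr_left fun n => ?_).congr_right fun n => by simp
      rw [smul_smul, mul_inv_cancel₀ (hh _).ne', one_smul]
    have ho2 := (ho.trans_isBigO hO).tendsto_div_nhds_zero
    have hA : Tendsto (fun n => A ((h (φ n))⁻¹ • (G (φ n) (τ (φ n)) - g (τ (φ n))))) atTop
      (𝓝 (A (X t))) := (A.continuous.tendsto _).comp hq
    have hsum := ho2.add hA
    rw [zero_add] at hsum
    have hlow : Tendsto (fun n => -ε * (1 + K * h (φ n))) atTop (𝓝 (-ε)) := by
      have := ((hh0.const_mul K).const_add 1).const_mul (-ε)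
      simpa using this
    refine le_of_tendsto_of_tendsto' hlow hsum fun n => ?_
    have hp := hh (φ n)
    have h1 := hτ (φ n) (τ (φ n))
    simp only [Function.comp_apply, map_smul, smul_eq_mul]
    rw [div_add' _ _ _ hp.ne', le_div_iff₀ hp, inv_mul_eq_div, div_mul_cancel₀ _ hp.ne']
    nlinarith

/-! ### Almost critical points on a sphere: the deformation argument and symmetric criticality. -/

section Minimax

variable {H W : Type*} [NormedAddCommGroup H] [InnerProductSpace ℝ H]
  [NormedAddCommGroup W] [InnerProductSpace ℝ W]

/-- Moving `u` in a tangential direction `x` and projecting back to the sphere `‖L ·‖² = c`. -/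
def sphereStep (L : H →L[ℝ] W) (c : ℝ) (u x : H) : H :=
  (√(1 + ‖L x‖ ^ 2 / c))⁻¹ • (u + x)

theorem norm_sphereStep (L : H →L[ℝ] W) {c : ℝ} (hc : 0 < c) {u x : H} (hu : ‖L u‖ ^ 2 = c)
    (hx : inner ℝ (L u) (L x) = 0) : ‖L (sphereStep L c u x)‖ ^ 2 = c := by
  have h1 : 0 < 1 + ‖L x‖ ^ 2 / c := by positivity
  rw [sphereStep, map_smul, norm_smul, mul_pow, map_add, norm_add_sq_real, hu, hx, norm_inv,
    inv_pow, Real.norm_of_nonneg (Real.sqrt_nonneg _), Real.sq_sqrt h1.le]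
  field_simp
  ring

/-- With `y = ‖L x‖² / c`, the normalizing factor lies between `1 - y` and `1`, so the projection
costs only a second order error, as `exists_max_fderiv_ge` requires. -/
theorem sphereStep_sub (L : H →L[ℝ] W) {c : ℝ} (hc : 0 < c) (u x : H) :
    ‖sphereStep L c u x - u - x‖ ≤ ‖L x‖ ^ 2 / c * ‖u + x‖ := by
  have hy : 0 ≤ ‖L x‖ ^ 2 / c := by positivity
  set y := ‖L x‖ ^ 2 / c
  have h1 : 1 ≤ √(1 + y) := Real.one_le_sqrt.2 (by linarith)
  have h2 : √(1 + y) ≤ 1 + y := by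
    rw [Real.sqrt_le_left (by linarith)]
    nlinarith
  have e : sphereStep L c u x - u - x = ((√(1 + y))⁻¹ - 1) • (u + x) := by
    rw [sphereStep, sub_smul, one_smul]; abel
  rw [e, norm_smul]
  gcongr
  rw [Real.norm_eq_abs, abs_le]
  have h3 : (√(1 + y))⁻¹ ≤ 1 := inv_le_one_of_one_le₀ h1
  refine ⟨?_, by linarith⟩
  have h4 : (1 + y)⁻¹ ≤ (√(1 + y))⁻¹ := inv_anti₀ (by linarith) h2
  have h5 : 1 - y ≤ (1 + y)⁻¹ := by
    rw [← one_div, le_div_iff₀ (by linarith)]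
    nlinarith
  linarith

/-- A substitute for `v / ‖v‖` that remains continuous at `v = 0`. -/
theorem norm_inv_add_smul_le {V : Type*} [NormedAddCommGroup V] [NormedSpace ℝ V] {ε : ℝ}
    (hε : 0 < ε) (v : V) : ‖(ε + ‖v‖)⁻¹ • v‖ ≤ 1 := by
  have : 0 < ε + ‖v‖ := by positivity
  rw [norm_smul, norm_inv, Real.norm_of_nonneg this.le, inv_mul_le_iff₀ this]
  linarith

theorem le_two_mul_of_sq_div_le {x ε : ℝ} (hε : 0 < ε) (hx : 0 ≤ x) (h : (ε + x)⁻¹ * x ^ 2 ≤ ε) :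
    x ≤ 2 * ε := by
  rw [inv_mul_le_iff₀ (by linarith)] at h
  nlinarith

variable [CompleteSpace H] [CompleteSpace W]

/-- The first component of the gradient of `Φ : H × ℝ → ℝ`. -/
def gradFst (Φ : H × ℝ → ℝ) (p : H × ℝ) : H :=
  (InnerProductSpace.toDual ℝ H).symm ((fderiv ℝ Φ p).comp (ContinuousLinearMap.inl ℝ H ℝ))

theorem inner_gradFst (Φ : H × ℝ → ℝ) (p : H × ℝ) (v : H) :
    inner ℝ (gradFst Φ p) v = fderiv ℝ Φ p (v, 0) := by
  simp [gradFst]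

theorem continuous_gradFst {Φ : H × ℝ → ℝ} (hΦ : ContDiff ℝ 1 Φ) : Continuous (gradFst Φ) :=
  (InnerProductSpace.toDual ℝ H).symm.continuous.comp
    ((hΦ.continuous_fderiv one_ne_zero).clm_comp continuous_const)

/-- The component of `gradFst Φ p` tangential to the level set of `‖L ·‖` through `p.1`. -/
def tangentGrad (L : H →L[ℝ] W) (Φ : H × ℝ → ℝ) (p : H × ℝ) : H :=
  let b := ContinuousLinearMap.adjoint L (L p.1)
  gradFst Φ p - (inner ℝ b (gradFst Φ p) / ‖b‖ ^ 2) • b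

theorem inner_tangentGrad (L : H →L[ℝ] W) (Φ : H × ℝ → ℝ) (p : H × ℝ) (hp : L p.1 ≠ 0) :
    inner ℝ (L p.1) (L (tangentGrad L Φ p)) = 0 := by
  -- The normal vector `L*(L u)` pairs with `u` to `‖L u‖²`, hence cannot vanish.
  have hb : ContinuousLinearMap.adjoint L (L p.1) ≠ 0 := by
    intro h0
    have h1 : inner ℝ (ContinuousLinearMap.adjoint L (L p.1)) p.1 = ‖L p.1‖ ^ 2 := by
      rw [ContinuousLinearMap.adjoint_inner_left, real_inner_self_eq_norm_sq]
    rw [h0, inner_zero_left] at h1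
    exact hp (by simpa using h1.symm)
  rw [← ContinuousLinearMap.adjoint_inner_left, tangentGrad, inner_sub_right, inner_smul_right,
    real_inner_self_eq_norm_sq, div_mul_cancel₀ _ (by simpa using hb), sub_self]

theorem inner_tangentGrad_of_tangent (L : H →L[ℝ] W) (Φ : H × ℝ → ℝ) (p : H × ℝ) {v : H}
    (hv : inner ℝ (L p.1) (L v) = 0) :
    inner ℝ (tangentGrad L Φ p) v = fderiv ℝ Φ p (v, 0) := by
  rw [tangentGrad, inner_sub_left, real_inner_smul_left,
    ContinuousLinearMap.adjoint_inner_left L v (L p.1), hv, mul_zero, sub_zero, inner_gradFst]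

theorem continuousOn_tangentGrad (L : H →L[ℝ] W) {Φ : H × ℝ → ℝ} (hΦ : ContDiff ℝ 1 Φ) :
    ContinuousOn (tangentGrad L Φ) {p | L p.1 ≠ 0} := by
  have hb : Continuous fun p : H × ℝ => ContinuousLinearMap.adjoint L (L p.1) := by fun_prop
  have hg := continuous_gradFst hΦ
  refine hg.continuousOn.sub (ContinuousOn.smul (ContinuousOn.div
    (hb.inner hg).continuousOn (hb.norm.pow 2).continuousOn ?_) hb.continuousOn)
  intro p hp
  have h1 : inner ℝ (ContinuousLinearMap.adjoint L (L p.1)) p.1 = ‖L p.1‖ ^ 2 := by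
    rw [ContinuousLinearMap.adjoint_inner_left, real_inner_self_eq_norm_sq]
  intro h0
  have h0' : ContinuousLinearMap.adjoint L (L p.1) = 0 := by simpa using h0
  rw [h0', inner_zero_left] at h1
  exact hp (by simpa using h1.symm)

/-- Constrained minimax principle: if every path in `{‖L u‖² = c} × ℝ` with the endpoints of `γ`
meets `{Φ ≥ l}`, while `Φ ≤ l + ε²` along `γ` and `Φ < l` at its endpoints, then there is an
almost critical point of `Φ` on `{‖L u‖² = c} × ℝ`, at level about `l` and close to `γ`. -/
theorem exists_almost_critical (L : H →L[ℝ] W) {Φ : H × ℝ → ℝ} (hΦ : ContDiff ℝ 1 Φ)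
    {c l ε : ℝ} (hc : 0 < c) (hε : 0 < ε) (γ : C(unitInterval, H × ℝ))
    (hγ : ∀ t, ‖L (γ t).1‖ ^ 2 = c) (h0 : Φ (γ 0) < l) (h1 : Φ (γ 1) < l)
    (hle : ∀ t, Φ (γ t) ≤ l + ε ^ 2)
    (hmin : ∀ g : C(unitInterval, H × ℝ), (∀ t, ‖L (g t).1‖ ^ 2 = c) → g 0 = γ 0 → g 1 = γ 1 →
      ∃ t, l ≤ Φ (g t)) :
    ∃ p : H × ℝ, ‖L p.1‖ ^ 2 = c ∧ (∃ t, dist (γ t) p ≤ ε) ∧ l ≤ Φ p ∧ Φ p ≤ l + ε ^ 2 ∧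
      |fderiv ℝ Φ p (0, 1)| ≤ 2 * ε ∧
      ∀ v, inner ℝ (L p.1) (L v) = 0 → |fderiv ℝ Φ p (v, 0)| ≤ 2 * ε * ‖v‖ := by
  let P : Set C(unitInterval, H × ℝ) :=
    {g | (∀ t, ‖L (g t).1‖ ^ 2 = c) ∧ g 0 = γ 0 ∧ g 1 = γ 1}
  have hPclosed : IsClosed P := by
    have hev : ∀ t, Continuous fun g : C(unitInterval, H × ℝ) => g t := fun t =>
      continuous_eval_const t
    refine IsClosed.and ?_ (IsClosed.and (isClosed_eq (hev 0) continuous_const)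
      (isClosed_eq (hev 1) continuous_const))
    simp only [Set.ofPred_forall]
    refine isClosed_iInter fun t => isClosed_eq ?_ continuous_const
    exact (L.continuous.comp (continuous_fst.comp (hev t))).norm.pow 2
  have : CompleteSpace P := hPclosed.completeSpace_coe
  let I : C(unitInterval, H × ℝ) → ℝ := fun g => ⨆ t, Φ (g t)
  have hIc : Continuous I := continuous_iSup_comp hΦ.continuous
  have hIb : ∀ g : C(unitInterval, H × ℝ), BddAbove (Set.range fun t => Φ (g t)) := fun g =>
    (isCompact_range (hΦ.continuous.comp g.continuous)).bddAbove
  -- Since `I ≥ l` on `P` and `I γ ≤ l + ε²`, Ekeland's principle with slope `ε` moves the path by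
  -- at most `ε`.
  obtain ⟨⟨g, hgP⟩, hg1, hg2⟩ := ekeland (X := P) (f := fun g => I g.1)
    (hIc.comp continuous_subtype_val) (l := l) (fun g => by
      obtain ⟨t, ht⟩ := hmin g.1 g.2.1 g.2.2.1 g.2.2.2
      exact ht.trans (le_ciSup (hIb g.1) t)) hε ⟨γ, hγ, rfl, rfl⟩
  obtain ⟨hgc, hg0, hgl⟩ := hgP
  have hIγ : I γ ≤ l + ε ^ 2 := ciSup_le hle
  have hIg : l ≤ I g := by
    obtain ⟨t, ht⟩ := hmin g hgc hg0 hgl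
    exact ht.trans (le_ciSup (hIb g) t)
  have hdist : dist γ g ≤ ε := by
    have : I g + ε * dist γ g ≤ I γ := hg1
    have h2 : ε * dist γ g ≤ ε * ε := by nlinarith
    exact le_of_mul_le_mul_left h2 hε
  have hIg' : I g ≤ l + ε ^ 2 := by
    have h2 : I g + ε * dist γ g ≤ I γ := hg1
    have : 0 ≤ ε * dist γ g := by positivity
    linarith
  have hLg : ∀ t, L (g t).1 ≠ 0 := fun t h => by
    have := hgc t
    rw [h] at this
    simp at this
    linarith
  -- the descent field along `g`
  set m := max (Φ (γ 0)) (Φ (γ 1)) with hm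
  have hml : m < l := max_lt h0 h1
  -- The cut-off vanishes where `Φ ≤ m`, so the endpoints stay fixed, and equals `1` where `Φ ≥ l`,
  -- in particular at the maximum points of `Φ` along `g`.
  let χ : unitInterval → ℝ := fun t => min 1 (max 0 ((Φ (g t) - m) / (l - m)))
  have hχ0 : ∀ t, 0 ≤ χ t := fun t => le_min zero_le_one (le_max_left _ _)
  have hχ1 : ∀ t, χ t ≤ 1 := fun t => min_le_left _ _
  have hχc : Continuous χ := by
    have := hΦ.continuous.comp g.continuous
    exact continuous_const.min (continuous_const.max ((this.sub continuous_const).div_const _))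
  have hχend : ∀ t, Φ (g t) ≤ m → χ t = 0 := by
    intro t ht
    have : (Φ (g t) - m) / (l - m) ≤ 0 := div_nonpos_of_nonpos_of_nonneg (by linarith) (by linarith)
    simp only [χ]
    rw [max_eq_left this]
    simp
  have hχtop : ∀ t, l ≤ Φ (g t) → χ t = 1 := by
    intro t ht
    have : 1 ≤ (Φ (g t) - m) / (l - m) := by
      rw [le_div_iff₀ (by linarith)]
      linarith
    exact min_eq_left (this.trans (le_max_right _ _))
  let v : unitInterval → H := fun t => tangentGrad L Φ (g t)
  let w : unitInterval → ℝ := fun t => fderiv ℝ Φ (g t) (0, 1)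
  have hvc : Continuous v := (continuousOn_tangentGrad L hΦ).comp_continuous g.continuous hLg
  have hwc : Continuous w :=
    ((hΦ.continuous_fderiv one_ne_zero).comp g.continuous).clm_apply continuous_const
  -- The two components are normalized separately: `H × ℝ` carries the sup norm, so this still gives
  -- `‖X t‖ ≤ 1`.
  let X1 : unitInterval → H := fun t => -(χ t • ((ε + ‖v t‖)⁻¹ • v t))
  let X2 : unitInterval → ℝ := fun t => -(χ t • ((ε + ‖w t‖)⁻¹ • w t))
  have hX1c : Continuous X1 := (hχc.smul (((continuous_const.add hvc.norm).inv₀ fun t =>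
    (add_pos_of_pos_of_nonneg hε (norm_nonneg _)).ne').smul hvc)).neg
  have hX2c : Continuous X2 := (hχc.smul (((continuous_const.add hwc.norm).inv₀ fun t =>
    (add_pos_of_pos_of_nonneg hε (norm_nonneg _)).ne').smul hwc)).neg
  have hX1n : ∀ t, ‖X1 t‖ ≤ 1 := by
    intro t
    rw [norm_neg, norm_smul, Real.norm_of_nonneg (hχ0 t)]
    exact mul_le_one₀ (hχ1 t) (norm_nonneg _) (norm_inv_add_smul_le hε _)
  have hX2n : ∀ t, ‖X2 t‖ ≤ 1 := by
    intro t
    rw [norm_neg, norm_smul, Real.norm_of_nonneg (hχ0 t)]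
    exact mul_le_one₀ (hχ1 t) (norm_nonneg _) (norm_inv_add_smul_le hε _)
  have hX1t : ∀ t, inner ℝ (L (g t).1) (L (X1 t)) = 0 := by
    intro t
    simp only [X1, map_neg, map_smul, inner_neg_right, inner_smul_right]
    rw [inner_tangentGrad L Φ (g t) (hLg t)]
    simp
  let X : C(unitInterval, H × ℝ) := ⟨fun t => (X1 t, X2 t), hX1c.prodMk hX2c⟩
  obtain ⟨R, hR⟩ : ∃ R, ∀ t, ‖(g t).1‖ ≤ R := by
    obtain ⟨R, hR⟩ := (isCompact_range (continuous_fst.comp g.continuous).norm).bddAbove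
    exact ⟨R, fun t => hR ⟨t, rfl⟩⟩
  set K := ‖L‖ ^ 2 / c * (R + 1) with hK
  have hR0 : 0 ≤ R := (norm_nonneg _).trans (hR 0)
  let G : ℕ → unitInterval → H × ℝ := fun n t =>
    (sphereStep L c (g t).1 ((1 / ((n : ℝ) + 1)) • X1 t), (g t).2 + (1 / ((n : ℝ) + 1)) • X2 t)
  have hpos : ∀ n : ℕ, (0 : ℝ) < 1 / ((n : ℝ) + 1) := fun n => by positivity
  have hle1 : ∀ n : ℕ, (1 : ℝ) / ((n : ℝ) + 1) ≤ 1 := fun n => by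
    rw [div_le_one (by positivity)]
    linarith [(Nat.cast_nonneg n : (0 : ℝ) ≤ n)]
  have hGc : ∀ n, Continuous (G n) := by
    intro n
    have e1 : Continuous fun t => (1 / ((n : ℝ) + 1)) • X1 t := hX1c.const_smul _
    have e2 : Continuous fun t => (1 / ((n : ℝ) + 1)) • X2 t := by fun_prop
    refine Continuous.prodMk ?_ ((continuous_snd.comp g.continuous).add e2)
    refine Continuous.smul (Continuous.inv₀ ?_ ?_) ((continuous_fst.comp g.continuous).add e1)
    · exact ((((L.continuous.comp e1).norm.pow 2).div_const c).const_add 1).sqrt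
    · intro t
      positivity
  have hGX : ∀ n t, ‖G n t - g t - (1 / ((n : ℝ) + 1)) • X t‖ ≤ K * (1 / ((n : ℝ) + 1)) ^ 2 := by
    intro n t
    set h := 1 / ((n : ℝ) + 1)
    have hh := hpos n
    have hh1 := hle1 n
    refine max_le ?_ ?_
    · refine (sphereStep_sub L hc (g t).1 (h • X1 t)).trans ?_
      have e1 : ‖h • X1 t‖ ≤ h := by
        rw [norm_smul, Real.norm_of_nonneg hh.le]
        exact mul_le_of_le_one_right hh.le (hX1n t)
      have e2 : ‖L (h • X1 t)‖ ≤ ‖L‖ * h := (L.le_opNorm _).trans (by gcongr)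
      have e3 : ‖(g t).1 + h • X1 t‖ ≤ R + 1 :=
        (norm_add_le _ _).trans (add_le_add (hR t) (e1.trans hh1))
      calc ‖L (h • X1 t)‖ ^ 2 / c * ‖(g t).1 + h • X1 t‖
          ≤ (‖L‖ * h) ^ 2 / c * (R + 1) := by gcongr
        _ = K * h ^ 2 := by rw [hK]; ring
    · have : (G n t - g t - h • X t).2 = 0 := by
        simp [G, X, h]
      rw [this, norm_zero]
      positivity
  have hXend : ∀ t, Φ (g t) ≤ m → ∀ n, G n t = g t := by
    intro t ht n
    have z := hχend t ht
    simp [G, X1, X2, z, sphereStep]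
  have hGP : ∀ n, (⟨G n, hGc n⟩ : C(unitInterval, H × ℝ)) ∈ P := by
    intro n
    refine ⟨fun t => ?_, ?_, ?_⟩
    · refine norm_sphereStep L hc (hgc t) ?_
      rw [map_smul, inner_smul_right, hX1t, mul_zero]
    · exact (hXend 0 (by rw [hg0]; exact le_max_left _ _) n).trans hg0
    · exact (hXend 1 (by rw [hgl]; exact le_max_right _ _) n).trans hgl
  obtain ⟨t, ht, hder⟩ := exists_max_fderiv_ge (ε := ε) hΦ g X G hpos
    tendsto_one_div_add_atTop_nhds_zero_nat hGX (by
      intro n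
      have e1 : I g ≤ I ⟨G n, hGc n⟩ + ε * dist g ⟨G n, hGc n⟩ := hg2 ⟨_, hGP n⟩
      obtain ⟨t, -, ht⟩ := isCompact_univ.exists_isMaxOn Set.univ_nonempty
        (hΦ.continuous.comp (hGc n)).continuousOn
      refine ⟨t, fun s => ?_⟩
      have e2 : I ⟨G n, hGc n⟩ ≤ Φ (G n t) := ciSup_le fun s => ht (Set.mem_univ s)
      have e3 : dist g ⟨G n, hGc n⟩ ≤ 1 / ((n : ℝ) + 1) + K * (1 / ((n : ℝ) + 1)) ^ 2 := by
        rw [dist_comm, ContinuousMap.dist_le (by positivity)]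
        intro s
        rw [dist_eq_norm]
        have hX : ‖X s‖ ≤ 1 := max_le (hX1n s) (hX2n s)
        calc ‖G n s - g s‖ = ‖(1 / ((n : ℝ) + 1)) • X s
              + (G n s - g s - (1 / ((n : ℝ) + 1)) • X s)‖ := by congr 1; abel
          _ ≤ _ := by
            refine (norm_add_le _ _).trans (add_le_add ?_ (hGX n s))
            rw [norm_smul, Real.norm_of_nonneg (hpos n).le]
            exact mul_le_of_le_one_right (hpos n).le hX
      have e4 := le_ciSup (hIb g) s
      have e5 := mul_le_mul_of_nonneg_left e3 hε.le
      show Φ (g s) ≤ _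
      have e6 : Φ (g s) ≤ I g := e4
      linarith)
  have htop : Φ (g t) = I g := le_antisymm (le_ciSup (hIb g) t) (ciSup_le ht)
  have hχt := hχtop t (htop ▸ hIg)
  -- At this maximum point the cut-off is `1`, and the derivative is minus a sum of two nonnegative
  -- terms. Being at least `-ε`, it forces each term to be at most `ε`.
  have hsplit : fderiv ℝ Φ (g t) (X t)
      = -((ε + ‖v t‖)⁻¹ * ‖v t‖ ^ 2) - (ε + |w t|)⁻¹ * |w t| ^ 2 := by
    have e1 : X t = (X1 t, 0) + X2 t • ((0 : H), (1 : ℝ)) := by simp [X]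
    have e2 : fderiv ℝ Φ (g t) (X1 t, 0) = -((ε + ‖v t‖)⁻¹ * ‖v t‖ ^ 2) := by
      rw [← inner_tangentGrad_of_tangent L Φ (g t) (hX1t t)]
      simp only [X1, hχt, one_smul, inner_neg_right, inner_smul_right]
      rw [real_inner_self_eq_norm_sq]
    rw [e1, map_add, map_smul, e2]
    simp only [X2, hχt, smul_eq_mul, Real.norm_eq_abs, sq_abs, w]
    ring
  rw [hsplit] at hder
  have p1 : 0 ≤ (ε + ‖v t‖)⁻¹ * ‖v t‖ ^ 2 := by positivity
  have p2 : 0 ≤ (ε + |w t|)⁻¹ * |w t| ^ 2 := by positivity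
  have q1 : ‖v t‖ ≤ 2 * ε := le_two_mul_of_sq_div_le hε (norm_nonneg _) (by linarith)
  have q2 : |w t| ≤ 2 * ε := le_two_mul_of_sq_div_le hε (abs_nonneg _) (by linarith)
  refine ⟨g t, hgc t, ⟨t, (ContinuousMap.dist_apply_le_dist t).trans hdist⟩, htop ▸ hIg,
    htop ▸ hIg', q2, fun x hx => ?_⟩
  rw [← inner_tangentGrad_of_tangent L Φ (g t) hx]
  exact (abs_real_inner_le_norm _ _).trans (by gcongr)

/-- Symmetric criticality: if a linear form `ℓ` and `⟪L v, L ·⟫` are invariant under a family of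
linear isometries, then `ℓ` is controlled on `{w | ⟪L v, L w⟫ = 0}` by its values at the fixed
points of the family. -/
theorem abs_le_of_invariant {ι : Type*} (L : H →L[ℝ] W) (ℓ : H →L[ℝ] ℝ) (T : ι → H →ₗᵢ[ℝ] H)
    {v : H} (hv : L v ≠ 0) (hℓ : ∀ i w, ℓ (T i w) = ℓ w)
    (hL : ∀ i w, inner ℝ (L v) (L (T i w)) = inner ℝ (L v) (L w)) {K : ℝ} (hK : 0 ≤ K)
    (h : ∀ w, (∀ i, T i w = w) → inner ℝ (L v) (L w) = 0 → |ℓ w| ≤ K * ‖w‖) {w : H}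
    (hw : inner ℝ (L v) (L w) = 0) : |ℓ w| ≤ K * ‖w‖ := by
  -- The form is viewed on `H × ℝ` with a dummy real variable, so that `tangentGrad` applies.
  let Φ : H × ℝ →L[ℝ] ℝ := ℓ.comp (ContinuousLinearMap.fst ℝ H ℝ)
  have hΦ : ∀ w, fderiv ℝ Φ (v, 0) (w, 0) = ℓ w := fun w => by
    rw [Φ.fderiv]
    rfl
  set p := tangentGrad L Φ (v, 0) with hp
  have hpt : inner ℝ (L v) (L p) = 0 := inner_tangentGrad L Φ (v, 0) hv
  have hform : ∃ κ : ℝ, ∀ w, inner ℝ p w = ℓ w - κ * inner ℝ (L v) (L w) := by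
    refine ⟨inner ℝ (ContinuousLinearMap.adjoint L (L v)) (gradFst Φ (v, 0))
      / ‖ContinuousLinearMap.adjoint L (L v)‖ ^ 2, fun w => ?_⟩
    rw [hp, tangentGrad, inner_sub_left, real_inner_smul_left, inner_gradFst, hΦ,
      ContinuousLinearMap.adjoint_inner_left L w (L v)]
  obtain ⟨κ, hκ⟩ := hform
  -- The vector `p` represents `ℓ - κ ⟪L v, L ·⟫`, which is invariant, so `⟪p, T p⟫ = ‖p‖²`.
  -- Together with `‖T p‖ = ‖p‖` this gives `‖T p - p‖² = 0`; the hypothesis can then be tested on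
  -- `p` itself.
  have hpf : ∀ i, T i p = p := by
    intro i
    have hinv : inner ℝ p (T i p) = inner ℝ p p := by rw [hκ, hκ, hℓ, hL]
    have h4 : ‖T i p - p‖ ^ 2 = 0 := by
      rw [norm_sub_sq_real, real_inner_comm, hinv, real_inner_self_eq_norm_sq,
        LinearIsometry.norm_map]
      ring
    exact sub_eq_zero.1 (norm_eq_zero.1 (pow_eq_zero_iff two_ne_zero |>.1 h4))
  have hpw : ∀ w : H, inner ℝ (L v) (L w) = 0 → inner ℝ p w = ℓ w := fun w hw => by
    rw [hκ, hw, mul_zero, sub_zero]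
  have hpK : ‖p‖ ≤ K := by
    have h5 := h p hpf hpt
    rw [← hpw p hpt, real_inner_self_eq_norm_sq, abs_of_nonneg (sq_nonneg _)] at h5
    rcases (norm_nonneg p).eq_or_lt with h0 | h0
    · rw [← h0]; exact hK
    · nlinarith
  rw [← hpw _ hw]
  exact (abs_real_inner_le_norm _ _).trans (mul_le_mul_of_nonneg_right hpK (norm_nonneg _))

end Minimax

/-! ### The functional `f ↦ ∫ ‖f‖ ^ r` is of class `C¹` on `Lʳ`, `r > 2` -/

/-- A quadratic remainder, uniform on balls, yields more than differentiability: comparing the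
expansions of `Φ (y + z)` at `x` and at `y` shows that `A` is locally Lipschitz. -/
theorem contDiff_one_of_quadratic_remainder {E : Type*} [NormedAddCommGroup E] [NormedSpace ℝ E]
    {Φ : E → ℝ} (A : E → E →L[ℝ] ℝ) (B : ℝ → ℝ)
    (h : ∀ R x y, ‖x‖ ≤ R → ‖y‖ ≤ R → |Φ y - Φ x - A x (y - x)| ≤ B R * ‖y - x‖ ^ 2) :
    ContDiff ℝ 1 Φ := by
  have hB : ∀ R, ∃ C, 0 ≤ C ∧ B R ≤ C := fun R => ⟨max 0 (B R), le_max_left _ _, le_max_right _ _⟩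
  refine contDiff_one_iff_hasFDerivAt.2 ⟨A, ?_, fun x => ?_⟩
  · rw [continuous_iff_continuousAt]
    intro x
    obtain ⟨C, hC0, hC⟩ := hB (3 * (‖x‖ + 1))
    have key : ∀ y, ‖y - x‖ ≤ 1 → ‖A y - A x‖ ≤ 6 * C * ‖y - x‖ := by
      intro y hy
      set d := ‖y - x‖ with hd
      rcases (norm_nonneg (y - x)).eq_or_lt with h0 | h0
      · have : y = x := by rw [← sub_eq_zero, ← norm_eq_zero]; exact h0.symm
        rw [this]
        simp only [sub_self, norm_zero]
        positivity
      have hyn : ‖y‖ ≤ ‖x‖ + 1 := by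
        have := norm_add_le (y - x) x
        rw [sub_add_cancel] at this
        linarith
      have hx0 := norm_nonneg x
      -- Three remainders combine to `A y z - A x z`: from `x` to `y + z` (at most `4 C d²`, as the
      -- increment is at most `2 d`), from `y` to `y + z`, and from `x` to `y` (at most `C d²`
      -- each).
      have main : ∀ z, ‖z‖ = d → |A y z - A x z| ≤ 6 * C * d ^ 2 := by
        intro z hz
        have n1 : ‖y + z‖ ≤ 3 * (‖x‖ + 1) := (norm_add_le _ _).trans (by linarith)
        have e1 := (h (3 * (‖x‖ + 1)) y (y + z) (by linarith) n1).trans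
          (mul_le_mul_of_nonneg_right hC (sq_nonneg _))
        have e2 := (h (3 * (‖x‖ + 1)) x (y + z) (by linarith) n1).trans
          (mul_le_mul_of_nonneg_right hC (sq_nonneg _))
        have e3 := (h (3 * (‖x‖ + 1)) x y (by linarith) (by linarith)).trans
          (mul_le_mul_of_nonneg_right hC (sq_nonneg _))
        have r1 : y + z - y = z := by abel
        have r2 : y + z - x = (y - x) + z := by abel
        rw [r1, hz] at e1
        rw [r2, map_add] at e2
        have n2 : ‖y - x + z‖ ^ 2 ≤ 4 * d ^ 2 := by
          have := norm_add_le (y - x) z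
          have h4 : ‖y - x + z‖ ≤ 2 * d := by linarith
          nlinarith [norm_nonneg (y - x + z)]
        have n3 := mul_le_mul_of_nonneg_left n2 hC0
        rw [abs_le] at *
        constructor <;> linarith [e1.1, e1.2, e2.1, e2.2, e3.1, e3.2]
      refine ContinuousLinearMap.opNorm_le_bound _ (by positivity) fun z => ?_
      rcases (norm_nonneg z).eq_or_lt with hz | hz
      · have : z = 0 := by rw [← norm_eq_zero]; exact hz.symm
        simp [this]
      have h5 := main ((d / ‖z‖) • z) (by
        rw [norm_smul, Real.norm_of_nonneg (by positivity), div_mul_cancel₀ _ hz.ne'])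
      rw [map_smul, map_smul, ← smul_sub, smul_eq_mul, abs_mul, abs_of_pos (by positivity),
        div_mul_eq_mul_div, div_le_iff₀ hz] at h5
      rw [sub_apply, Real.norm_eq_abs]
      refine le_of_mul_le_mul_left (h5.trans_eq ?_) h0
      ring
    refine tendsto_iff_norm_sub_tendsto_zero.2 ?_
    have hl : Tendsto (fun y => 6 * C * ‖y - x‖) (𝓝 x) (𝓝 0) := by
      have : Continuous fun y => 6 * C * ‖y - x‖ := by fun_prop
      simpa using this.tendsto x
    refine squeeze_zero' (Eventually.of_forall fun _ => norm_nonneg _) ?_ hl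
    filter_upwards [Metric.closedBall_mem_nhds x one_pos] with y hy
    exact key y (by rwa [mem_closedBall_iff_norm] at hy)
  · obtain ⟨C, hC0, hC⟩ := hB (‖x‖ + 1)
    rw [hasFDerivAt_iff_isLittleO]
    have hO : (fun y => Φ y - Φ x - A x (y - x)) =O[𝓝 x] fun y => ‖y - x‖ ^ 2 := by
      refine Asymptotics.IsBigO.of_bound C ?_
      filter_upwards [Metric.closedBall_mem_nhds x one_pos] with y hy
      rw [mem_closedBall_iff_norm] at hy
      have hyn : ‖y‖ ≤ ‖x‖ + 1 := by
        have := norm_add_le (y - x) x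
        rw [sub_add_cancel] at this
        linarith
      have := h (‖x‖ + 1) x y (by linarith) hyn
      rw [Real.norm_eq_abs, Real.norm_of_nonneg (sq_nonneg _)]
      exact this.trans (mul_le_mul_of_nonneg_right hC (sq_nonneg _))
    refine hO.trans_isLittleO ?_
    have h2 : (fun y => ‖y - x‖) =o[𝓝 x] fun _ => (1 : ℝ) := by
      rw [Asymptotics.isLittleO_one_iff]
      have : Continuous fun y => ‖y - x‖ := by fun_prop
      simpa using this.tendsto x
    have h3 := h2.mul_isBigO (Asymptotics.isBigO_refl (fun y => ‖y - x‖) (𝓝 x))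
    refine ((h3.congr_left fun y => by ring).congr_right fun y => one_mul _).of_norm_right

/-- Convexity of `t ↦ t^k`, obtained from Bernoulli's inequality for `y / x`. -/
theorem rpow_tangent_le {x y k : ℝ} (hx : 0 ≤ x) (hy : 0 ≤ y) (hk : 1 < k) :
    x ^ k + k * x ^ (k - 1) * (y - x) ≤ y ^ k := by
  rcases hx.eq_or_lt with rfl | hx
  · rw [Real.zero_rpow (by linarith), Real.zero_rpow (by linarith)]
    simp only [mul_zero, zero_mul, add_zero]
    positivity
  · have h := one_add_mul_self_le_rpow_one_add (s := (y - x) / x)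
      (by rw [le_div_iff₀ hx]; linarith) hk.le
    have e : 1 + (y - x) / x = y / x := by field_simp; ring
    rw [e, Real.div_rpow hy hx.le, le_div_iff₀ (by positivity)] at h
    refine le_trans (le_of_eq ?_) h
    rw [Real.rpow_sub_one hx.ne']
    field_simp

/-- The factor `b` replaces a Lipschitz bound for `t ↦ t^s`, which fails near `0` when `s < 1`. For
`s > 1` it is the tangent inequality at `b`; for `s ≤ 1` it follows from `a / b ≤ (a / b)^s`. -/
theorem rpow_sub_rpow_mul_le {a b s : ℝ} (ha : 0 ≤ a) (hab : a ≤ b) (hs : 0 < s) :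
    (b ^ s - a ^ s) * b ≤ max 1 s * b ^ s * (b - a) := by
  have hb : 0 ≤ b := ha.trans hab
  rcases lt_or_ge 1 s with h1 | h1
  · have h := rpow_tangent_le hb ha h1
    rcases hb.eq_or_lt with rfl | hb'
    · have : a = 0 := le_antisymm hab ha
      simp [this]
    rw [max_eq_right h1.le]
    have e : b ^ (s - 1) * b = b ^ s := by rw [Real.rpow_sub_one hb'.ne']; field_simp
    have h2 : (b ^ s - a ^ s) ≤ s * b ^ (s - 1) * (b - a) := by linarith
    have h3 := mul_le_mul_of_nonneg_right h2 hb
    refine h3.trans_eq ?_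
    rw [← e]; ring
  · rw [max_eq_left h1, one_mul]
    rcases hb.eq_or_lt with rfl | hb'
    · have : a = 0 := le_antisymm hab ha
      simp [this]
    have hx0 : 0 ≤ a / b := by positivity
    have h := Real.rpow_le_rpow_of_exponent_ge' hx0 ((div_le_one hb').2 hab) hs.le h1
    rw [Real.rpow_one, Real.div_rpow ha hb, div_le_div_iff₀ hb' (by positivity)] at h
    nlinarith

/-- Second order bound for `t ↦ t ^ r` as a function of `t²`. -/
theorem rpow_quadratic_remainder {a b r : ℝ} (ha : 0 ≤ a) (hb : 0 ≤ b) (hr : 2 < r) :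
    |b ^ r - a ^ r - r / 2 * a ^ (r - 2) * (b ^ 2 - a ^ 2)|
      ≤ r * max 1 (r - 2) * (a + b) ^ (r - 2) * (b - a) ^ 2 := by
  have hsq : ∀ {x k : ℝ}, 0 ≤ x → (x ^ 2) ^ k = x ^ (2 * k) := fun hx => by
    rw [← Real.rpow_natCast, ← Real.rpow_mul hx]; norm_num
  -- The function `τ ↦ τ^{r/2}` is convex. The tangents at `a²` and `b²` show that the remainder is
  -- nonnegative and at most the difference of the slopes times `b² - a²`.
  have t1 := rpow_tangent_le (sq_nonneg a) (sq_nonneg b) (show 1 < r / 2 by linarith)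
  have t2 := rpow_tangent_le (sq_nonneg b) (sq_nonneg a) (show 1 < r / 2 by linarith)
  rw [hsq ha, hsq ha, hsq hb, show 2 * (r / 2) = r by ring,
    show 2 * (r / 2 - 1) = r - 2 by ring] at t1
  rw [hsq ha, hsq hb, hsq hb, show 2 * (r / 2) = r by ring,
    show 2 * (r / 2 - 1) = r - 2 by ring] at t2
  rw [abs_of_nonneg (by linarith)]
  have hM : 0 < max 1 (r - 2) := lt_max_of_lt_left one_pos
  have h1 : b ^ r - a ^ r - r / 2 * a ^ (r - 2) * (b ^ 2 - a ^ 2)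
      ≤ r / 2 * ((b ^ (r - 2) - a ^ (r - 2)) * (b ^ 2 - a ^ 2)) := by linarith
  refine h1.trans ?_
  have key : ∀ {a b : ℝ}, 0 ≤ a → a ≤ b →
      (b ^ (r - 2) - a ^ (r - 2)) * (b ^ 2 - a ^ 2)
        ≤ 2 * (max 1 (r - 2) * (a + b) ^ (r - 2) * (b - a) ^ 2) := by
    intro a b ha hab
    have hb : 0 ≤ b := ha.trans hab
    have h2 := rpow_sub_rpow_mul_le ha hab (show 0 < r - 2 by linarith)
    have h3 : 0 ≤ b ^ (r - 2) - a ^ (r - 2) :=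
      sub_nonneg.2 (Real.rpow_le_rpow ha hab (by linarith))
    have h4 : b ^ (r - 2) ≤ (a + b) ^ (r - 2) := Real.rpow_le_rpow hb (by linarith) (by linarith)
    have h5 : 0 ≤ b - a := by linarith
    calc (b ^ (r - 2) - a ^ (r - 2)) * (b ^ 2 - a ^ 2)
        = (b ^ (r - 2) - a ^ (r - 2)) * (b + a) * (b - a) := by ring
      _ ≤ (b ^ (r - 2) - a ^ (r - 2)) * (2 * b) * (b - a) := by gcongr; linarith
      _ = 2 * ((b ^ (r - 2) - a ^ (r - 2)) * b) * (b - a) := by ring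
      _ ≤ 2 * (max 1 (r - 2) * b ^ (r - 2) * (b - a)) * (b - a) := by gcongr
      _ ≤ 2 * (max 1 (r - 2) * (a + b) ^ (r - 2) * (b - a)) * (b - a) := by gcongr
      _ = _ := by ring
  rcases le_total a b with hab | hab
  · nlinarith [key ha hab]
  · have h6 := key hb hab
    rw [add_comm b a] at h6
    nlinarith

/-- The expansion in the variable `‖·‖²` is convenient because `‖b‖²` is exactly `‖a‖² + 2 Re ⟪a, b
- a⟫ + ‖b - a‖²`; the last term joins the remainder. -/
theorem norm_rpow_quadratic_remainder {𝕜 V : Type*} [RCLike 𝕜] [NormedAddCommGroup V]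
    [InnerProductSpace 𝕜 V] {r : ℝ} (hr : 2 < r) (a b : V) :
    |‖b‖ ^ r - ‖a‖ ^ r - r * ‖a‖ ^ (r - 2) * RCLike.re (inner 𝕜 a (b - a))|
      ≤ (r * max 1 (r - 2) + r / 2) * ((‖a‖ + ‖b‖) ^ (r - 2) * ‖b - a‖ ^ 2) := by
  have h1 := rpow_quadratic_remainder (norm_nonneg a) (norm_nonneg b) hr
  have e : ‖b‖ ^ 2 = ‖a‖ ^ 2 + 2 * RCLike.re (inner 𝕜 a (b - a)) + ‖b - a‖ ^ 2 := by
    have := norm_add_sq (𝕜 := 𝕜) a (b - a)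
    rwa [add_sub_cancel] at this
  have h2 : (‖b‖ - ‖a‖) ^ 2 ≤ ‖b - a‖ ^ 2 := by
    rw [← sq_abs (‖b‖ - ‖a‖)]
    exact pow_le_pow_left₀ (abs_nonneg _) (abs_norm_sub_norm_le b a) 2
  have h3 : ‖a‖ ^ (r - 2) ≤ (‖a‖ + ‖b‖) ^ (r - 2) :=
    Real.rpow_le_rpow (norm_nonneg _) (by linarith [norm_nonneg b]) (by linarith)
  have e2 : ‖b‖ ^ r - ‖a‖ ^ r - r * ‖a‖ ^ (r - 2) * RCLike.re (inner 𝕜 a (b - a))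
      = (‖b‖ ^ r - ‖a‖ ^ r - r / 2 * ‖a‖ ^ (r - 2) * (‖b‖ ^ 2 - ‖a‖ ^ 2))
        + r / 2 * ‖a‖ ^ (r - 2) * ‖b - a‖ ^ 2 := by rw [e]; ring
  rw [e2]
  refine (abs_add_le _ _).trans ?_
  have hM : 0 < max 1 (r - 2) := lt_max_of_lt_left one_pos
  rw [add_mul]
  refine add_le_add (h1.trans ?_) ?_
  · rw [mul_assoc]; gcongr
  · rw [abs_of_nonneg (by positivity), mul_assoc]; gcongr

/-- Hölder's inequality in the form `∫ A^θ B^η ≤ (∫ A)^θ (∫ B)^η`, `θ + η = 1`. -/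
theorem integral_rpow_mul_rpow_le {α : Type*} [MeasurableSpace α] {μ : Measure α} {A B : α → ℝ}
    (hA : Integrable A μ) (hB : Integrable B μ) (hA0 : ∀ x, 0 ≤ A x) (hB0 : ∀ x, 0 ≤ B x)
    {θ η : ℝ} (hθ : 0 ≤ θ) (hη : 0 ≤ η) (h : θ + η = 1) :
    Integrable (fun x => A x ^ θ * B x ^ η) μ ∧
      ∫ x, A x ^ θ * B x ^ η ∂μ ≤ (∫ x, A x ∂μ) ^ θ * (∫ x, B x ∂μ) ^ η := by
  have hm : AEStronglyMeasurable (fun x => A x ^ θ * B x ^ η) μ :=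
    ((hA.1.aemeasurable.pow_const θ).mul (hB.1.aemeasurable.pow_const η)).aestronglyMeasurable
  have h0 : ∀ x, 0 ≤ A x ^ θ * B x ^ η := fun x => by have := hA0 x; have := hB0 x; positivity
  have hIA : 0 ≤ ∫ x, A x ∂μ := integral_nonneg hA0
  have hIB : 0 ≤ ∫ x, B x ∂μ := integral_nonneg hB0
  have key : ∫⁻ x, ENNReal.ofReal (A x ^ θ * B x ^ η) ∂μ
      ≤ ENNReal.ofReal ((∫ x, A x ∂μ) ^ θ * (∫ x, B x ∂μ) ^ η) := by
    have h1 := ENNReal.lintegral_mul_norm_pow_le (μ := μ) hA.1.aemeasurable.ennreal_ofReal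
      hB.1.aemeasurable.ennreal_ofReal hθ hη h
    rw [← ofReal_integral_eq_lintegral_ofReal hA (ae_of_all _ hA0),
      ← ofReal_integral_eq_lintegral_ofReal hB (ae_of_all _ hB0),
      ENNReal.ofReal_rpow_of_nonneg hIA hθ, ENNReal.ofReal_rpow_of_nonneg hIB hη,
      ← ENNReal.ofReal_mul (by positivity)] at h1
    refine le_trans (le_of_eq (lintegral_congr fun x => ?_)) h1
    have := hA0 x
    rw [ENNReal.ofReal_rpow_of_nonneg (hA0 x) hθ, ENNReal.ofReal_rpow_of_nonneg (hB0 x) hη,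
      ← ENNReal.ofReal_mul (by positivity)]
  have hi : Integrable (fun x => A x ^ θ * B x ^ η) μ := by
    refine ⟨hm, ?_⟩
    rw [hasFiniteIntegral_iff_ofReal (ae_of_all _ h0)]
    exact key.trans_lt ENNReal.ofReal_lt_top
  refine ⟨hi, ?_⟩
  rw [← ofReal_integral_eq_lintegral_ofReal hi (ae_of_all _ h0)] at key
  exact (ENNReal.ofReal_le_ofReal_iff (by positivity)).1 key

theorem integral_norm_rpow_eq {α E : Type*} [MeasurableSpace α] {μ : Measure α}
    [NormedAddCommGroup E] {r : ℝ} (hr : 0 < r) (f : Lp E (ENNReal.ofReal r) μ) :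
    ∫ x, ‖f x‖ ^ r ∂μ = ‖f‖ ^ r := by
  have h0 : ENNReal.ofReal r ≠ 0 := by simpa using hr
  have hi : 0 ≤ ∫ x, ‖f x‖ ^ r ∂μ := integral_nonneg fun x => by positivity
  rw [Lp.norm_def, (Lp.memLp f).eLpNorm_eq_integral_rpow_norm h0 ENNReal.ofReal_ne_top,
    ENNReal.toReal_ofReal hr.le, ENNReal.toReal_ofReal (by positivity), ← Real.rpow_mul hi,
    inv_mul_cancel₀ hr.ne', Real.rpow_one]

theorem integrable_norm_rpow_of_memLp {α E : Type*} [MeasurableSpace α] {μ : Measure α}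
    [NormedAddCommGroup E] {r : ℝ} (hr : 0 < r) {f : α → E} (hf : MemLp f (ENNReal.ofReal r) μ) :
    Integrable (fun x => ‖f x‖ ^ r) μ := by
  have := hf.integrable_norm_rpow (by simpa using hr) ENNReal.ofReal_ne_top
  rwa [ENNReal.toReal_ofReal hr.le] at this

/-- Hölder's inequality in `Lʳ` for `∫ F^s G^t`, `s + t = r`. -/
theorem integral_norm_rpow_mul_le {α E F : Type*} [MeasurableSpace α] {μ : Measure α}
    [NormedAddCommGroup E] [NormedAddCommGroup F] {s t : ℝ} (hs : 0 ≤ s) (ht : 0 ≤ t)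
    (hst : 0 < s + t) (f : Lp E (ENNReal.ofReal (s + t)) μ) (g : Lp F (ENNReal.ofReal (s + t)) μ) :
    Integrable (fun x => ‖f x‖ ^ s * ‖g x‖ ^ t) μ ∧
      ∫ x, ‖f x‖ ^ s * ‖g x‖ ^ t ∂μ ≤ ‖f‖ ^ s * ‖g‖ ^ t := by
  have h := integral_rpow_mul_rpow_le (integrable_norm_rpow_of_memLp hst (Lp.memLp f))
    (integrable_norm_rpow_of_memLp hst (Lp.memLp g)) (fun x => by positivity)
    (fun x => by positivity) (θ := s / (s + t)) (η := t / (s + t)) (by positivity) (by positivity)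
    (by field_simp)
  have e : ∀ {y k : ℝ}, 0 ≤ y → (y ^ (s + t)) ^ (k / (s + t)) = y ^ k := fun hy => by
    rw [← Real.rpow_mul hy, mul_div_cancel₀ _ hst.ne']
  have ef : ∀ x, (‖f x‖ ^ (s + t)) ^ (s / (s + t)) = ‖f x‖ ^ s := fun x => e (norm_nonneg _)
  have eg : ∀ x, (‖g x‖ ^ (s + t)) ^ (t / (s + t)) = ‖g x‖ ^ t := fun x => e (norm_nonneg _)
  have hf0 : 0 ≤ ‖f‖ := by rw [Lp.norm_def]; exact ENNReal.toReal_nonneg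
  have hg0 : 0 ≤ ‖g‖ := by rw [Lp.norm_def]; exact ENNReal.toReal_nonneg
  simp only [ef, eg] at h
  rwa [integral_norm_rpow_eq hst, integral_norm_rpow_eq hst, e hf0, e hg0] at h

section

variable {α 𝕜 : Type*} [MeasurableSpace α] {μ : Measure α} [RCLike 𝕜] {r : ℝ}

theorem norm_rpow_smul_inner_le (hr : 2 < r) (a b : 𝕜) :
    |r * ‖a‖ ^ (r - 2) * RCLike.re (inner 𝕜 a b)| ≤ r * (‖a‖ ^ (r - 1) * ‖b‖ ^ (1 : ℝ)) := by
  have h1 : |RCLike.re (inner 𝕜 a b)| ≤ ‖a‖ * ‖b‖ :=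
    (RCLike.abs_re_le_norm _).trans (norm_inner_le_norm _ _)
  rw [abs_mul, abs_of_nonneg (by positivity), Real.rpow_one]
  have e : ‖a‖ ^ (r - 1) = ‖a‖ ^ (r - 2) * ‖a‖ := by
    have := Real.rpow_add_one' (norm_nonneg a) (y := r - 2) (by linarith)
    rw [← this]; congr 1; ring
  calc r * ‖a‖ ^ (r - 2) * |RCLike.re (inner 𝕜 a b)|
      ≤ r * ‖a‖ ^ (r - 2) * (‖a‖ * ‖b‖) := by gcongr
    _ = _ := by rw [e]; ring

theorem integrable_deriv_integrand (hr : 2 < r) (f h : Lp 𝕜 (ENNReal.ofReal r) μ) :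
    Integrable (fun x => r * ‖f x‖ ^ (r - 2) * RCLike.re (inner 𝕜 (f x) (h x))) μ ∧
      |∫ x, r * ‖f x‖ ^ (r - 2) * RCLike.re (inner 𝕜 (f x) (h x)) ∂μ| ≤ r * ‖f‖ ^ (r - 1) * ‖h‖ := by
  obtain ⟨s, rfl⟩ : ∃ s, r = s + 1 := ⟨r - 1, by ring⟩
  obtain ⟨h1, h2⟩ := integral_norm_rpow_mul_le (s := s) (t := 1) (by linarith) zero_le_one
    (by linarith) f h
  have hm : AEStronglyMeasurable
      (fun x => (s + 1) * ‖f x‖ ^ (s + 1 - 2) * RCLike.re (inner 𝕜 (f x) (h x))) μ := by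
    have hf := (Lp.aestronglyMeasurable f)
    have hi : AEStronglyMeasurable (fun x => inner 𝕜 (f x) (h x)) μ :=
      hf.inner (Lp.aestronglyMeasurable h)
    have hn : AEMeasurable (fun x => (s + 1) * ‖f x‖ ^ (s + 1 - 2)) μ :=
      ((hf.norm.aemeasurable.pow_const _).const_mul _)
    exact hn.aestronglyMeasurable.mul (RCLike.continuous_re.comp_aestronglyMeasurable hi)
  have hb : ∀ x, ‖(s + 1) * ‖f x‖ ^ (s + 1 - 2) * RCLike.re (inner 𝕜 (f x) (h x))‖
      ≤ (s + 1) * (‖f x‖ ^ s * ‖h x‖ ^ (1 : ℝ)) := by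
    intro x
    have := norm_rpow_smul_inner_le hr (f x) (h x)
    rwa [add_sub_cancel_right] at this
  refine ⟨(h1.const_mul (s + 1)).mono' hm (ae_of_all _ hb), ?_⟩
  have h3 := norm_integral_le_of_norm_le (h1.const_mul (s + 1)) (ae_of_all _ hb)
  rw [Real.norm_eq_abs, integral_const_mul] at h3
  rw [Real.rpow_one] at h2
  rw [add_sub_cancel_right, mul_assoc]
  exact h3.trans (by gcongr)

/-- The derivative of `f ↦ ∫ ‖f‖ ^ r` on `Lʳ`. -/
def normPowDeriv [Fact (1 ≤ ENNReal.ofReal r)] (hr : 2 < r) (f : Lp 𝕜 (ENNReal.ofReal r) μ) :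
    Lp 𝕜 (ENNReal.ofReal r) μ →L[ℝ] ℝ :=
  LinearMap.mkContinuous
    { toFun := fun h => ∫ x, r * ‖f x‖ ^ (r - 2) * RCLike.re (inner 𝕜 (f x) (h x)) ∂μ
      map_add' := fun h k => by
        rw [← integral_add (integrable_deriv_integrand hr f h).1
          (integrable_deriv_integrand hr f k).1]
        refine integral_congr_ae ?_
        filter_upwards [Lp.coeFn_add h k] with x hx
        rw [hx, Pi.add_apply, inner_add_right, map_add, mul_add]
      map_smul' := fun a h => by
        rw [RingHom.id_apply, smul_eq_mul, ← integral_const_mul]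
        refine integral_congr_ae ?_
        filter_upwards [Lp.coeFn_smul a h] with x hx
        rw [hx, Pi.smul_apply, inner_smul_right_eq_smul, RCLike.smul_re]
        ring }
    (r * ‖f‖ ^ (r - 1)) (fun h => (integrable_deriv_integrand hr f h).2)

theorem contDiff_integral_norm_rpow [Fact (1 ≤ ENNReal.ofReal r)] (hr : 2 < r) :
    ContDiff ℝ 1 (fun f : Lp 𝕜 (ENNReal.ofReal r) μ => ∫ x, ‖f x‖ ^ r ∂μ) := by
  refine contDiff_one_of_quadratic_remainder (normPowDeriv hr)
    (fun R => (r * max 1 (r - 2) + r / 2) * (2 * R) ^ (r - 2)) fun R f g hf hg => ?_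
  have hr0 : 0 < r := by linarith
  have hM : 0 < max 1 (r - 2) := lt_max_of_lt_left one_pos
  have hR : 0 ≤ R := (norm_nonneg _).trans hf
  set C := r * max 1 (r - 2) + r / 2
  have hC : 0 ≤ C := by positivity
  have hN : ∀ f : Lp 𝕜 (ENNReal.ofReal r) μ, Integrable (fun x => ‖f x‖ ^ r) μ := fun f =>
    integrable_norm_rpow_of_memLp hr0 (Lp.memLp f)
  have hd := (integrable_deriv_integrand hr f (g - f)).1
  have e1 : ∫ x, ‖g x‖ ^ r ∂μ - ∫ x, ‖f x‖ ^ r ∂μ - normPowDeriv hr f (g - f)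
      = ∫ x, (‖g x‖ ^ r - ‖f x‖ ^ r
        - r * ‖f x‖ ^ (r - 2) * RCLike.re (inner 𝕜 (f x) ((g - f : Lp 𝕜 (ENNReal.ofReal r) μ) x))) ∂μ := by
    have hgf : Integrable (fun x => ‖g x‖ ^ r - ‖f x‖ ^ r) μ := (hN g).sub (hN f)
    rw [integral_sub hgf hd, integral_sub (hN g) (hN f)]
    rfl
  -- the function `‖f‖ + ‖g‖` as an element of `Lʳ`
  let F : Lp ℝ (ENNReal.ofReal r) μ := ((Lp.memLp f).norm.add (Lp.memLp g).norm).toLp _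
  have hF : ∀ᵐ x ∂μ, F x = ‖f x‖ + ‖g x‖ := ((Lp.memLp f).norm.add (Lp.memLp g).norm).coeFn_toLp
  have hFn : ‖F‖ ≤ 2 * R := by
    have e : F = (Lp.memLp f).norm.toLp _ + (Lp.memLp g).norm.toLp _ := rfl
    rw [e]
    refine (norm_add_le _ _).trans ?_
    rw [Lp.norm_toLp, Lp.norm_toLp, eLpNorm_norm, eLpNorm_norm, ← Lp.norm_def, ← Lp.norm_def]
    linarith
  have hst : r - 2 + 2 = r := by ring
  obtain ⟨i1, i2⟩ : Integrable (fun x => ‖F x‖ ^ (r - 2) * ‖(g - f : Lp 𝕜 (ENNReal.ofReal r) μ) x‖ ^ (2 : ℝ)) μ ∧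
      ∫ x, ‖F x‖ ^ (r - 2) * ‖(g - f : Lp 𝕜 (ENNReal.ofReal r) μ) x‖ ^ (2 : ℝ) ∂μ
        ≤ ‖F‖ ^ (r - 2) * ‖g - f‖ ^ (2 : ℝ) := by
    -- The exponent occurs in the types of `F` and `G`, so `r - 2 + 2 = r` is rewritten in the
    -- statement quantified over them.
    have := fun (F : Lp ℝ (ENNReal.ofReal (r - 2 + 2)) μ) (G : Lp 𝕜 (ENNReal.ofReal (r - 2 + 2)) μ) =>
      integral_norm_rpow_mul_le (s := r - 2) (t := 2) (by linarith) (by norm_num) (by linarith) F G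
    rw [hst] at this
    exact this F (g - f)
  rw [e1]
  have hb : ∀ᵐ x ∂μ, ‖‖g x‖ ^ r - ‖f x‖ ^ r
        - r * ‖f x‖ ^ (r - 2) * RCLike.re (inner 𝕜 (f x) ((g - f : Lp 𝕜 (ENNReal.ofReal r) μ) x))‖
      ≤ C * (‖F x‖ ^ (r - 2) * ‖(g - f : Lp 𝕜 (ENNReal.ofReal r) μ) x‖ ^ (2 : ℝ)) := by
    filter_upwards [hF, Lp.coeFn_sub g f] with x hx1 hx2
    rw [hx1, hx2, Real.norm_of_nonneg (show 0 ≤ ‖f x‖ + ‖g x‖ by positivity), Real.rpow_two]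
    exact norm_rpow_quadratic_remainder hr (f x) (g x)
  refine (norm_integral_le_of_norm_le (i1.const_mul C) hb).trans ?_
  rw [integral_const_mul, mul_assoc]
  rw [Real.rpow_two] at i2
  have h5 : ‖F‖ ^ (r - 2) ≤ (2 * R) ^ (r - 2) :=
    Real.rpow_le_rpow (norm_nonneg _) hFn (by linarith)
  exact mul_le_mul_of_nonneg_left (i2.trans (by gcongr)) hC

end

/-! ### The Hilbert space `H¹` and Sobolev's inequality -/

section H1Structure

variable {𝕜 : Type*} [RCLike 𝕜] {N : ℕ}

theorem continuous_integral_smul_of_test {φ : EuclideanSpace ℝ (Fin N) → ℝ} (hφ : Continuous φ)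
    (hc : HasCompactSupport φ) : Continuous fun u : L2 𝕜 N => ∫ x, φ x • u x := by
  have hm : MemLp (fun x => (φ x : 𝕜)) 2 (volume : Measure (EuclideanSpace ℝ (Fin N))) :=
    (hφ.memLp_of_hasCompactSupport hc).ofReal
  have e : ∀ u : L2 𝕜 N, ∫ x, φ x • u x = inner 𝕜 (hm.toLp _) u := by
    intro u
    rw [L2.inner_def]
    refine integral_congr_ae ?_
    filter_upwards [hm.coeFn_toLp] with x hx
    rw [hx, RCLike.inner_apply, RCLike.conj_ofReal, RCLike.real_smul_eq_coe_mul, mul_comm]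
  simp only [e]
  fun_prop

/-- Every tested identity is a closed condition, because pairing with a test function is an `L²`
inner product. The resulting completeness of `H¹` is what Ekeland's principle and Riesz
representation need. -/
theorem isClosed_h1Graph : IsClosed (h1Graph 𝕜 N : Set (WithLp 2 (L2 𝕜 N × PiLp 2 (fun _ : Fin N => L2 𝕜 N)))) := by
  have e : (h1Graph 𝕜 N : Set (WithLp 2 (L2 𝕜 N × PiLp 2 (fun _ : Fin N => L2 𝕜 N))))
      = ⋂ (i : Fin N) (φ : EuclideanSpace ℝ (Fin N) → ℝ) (_ : ContDiff ℝ ∞ φ)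
        (_ : HasCompactSupport φ),
        {p | ∫ x, (fderiv ℝ φ x (EuclideanSpace.single i 1)) • p.fst x
          = -∫ x, φ x • p.snd i x} := by
    ext p
    simp only [Set.mem_iInter]
    rfl
  rw [e]
  refine isClosed_iInter fun i => isClosed_iInter fun φ => isClosed_iInter fun hφ =>
    isClosed_iInter fun hc => isClosed_eq ?_ ?_
  · exact (continuous_integral_smul_of_test
      ((hφ.continuous_fderiv (by simp)).clm_apply continuous_const)
      (hc.fderiv_apply (𝕜 := ℝ) (EuclideanSpace.single i 1))).comp
      (WithLp.fstL 2 ℝ (L2 𝕜 N) (PiLp 2 (fun _ : Fin N => L2 𝕜 N))).continuous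
  · exact ((continuous_integral_smul_of_test hφ.continuous hc).comp
      ((PiLp.proj (𝕜 := ℝ) 2 (fun _ : Fin N => L2 𝕜 N) i).continuous.comp
      (WithLp.sndL 2 ℝ (L2 𝕜 N) (PiLp 2 (fun _ : Fin N => L2 𝕜 N))).continuous)).neg

instance : CompleteSpace (H1 𝕜 N) := isClosed_h1Graph.completeSpace_coe

variable (𝕜 N) in
/-- The inclusion `H¹ → L²`. -/
def fnL : H1 𝕜 N →L[ℝ] L2 𝕜 N :=
  (WithLp.fstL 2 ℝ (L2 𝕜 N) (PiLp 2 (fun _ : Fin N => L2 𝕜 N))).comp (h1Graph 𝕜 N).subtypeL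

variable (𝕜 N) in
/-- The weak gradient as a continuous linear map. -/
def gradL : H1 𝕜 N →L[ℝ] PiLp 2 (fun _ : Fin N => L2 𝕜 N) :=
  (WithLp.sndL 2 ℝ (L2 𝕜 N) (PiLp 2 (fun _ : Fin N => L2 𝕜 N))).comp (h1Graph 𝕜 N).subtypeL

theorem norm_sq_eq (u : H1 𝕜 N) : ‖u‖ ^ 2 = ‖u.fn‖ ^ 2 + ‖u.grad‖ ^ 2 :=
  WithLp.prod_norm_sq_eq_of_L2 u.1

theorem norm_grad_sq (u : H1 𝕜 N) : ‖u.grad‖ ^ 2 = ∑ i, ‖u.grad i‖ ^ 2 :=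
  PiLp.norm_sq_eq_of_L2 _ u.grad

theorem norm_fn_le (u : H1 𝕜 N) : ‖u.fn‖ ≤ ‖u‖ :=
  le_of_sq_le_sq (by rw [norm_sq_eq]; nlinarith [sq_nonneg ‖u.grad‖]) (norm_nonneg _)

theorem norm_grad_le (u : H1 𝕜 N) : ‖u.grad‖ ≤ ‖u‖ :=
  le_of_sq_le_sq (by rw [norm_sq_eq]; nlinarith [sq_nonneg ‖u.fn‖]) (norm_nonneg _)

theorem norm_grad_apply_le (u : H1 𝕜 N) (i : Fin N) : ‖u.grad i‖ ≤ ‖u.grad‖ :=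
  PiLp.norm_apply_le u.grad i

theorem H1.isWeakPartialDeriv (u : H1 𝕜 N) (i : Fin N) : IsWeakPartialDeriv i u.fn (u.grad i) :=
  u.2 i

end H1Structure

/-! ### Mollification in `L²`. -/

section Mollify

variable {𝕜 : Type*} [RCLike 𝕜] {N : ℕ}

/-- Young's inequality `‖φ ⋆ g‖₂ ≤ ‖g‖₂` for `φ ≥ 0` with `∫ φ = 1`. -/
theorem eLpNorm_convolution_le {φ : EuclideanSpace ℝ (Fin N) → ℝ} (hφ : Continuous φ)
    (hc : HasCompactSupport φ) (h0 : ∀ x, 0 ≤ φ x) (h1 : ∫ x, φ x = 1) (g : L2 𝕜 N) :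
    eLpNorm (convolution φ g (ContinuousLinearMap.lsmul ℝ ℝ) volume) 2 volume
      ≤ eLpNorm g 2 volume := by
  have hgm : Measurable fun x => ‖g x‖ₑ := (Lp.stronglyMeasurable g).enorm
  have hφm : Measurable fun x => ENNReal.ofReal (φ x) := hφ.measurable.ennreal_ofReal
  have hφ1 : ∫⁻ x, ENNReal.ofReal (φ x) = 1 := by
    rw [← ofReal_integral_eq_lintegral_ofReal (hφ.integrable_of_hasCompactSupport hc)
      (ae_of_all _ h0), h1, ENNReal.ofReal_one]
  have hpt : ∀ x, ‖convolution φ g (ContinuousLinearMap.lsmul ℝ ℝ) volume x‖ₑ ^ (2 : ℝ)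
      ≤ ∫⁻ t, ENNReal.ofReal (φ t) * ‖g (x - t)‖ₑ ^ (2 : ℝ) := by
    intro x
    have hgx : Measurable fun t => ‖g (x - t)‖ₑ := hgm.comp (measurable_const.sub measurable_id)
    have a1 : ‖convolution φ g (ContinuousLinearMap.lsmul ℝ ℝ) volume x‖ₑ
        ≤ ∫⁻ t, ENNReal.ofReal (φ t) * ‖g (x - t)‖ₑ := by
      refine (enorm_integral_le_lintegral_enorm _).trans_eq (lintegral_congr fun t => ?_)
      rw [ContinuousLinearMap.lsmul_apply, enorm_smul, Real.enorm_eq_ofReal (h0 t)]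
    -- Cauchy–Schwarz after splitting `φ = φ^{1/2} φ^{1/2}`; the second factor integrates to `1`.
    have a2 := ENNReal.lintegral_mul_norm_pow_le (μ := (volume : Measure (EuclideanSpace ℝ (Fin N))))
      (f := fun t => ENNReal.ofReal (φ t) * ‖g (x - t)‖ₑ ^ (2 : ℝ))
      (g := fun t => ENNReal.ofReal (φ t)) (p := 1 / 2) (q := 1 / 2)
      (hφm.mul (hgx.pow_const _)).aemeasurable hφm.aemeasurable
      (by norm_num) (by norm_num) (by norm_num)
    have a3 : ∀ t, (ENNReal.ofReal (φ t) * ‖g (x - t)‖ₑ ^ (2 : ℝ)) ^ (1 / 2 : ℝ)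
        * ENNReal.ofReal (φ t) ^ (1 / 2 : ℝ) = ENNReal.ofReal (φ t) * ‖g (x - t)‖ₑ := by
      intro t
      rw [ENNReal.mul_rpow_of_nonneg _ _ (by norm_num), ← ENNReal.rpow_mul, mul_right_comm,
        ← ENNReal.rpow_add_of_nonneg _ _ (by norm_num) (by norm_num)]
      norm_num
    simp only [a3, hφ1, ENNReal.one_rpow, mul_one] at a2
    calc _ ≤ ((∫⁻ t, ENNReal.ofReal (φ t) * ‖g (x - t)‖ₑ ^ (2 : ℝ)) ^ (1 / 2 : ℝ)) ^ (2 : ℝ) := by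
          gcongr
          exact a1.trans a2
      _ = _ := by rw [← ENNReal.rpow_mul]; norm_num
  rw [eLpNorm_eq_lintegral_rpow_enorm_toReal two_ne_zero ENNReal.ofNat_ne_top,
    eLpNorm_eq_lintegral_rpow_enorm_toReal two_ne_zero ENNReal.ofNat_ne_top]
  simp only [ENNReal.toReal_ofNat]
  refine ENNReal.rpow_le_rpow ?_ (by norm_num)
  refine (lintegral_mono hpt).trans ?_
  rw [lintegral_lintegral_swap]
  · have : ∀ t, ∫⁻ x, ENNReal.ofReal (φ t) * ‖g (x - t)‖ₑ ^ (2 : ℝ)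
        = ENNReal.ofReal (φ t) * ∫⁻ x, ‖g x‖ₑ ^ (2 : ℝ) := by
      intro t
      rw [lintegral_const_mul' _ _ ENNReal.ofReal_ne_top,
        lintegral_sub_right_eq_self (fun x => ‖g x‖ₑ ^ (2 : ℝ)) t]
    simp only [this]
    rw [lintegral_mul_const _ hφm, hφ1, one_mul]
  · refine ((hφm.comp measurable_snd).mul ((hgm.comp ?_).pow_const _)).aemeasurable
    exact measurable_fst.sub measurable_snd

theorem locallyIntegrable_L2 (g : L2 𝕜 N) : LocallyIntegrable g volume :=
  (Lp.memLp g).locallyIntegrable (by norm_num)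

/-- The partial derivative of a mollification is the mollification of the weak derivative. -/
theorem fderiv_convolution_apply {φ : EuclideanSpace ℝ (Fin N) → ℝ} (hφ : ContDiff ℝ ∞ φ)
    (hc : HasCompactSupport φ) (u : H1 𝕜 N) (i : Fin N) (x : EuclideanSpace ℝ (Fin N)) :
    fderiv ℝ (convolution φ u.fn (ContinuousLinearMap.lsmul ℝ ℝ) volume) x
        (EuclideanSpace.single i 1)
      = convolution φ (u.grad i) (ContinuousLinearMap.lsmul ℝ ℝ) volume x := by
  have hd := hc.hasFDerivAt_convolution_left (μ := volume)
    (ContinuousLinearMap.lsmul ℝ ℝ : ℝ →L[ℝ] 𝕜 →L[ℝ] 𝕜)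
    (hφ.of_le (by exact_mod_cast le_top)) (locallyIntegrable_L2 u.fn) x
  have hex := (hc.fderiv (𝕜 := ℝ)).convolutionExists_left (μ := volume)
    (ContinuousLinearMap.precompL (EuclideanSpace ℝ (Fin N))
      (ContinuousLinearMap.lsmul ℝ ℝ : ℝ →L[ℝ] 𝕜 →L[ℝ] 𝕜))
    (hφ.continuous_fderiv (by simp)) (locallyIntegrable_L2 u.fn) x
  rw [hd.fderiv, convolution_def, ContinuousLinearMap.integral_apply hex]
  -- The reflected translate `y ↦ φ (x - y)` is the test function for the weak derivative; the
  -- reflection produces the sign that cancels the one in the definition.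
  have hψ : ContDiff ℝ ∞ fun y => φ (x - y) := hφ.comp (contDiff_const.sub contDiff_id)
  have hψc : HasCompactSupport fun y => φ (x - y) :=
    hc.comp_homeomorph (Homeomorph.subLeft x)
  have hw := u.isWeakPartialDeriv i _ hψ hψc
  have hder : ∀ y, fderiv ℝ (fun y => φ (x - y)) y (EuclideanSpace.single i 1)
      = -fderiv ℝ φ (x - y) (EuclideanSpace.single i 1) := by
    intro y
    have hcomp : HasFDerivAt (fun y => φ (x - y)) _ y :=
      ((hφ.differentiable (by simp)) (x - y)).hasFDerivAt.comp y ((hasFDerivAt_id y).const_sub x)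
    rw [hcomp.fderiv]
    simp
  simp only [hder, neg_smul, integral_neg, neg_inj] at hw
  rw [convolution_def, ← integral_sub_left_eq_self _ _ x,
    ← integral_sub_left_eq_self (fun t => (ContinuousLinearMap.lsmul ℝ ℝ) (φ t) (u.grad i (x - t))) _ x]
  simp only [sub_sub_cancel]
  exact hw

end Mollify

/-! ### The Sobolev inequality on `H¹`. -/

section Sobolev

variable {𝕜 : Type*} [RCLike 𝕜] {N : ℕ}

theorem norm_clm_le_sum (A : EuclideanSpace ℝ (Fin N) →L[ℝ] 𝕜) :
    ‖A‖ ≤ ∑ i, ‖A (EuclideanSpace.single i 1)‖ := by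
  refine ContinuousLinearMap.opNorm_le_bound _ (by positivity) fun x => ?_
  have e : A x = ∑ i, x i • A (EuclideanSpace.single i 1) := by
    have := (EuclideanSpace.basisFun (Fin N) ℝ).sum_repr x
    conv_lhs => rw [← this]
    simp
  rw [e, Finset.sum_mul]
  refine (norm_sum_le _ _).trans (Finset.sum_le_sum fun i _ => ?_)
  rw [norm_smul, mul_comm]
  gcongr
  exact PiLp.norm_apply_le x i

theorem critExp_inv (hN : 3 ≤ N) : (critExp N)⁻¹ = 2⁻¹ - (N : ℝ)⁻¹ := by
  have : (3 : ℝ) ≤ N := by exact_mod_cast hN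
  have h2 : (N : ℝ) - 2 ≠ 0 := by linarith
  rw [critExp]
  field_simp

theorem two_lt_critExp (hN : 3 ≤ N) : 2 < critExp N := by
  have : (3 : ℝ) ≤ N := by exact_mod_cast hN
  rw [critExp, lt_div_iff₀ (by linarith)]
  linarith

/-- A cut-off equal to `1` on the unit ball. -/
def cutoff (N : ℕ) : ContDiffBump (0 : EuclideanSpace ℝ (Fin N)) := ⟨1, 2, one_pos, one_lt_two⟩

/-- The inequality for compactly supported `C¹` functions is applied to truncated mollifications
`χ(sₙ x) (ρₙ ⋆ u)(x)`. The derivative of the cut-off contributes at most `sₙ M ‖u‖₂ → 0`, and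
Fatou's lemma passes to the limit. -/
theorem sobolev_inequality (𝕜 : Type*) [RCLike 𝕜] (hN : 3 ≤ N) : ∃ C : ℝ≥0, ∀ u : H1 𝕜 N,
    eLpNorm u.fn (ENNReal.ofReal (critExp N)) volume ≤ C * ENNReal.ofReal ‖u.grad‖ := by
  have hcr := two_lt_critExp hN
  set p' : ℝ≥0 := (critExp N).toNNReal with hp'
  have hp'r : (p' : ℝ) = critExp N := Real.coe_toNNReal _ (by linarith)
  set C₀ : ℝ≥0 := SNormLESNormFDerivOfEqConst 𝕜 (volume : Measure (EuclideanSpace ℝ (Fin N))) ((2 : ℝ≥0) : ℝ)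
  -- The factor `N` comes from bounding the operator norm of the derivative by the sum of the `N`
  -- partial derivatives.
  refine ⟨C₀ * N, fun u => ?_⟩
  let χ := cutoff N
  obtain ⟨M, hM⟩ : ∃ M, ∀ x, ‖fderiv ℝ χ x‖ ≤ M :=
    (χ.contDiff.continuous_fderiv one_ne_zero).bounded_above_of_compact_support
      (χ.hasCompactSupport.fderiv (𝕜 := ℝ))
  have hM0 : 0 ≤ M := (norm_nonneg _).trans (hM 0)
  let ρ : ℕ → ContDiffBump (0 : EuclideanSpace ℝ (Fin N)) := fun n =>
    ⟨1 / ((n : ℝ) + 1), 2 * (1 / ((n : ℝ) + 1)), by positivity,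
      lt_mul_of_one_lt_left (by positivity) one_lt_two⟩
  let w : ℕ → EuclideanSpace ℝ (Fin N) → 𝕜 := fun n =>
    convolution ((ρ n).normed volume) u.fn (ContinuousLinearMap.lsmul ℝ ℝ) volume
  have hw : ∀ n, ContDiff ℝ 1 (w n) := fun n => by
    have := (ρ n).hasCompactSupport_normed (μ := volume) |>.contDiff_convolution_left (n := 1)
      (ContinuousLinearMap.lsmul ℝ ℝ : ℝ →L[ℝ] 𝕜 →L[ℝ] 𝕜) (ρ n).contDiff_normed
      (locallyIntegrable_L2 u.fn)
    exact_mod_cast this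
  have hw2 : ∀ n, eLpNorm (w n) 2 volume ≤ ENNReal.ofReal ‖u.fn‖ := fun n => by
    refine (eLpNorm_convolution_le (ρ n).continuous_normed (ρ n).hasCompactSupport_normed
      (ρ n).nonneg_normed (ρ n).integral_normed u.fn).trans_eq ?_
    rw [ofReal_norm, Lp.enorm_def]
  have hdw : ∀ n, eLpNorm (fun x => ‖fderiv ℝ (w n) x‖) 2 volume ≤ N * ENNReal.ofReal ‖u.grad‖ := by
    intro n
    have hcont : ∀ i : Fin N, Continuous fun x => ‖fderiv ℝ (w n) x (EuclideanSpace.single i 1)‖ :=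
      fun i => (((hw n).continuous_fderiv one_ne_zero).clm_apply continuous_const).norm
    calc eLpNorm (fun x => ‖fderiv ℝ (w n) x‖) 2 volume
        ≤ eLpNorm (∑ i : Fin N, fun x => ‖fderiv ℝ (w n) x (EuclideanSpace.single i 1)‖) 2 volume := by
          refine eLpNorm_mono_real fun x => ?_
          rw [norm_norm, Finset.sum_apply]
          exact norm_clm_le_sum _
      _ ≤ ∑ i : Fin N, eLpNorm (fun x => ‖fderiv ℝ (w n) x (EuclideanSpace.single i 1)‖) 2 volume :=
          eLpNorm_sum_le (fun i _ => (hcont i).aestronglyMeasurable) (by norm_num)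
      _ ≤ ∑ i : Fin N, ENNReal.ofReal ‖u.grad‖ := by
          refine Finset.sum_le_sum fun i _ => ?_
          rw [eLpNorm_norm]
          have e : (fun x => fderiv ℝ (w n) x (EuclideanSpace.single i 1))
              = convolution ((ρ n).normed volume) (u.grad i) (ContinuousLinearMap.lsmul ℝ ℝ)
                volume := by
            ext x
            exact fderiv_convolution_apply (ρ n).contDiff_normed (ρ n).hasCompactSupport_normed u i x
          rw [e]
          refine (eLpNorm_convolution_le (ρ n).continuous_normed (ρ n).hasCompactSupport_normed
            (ρ n).nonneg_normed (ρ n).integral_normed (u.grad i)).trans ?_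
          rw [← Lp.enorm_def, ← ofReal_norm]
          exact ENNReal.ofReal_le_ofReal (norm_grad_apply_le u i)
      _ = N * ENNReal.ofReal ‖u.grad‖ := by simp
  let s : ℕ → ℝ := fun n => 1 / ((n : ℝ) + 1)
  have hs : ∀ n, 0 < s n := fun n => by simp only [s]; positivity
  have hs0 : Tendsto s atTop (𝓝 0) := tendsto_one_div_add_atTop_nhds_zero_nat
  let χn : ℕ → EuclideanSpace ℝ (Fin N) → ℝ := fun n x => χ (s n • x)
  have hχd : ∀ n, ContDiff ℝ 1 (χn n) := fun n => χ.contDiff.comp (contDiff_const_smul (s n))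
  have hχfd : ∀ n x, ‖fderiv ℝ (χn n) x‖ ≤ s n * M := by
    intro n x
    have : fderiv ℝ (χn n) x = s n • fderiv ℝ χ (s n • x) := by
      simp only [χn]
      exact fderiv_comp_smul (s n) 
    rw [this, norm_smul, Real.norm_of_nonneg (hs n).le]
    exact mul_le_mul_of_nonneg_left (hM _) (hs n).le
  let v : ℕ → EuclideanSpace ℝ (Fin N) → 𝕜 := fun n x => χn n x • w n x
  have hv : ∀ n, ContDiff ℝ 1 (v n) := fun n => (hχd n).smul (hw n)
  have hvc : ∀ n, HasCompactSupport (v n) := fun n => by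
    have h1 : HasCompactSupport (χn n) :=
      χ.hasCompactSupport.comp_smul (hs n).ne'
    exact h1.smul_right
  have hvd : ∀ n, eLpNorm (fderiv ℝ (v n)) 2 volume
      ≤ N * ENNReal.ofReal ‖u.grad‖ + ENNReal.ofReal (s n * M) * ENNReal.ofReal ‖u.fn‖ := by
    intro n
    have c1 : Continuous fun x => ‖fderiv ℝ (w n) x‖ :=
      ((hw n).continuous_fderiv one_ne_zero).norm
    have c2 : Continuous fun x => (s n * M) • ‖w n x‖ := by
      have := (hw n).continuous
      fun_prop
    calc eLpNorm (fderiv ℝ (v n)) 2 volume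
        ≤ eLpNorm ((fun x => ‖fderiv ℝ (w n) x‖) + (fun x => (s n * M) • ‖w n x‖)) 2 volume := by
          refine eLpNorm_mono_real fun x => ?_
          have e := fderiv_smul ((hχd n).differentiable one_ne_zero x)
            ((hw n).differentiable one_ne_zero x)
          have e' : fderiv ℝ (v n) x = χn n x • fderiv ℝ (w n) x
            + (fderiv ℝ (χn n) x).smulRight (w n x) := e
          rw [e']
          refine (norm_add_le _ _).trans (add_le_add ?_ ?_)
          · rw [norm_smul, Real.norm_of_nonneg χ.nonneg]
            exact mul_le_of_le_one_left (norm_nonneg _) χ.le_one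
          · rw [ContinuousLinearMap.norm_smulRight_apply]
            exact mul_le_mul_of_nonneg_right (hχfd n x) (norm_nonneg _)
      _ ≤ _ := eLpNorm_add_le c1.aestronglyMeasurable c2.aestronglyMeasurable (by norm_num)
      _ ≤ _ := by
          refine add_le_add (hdw n) ?_
          have := eLpNorm_const_smul (p := 2) (μ := (volume : Measure (EuclideanSpace ℝ (Fin N))))
            (s n * M) (fun x => ‖w n x‖)
          have e2 : eLpNorm (fun x => (s n * M) • ‖w n x‖) 2 volume
            = ‖s n * M‖ₑ * eLpNorm (fun x => ‖w n x‖) 2 volume := this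
          rw [e2, eLpNorm_norm, Real.enorm_eq_ofReal (mul_nonneg (hs n).le hM0)]
          gcongr
          exact hw2 n
  have hvS : ∀ n, eLpNorm (v n) (ENNReal.ofReal (critExp N)) volume
      ≤ C₀ * (N * ENNReal.ofReal ‖u.grad‖ + ENNReal.ofReal (s n * M) * ENNReal.ofReal ‖u.fn‖) := by
    intro n
    have h3 : (0 : ℕ) < Module.finrank ℝ (EuclideanSpace ℝ (Fin N)) := by
      rw [finrank_euclideanSpace_fin]; omega
    have := eLpNorm_le_eLpNorm_fderiv_of_eq (μ := (volume : Measure (EuclideanSpace ℝ (Fin N))))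
      (F := 𝕜) (hv n) (hvc n) (p := 2) (p' := p') one_le_two h3
      (by rw [hp'r, finrank_euclideanSpace_fin, critExp_inv hN]; norm_num)
    refine this.trans ?_
    exact mul_le_mul' le_rfl (by exact_mod_cast hvd n)
  have hlim : ∀ᵐ x, Tendsto (fun n => v n x) atTop (𝓝 (u.fn x)) := by
    have := ContDiffBump.ae_convolution_tendsto_right_of_locallyIntegrable (φ := ρ) (l := atTop)
      (K := 2) (μ := (volume : Measure (EuclideanSpace ℝ (Fin N)))) (g := u.fn)
      (by simpa using hs0.const_mul 2) (Eventually.of_forall fun n => le_rfl)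
      (locallyIntegrable_L2 u.fn)
    filter_upwards [this] with x hx
    have h1 : Tendsto (fun n => χn n x) atTop (𝓝 1) := by
      have h2 : Tendsto (fun n => χ (s n • x)) atTop (𝓝 (χ ((0 : ℝ) • x))) :=
        (χ.continuous.tendsto _).comp (hs0.smul_const x)
      rw [zero_smul, χ.one_of_mem_closedBall (Metric.mem_closedBall_self χ.rIn_pos.le)] at h2
      exact h2
    simpa using h1.smul hx
  -- Fatou's lemma: almost everywhere convergence is enough.
  refine (Lp.eLpNorm_lim_le_liminf_eLpNorm (fun n => (hv n).continuous.aestronglyMeasurable) _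
    hlim).trans ?_
  have hbt : Tendsto (fun n => (C₀ : ℝ≥0∞) * (N * ENNReal.ofReal ‖u.grad‖
      + ENNReal.ofReal (s n * M) * ENNReal.ofReal ‖u.fn‖)) atTop
      (𝓝 (C₀ * (N * ENNReal.ofReal ‖u.grad‖ + 0))) := by
    refine ENNReal.Tendsto.const_mul (tendsto_const_nhds.add ?_) (Or.inr ENNReal.coe_ne_top)
    have h4 : Tendsto (fun n => ENNReal.ofReal (s n * M)) atTop (𝓝 0) := by
      have := ENNReal.tendsto_ofReal (hs0.mul_const M)
      simpa using this
    have := ENNReal.Tendsto.mul_const (b := ENNReal.ofReal ‖u.fn‖) h4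
      (Or.inr ENNReal.ofReal_ne_top)
    simpa using this
  refine (liminf_le_liminf (Eventually.of_forall hvS)).trans ?_
  rw [hbt.liminf_eq, add_zero, ENNReal.coe_mul, mul_assoc]
  simp

end Sobolev

/-! ### Sobolev and Gagliardo–Nirenberg inequalities, regularity of the energy -/

section Powers

variable {𝕜 : Type*} [RCLike 𝕜] {N : ℕ}

theorem powInt_nonneg (p : ℝ) (u : H1 𝕜 N) : 0 ≤ powInt p u :=
  integral_nonneg fun x => by positivity

theorem lpNorm_nonneg (p : ℝ) (u : H1 𝕜 N) : 0 ≤ lpNorm p u :=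
  Real.rpow_nonneg (powInt_nonneg p u) _

theorem lpNorm_rpow {p : ℝ} (hp : p ≠ 0) (u : H1 𝕜 N) : lpNorm p u ^ p = powInt p u := by
  rw [lpNorm, ← Real.rpow_mul (powInt_nonneg p u), one_div_mul_cancel hp, Real.rpow_one]

theorem lpNorm_eq_toReal {p : ℝ} (hp : 0 < p) (u : H1 𝕜 N)
    (h : MemLp u.fn (ENNReal.ofReal p) volume) :
    lpNorm p u = (eLpNorm u.fn (ENNReal.ofReal p) volume).toReal := by
  rw [h.eLpNorm_eq_integral_rpow_norm (by simpa using hp) ENNReal.ofReal_ne_top,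
    ENNReal.toReal_ofReal hp.le, ENNReal.toReal_ofReal (by positivity), lpNorm, powInt, one_div]

theorem powInt_two (u : H1 𝕜 N) : powInt 2 u = ‖u.fn‖ ^ 2 := by
  rw [powInt, ← real_inner_self_eq_norm_sq, L2.inner_def]
  refine integral_congr_ae (ae_of_all _ fun x => ?_)
  simp only [real_inner_self_eq_norm_sq, Real.rpow_two]

theorem integrable_norm_sq (u : H1 𝕜 N) : Integrable (fun x => ‖u.fn x‖ ^ (2 : ℝ)) := by
  refine integrable_norm_rpow_of_memLp two_pos ?_
  rw [ENNReal.ofReal_ofNat]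
  exact Lp.memLp u.fn

theorem memLp_critExp (hN : 3 ≤ N) (u : H1 𝕜 N) :
    MemLp u.fn (ENNReal.ofReal (critExp N)) volume := by
  obtain ⟨C, hC⟩ := sobolev_inequality 𝕜 hN
  exact ⟨Lp.aestronglyMeasurable u.fn, (hC u).trans_lt (by finiteness)⟩

theorem exists_lpNorm_critExp_le (𝕜 : Type*) [RCLike 𝕜] (hN : 3 ≤ N) :
    ∃ C : ℝ, 0 ≤ C ∧ ∀ u : H1 𝕜 N, lpNorm (critExp N) u ≤ C * ‖u.grad‖ := by
  obtain ⟨C, hC⟩ := sobolev_inequality 𝕜 hN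
  refine ⟨C, C.2, fun u => ?_⟩
  rw [lpNorm_eq_toReal (by linarith [two_lt_critExp hN]) u (memLp_critExp hN u)]
  refine (ENNReal.toReal_mono (by finiteness) (hC u)).trans_eq ?_
  rw [ENNReal.toReal_mul, ENNReal.toReal_ofReal (norm_nonneg _), ENNReal.coe_toReal]

/-- Interpolation between `L²` and `L^{2*}`. -/
theorem powInt_interpolation (hN : 3 ≤ N) {q : ℝ} (hq : 2 < q) (hq' : q < critExp N)
    (u : H1 𝕜 N) : MemLp u.fn (ENNReal.ofReal q) volume ∧
      powInt q u ≤ (‖u.fn‖ ^ 2) ^ ((critExp N - q) / (critExp N - 2))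
        * powInt (critExp N) u ^ ((q - 2) / (critExp N - 2)) := by
  have hcr := two_lt_critExp hN
  set p := critExp N
  have h := integral_rpow_mul_rpow_le (integrable_norm_sq u)
    (integrable_norm_rpow_of_memLp (by linarith : 0 < p) (memLp_critExp hN u))
    (fun x => by positivity) (fun x => by positivity)
    (θ := (p - q) / (p - 2)) (η := (q - 2) / (p - 2))
    (div_nonneg (by linarith) (by linarith)) (div_nonneg (by linarith) (by linarith))
    (by rw [← add_div, div_eq_one_iff_eq (by linarith)]; ring)
  have hp2 : p - 2 ≠ 0 := by linarith
  have e : ∀ y : ℝ, 0 ≤ y → (y ^ (2 : ℝ)) ^ ((p - q) / (p - 2)) * (y ^ p) ^ ((q - 2) / (p - 2))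
      = y ^ q := by
    intro y hy
    rw [← Real.rpow_mul hy, ← Real.rpow_mul hy]
    have e1 : 2 * ((p - q) / (p - 2)) + p * ((q - 2) / (p - 2)) = q := by
      field_simp
      ring
    rw [← Real.rpow_add' hy (by rw [e1]; linarith), e1]
  have e' : ∀ x, (‖u.fn x‖ ^ (2 : ℝ)) ^ ((p - q) / (p - 2)) * (‖u.fn x‖ ^ p) ^ ((q - 2) / (p - 2))
      = ‖u.fn x‖ ^ q := fun x => e _ (norm_nonneg _)
  simp only [e'] at h
  refine ⟨?_, ?_⟩
  · have := (integrable_norm_rpow_iff (Lp.aestronglyMeasurable u.fn) (p := ENNReal.ofReal q)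
      (by simp; linarith) ENNReal.ofReal_ne_top).1
    rw [ENNReal.toReal_ofReal (by linarith)] at this
    exact this h.1
  · rw [← powInt_two]
    exact h.2

theorem critExp_facts (hN : 3 ≤ N) : (2 : ℝ) < N ∧ critExp N * (N - 2) = 2 * N ∧
    (critExp N - 2) * (N - 2) = 4 := by
  have : (3 : ℝ) ≤ N := by exact_mod_cast hN
  have h2 : (N : ℝ) - 2 ≠ 0 := by linarith
  have h : critExp N * (N - 2) = 2 * N := by rw [critExp]; field_simp
  exact ⟨by linarith, h, by linarith⟩

theorem lt_critExp (hN : 3 ≤ N) {q : ℝ} (hq' : q < 2 + 4 / N) : q < critExp N := by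
  obtain ⟨h2, h3, h4⟩ := critExp_facts hN
  have : (4 : ℝ) / N < 4 / (N - 2) := div_lt_div_of_pos_left (by norm_num) (by linarith) (by linarith)
  have e : critExp N - 2 = 4 / (N - 2) := by rw [eq_div_iff (by linarith)]; exact h4
  linarith

/-- Interpolation between `L²` and `L^{2*}` followed by the Sobolev inequality; the interpolation
weight of `L^{2*}` is exactly `β`. -/
theorem exists_gagliardo (𝕜 : Type*) [RCLike 𝕜] (hN : 3 ≤ N) {q : ℝ} (hq : 2 < q)
    (hq' : q < critExp N) : ∃ C : ℝ, 0 ≤ C ∧ ∀ u : H1 𝕜 N,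
      lpNorm q u ≤ C * ‖u.grad‖ ^ (N * (1 / 2 - 1 / q) : ℝ)
        * ‖u.fn‖ ^ (1 - N * (1 / 2 - 1 / q) : ℝ) := by
  obtain ⟨C, hC0, hC⟩ := exists_lpNorm_critExp_le 𝕜 hN
  obtain ⟨h2, h3, h4⟩ := critExp_facts hN
  have hcr := two_lt_critExp hN
  set β : ℝ := N * (1 / 2 - 1 / q) with hβ
  refine ⟨C ^ β, by positivity, fun u => ?_⟩
  have h := (powInt_interpolation hN hq hq' u).2
  set p := critExp N with hp
  have hq0 : q ≠ 0 := by linarith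
  have hp2 : p - 2 ≠ 0 := by linarith
  have hN0 : (N : ℝ) ≠ 0 := by linarith
  have e1 : p * ((q - 2) / (p - 2)) * (1 / q) = β := by
    have hNm : (N : ℝ) - 2 ≠ 0 := by linarith
    have e2 : p = 2 * N / (N - 2) := rfl
    have e3 : p - 2 = 4 / (N - 2) := by rw [eq_div_iff hNm]; exact h4
    rw [e3, e2, hβ]
    field_simp
    ring
  have e4 : 2 * ((p - q) / (p - 2)) * (1 / q) = 1 - β := by
    rw [← e1]
    field_simp
    ring
  rw [← lpNorm_rpow (by linarith : p ≠ 0)] at h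
  have hl := lpNorm_nonneg p u
  calc lpNorm q u = powInt q u ^ (1 / q) := rfl
    _ ≤ ((‖u.fn‖ ^ 2) ^ ((p - q) / (p - 2)) * (lpNorm p u ^ p) ^ ((q - 2) / (p - 2))) ^ (1 / q) :=
        Real.rpow_le_rpow (powInt_nonneg q u) h (by positivity)
    _ = lpNorm p u ^ β * ‖u.fn‖ ^ (1 - β) := by
        rw [Real.mul_rpow (by positivity) (by positivity), ← Real.rpow_natCast ‖u.fn‖,
          ← Real.rpow_mul (norm_nonneg _), ← Real.rpow_mul (norm_nonneg _), ← Real.rpow_mul hl,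
          ← Real.rpow_mul hl, e1, Nat.cast_ofNat, e4, mul_comm]
    _ ≤ (C * ‖u.grad‖) ^ β * ‖u.fn‖ ^ (1 - β) := by
        refine mul_le_mul_of_nonneg_right (Real.rpow_le_rpow hl (hC u) ?_) (by positivity)
        rw [← e1]
        have : 0 ≤ (q - 2) / (p - 2) := div_nonneg (by linarith) (by linarith)
        positivity
    _ = _ := by rw [Real.mul_rpow hC0 (norm_nonneg _)]

/-- The embedding `H¹ → Lᵖ`, given a bound. -/
def lpEmbedding (p : ℝ) [Fact (1 ≤ ENNReal.ofReal p)]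
    (hm : ∀ u : H1 𝕜 N, MemLp u.fn (ENNReal.ofReal p) volume) (C : ℝ)
    (hC : ∀ u : H1 𝕜 N, (eLpNorm u.fn (ENNReal.ofReal p) volume).toReal ≤ C * ‖u‖) :
    H1 𝕜 N →L[ℝ] Lp 𝕜 (ENNReal.ofReal p) (volume : Measure (EuclideanSpace ℝ (Fin N))) :=
  LinearMap.mkContinuous
    { toFun := fun u => (hm u).toLp _
      map_add' := fun u v => by
        rw [← MemLp.toLp_add]
        exact MemLp.toLp_congr _ _ (Lp.coeFn_add u.fn v.fn)
      map_smul' := fun a u => by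
        rw [RingHom.id_apply, ← MemLp.toLp_const_smul]
        exact MemLp.toLp_congr _ _ (Lp.coeFn_smul a u.fn) }
    C (fun u => by
      simp only [LinearMap.coe_mk, AddHom.coe_mk, Lp.norm_toLp]
      exact hC u)

theorem contDiff_powInt_of_bound {p : ℝ} (hp : 2 < p)
    (hm : ∀ u : H1 𝕜 N, MemLp u.fn (ENNReal.ofReal p) volume) {C : ℝ}
    (hC : ∀ u : H1 𝕜 N, lpNorm p u ≤ C * ‖u‖) :
    ContDiff ℝ 1 (powInt p : H1 𝕜 N → ℝ) := by
  have : Fact (1 ≤ ENNReal.ofReal p) := ⟨by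
    rw [← ENNReal.ofReal_one]
    exact ENNReal.ofReal_le_ofReal (by linarith)⟩
  let J := lpEmbedding p hm C (fun u => (lpNorm_eq_toReal (by linarith) u (hm u)).symm.trans_le (hC u))
  have e : (powInt p : H1 𝕜 N → ℝ) = (fun f => ∫ x, ‖f x‖ ^ p) ∘ J := by
    ext u
    refine integral_congr_ae ?_
    filter_upwards [(hm u).coeFn_toLp] with x hx
    show ‖u.fn x‖ ^ p = ‖((hm u).toLp _ : EuclideanSpace ℝ (Fin N) → 𝕜) x‖ ^ p
    rw [hx]
  rw [e]
  exact (contDiff_integral_norm_rpow hp).comp J.contDiff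

theorem contDiff_powInt_critExp (hN : 3 ≤ N) : ContDiff ℝ 1 (powInt (critExp N) : H1 𝕜 N → ℝ) := by
  obtain ⟨C, hC0, hC⟩ := exists_lpNorm_critExp_le 𝕜 hN
  exact contDiff_powInt_of_bound (two_lt_critExp hN) (memLp_critExp hN)
    (fun u => (hC u).trans (mul_le_mul_of_nonneg_left (norm_grad_le u) hC0))

theorem contDiff_powInt (hN : 3 ≤ N) {q : ℝ} (hq : 2 < q) (hq' : q < critExp N) :
    ContDiff ℝ 1 (powInt q : H1 𝕜 N → ℝ) := by
  obtain ⟨C, hC0, hC⟩ := exists_gagliardo 𝕜 hN hq hq'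
  refine contDiff_powInt_of_bound hq (fun u => (powInt_interpolation hN hq hq' u).1) (C := C)
    fun u => (hC u).trans ?_
  have hN0 : (2 : ℝ) < N := (critExp_facts hN).1
  -- With `0 ≤ β ≤ 1`, both factors `‖∇u‖^β` and `‖u‖₂^{1-β}` are bounded by powers of the `H¹`
  -- norm, of total degree `1`.
  have hb : (N : ℝ) * (1 / 2 - 1 / q) ≤ 1 := by
    obtain ⟨h2, h3, h4⟩ := critExp_facts hN
    have : q * (N - 2) < 2 * N := by
      rw [← h3]
      exact mul_lt_mul_of_pos_right hq' (by linarith)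
    have e : (N : ℝ) * (1 / 2 - 1 / q) = N * (q - 2) / (2 * q) := by field_simp
    rw [e, div_le_one (by linarith)]
    linarith
  have hb0 : 0 ≤ (N : ℝ) * (1 / 2 - 1 / q) := by
    have : 1 / q ≤ 1 / 2 := one_div_le_one_div_of_le two_pos hq.le
    nlinarith
  set β := (N : ℝ) * (1 / 2 - 1 / q)
  rw [mul_assoc]
  refine mul_le_mul_of_nonneg_left ?_ hC0
  calc ‖u.grad‖ ^ β * ‖u.fn‖ ^ (1 - β) ≤ ‖u‖ ^ β * ‖u‖ ^ (1 - β) := by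
        have h1 := norm_grad_le u
        have h2 := norm_fn_le u
        gcongr
    _ = ‖u‖ := by
        rw [← Real.rpow_add' (norm_nonneg _) (by simp), add_sub_cancel, Real.rpow_one]

theorem contDiff_norm_grad_sq : ContDiff ℝ 1 (fun u : H1 𝕜 N => ‖u.grad‖ ^ 2) :=
  ((gradL 𝕜 N).contDiff).norm_sq ℝ

theorem contDiff_energy (hN : 3 ≤ N) {q : ℝ} (μ : ℝ) (hq : 2 < q) (hq' : q < critExp N) :
    ContDiff ℝ 1 (energy q μ : H1 𝕜 N → ℝ) :=
  ((contDiff_const.mul contDiff_norm_grad_sq).sub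
    (contDiff_const.mul (contDiff_powInt hN hq hq'))).sub
    (contDiff_const.mul (contDiff_powInt_critExp hN))

end Powers

/-! ### A nonzero radial function -/

section Radial

variable {N : ℕ}

/-- A smooth, compactly supported radial function, equal to `1` near `0`. -/
def radialBump (N : ℕ) (x : EuclideanSpace ℝ (Fin N)) : ℝ := Real.smoothTransition (2 - ‖x‖ ^ 2)

theorem contDiff_radialBump : ContDiff ℝ ∞ (radialBump N) :=
  Real.smoothTransition.contDiff.comp (contDiff_const.sub (contDiff_norm_sq ℝ))

theorem hasCompactSupport_radialBump : HasCompactSupport (radialBump N) := by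
  refine HasCompactSupport.intro (isCompact_closedBall (0 : EuclideanSpace ℝ (Fin N)) 2)
    fun x hx => ?_
  rw [Metric.mem_closedBall, dist_zero_right, not_le] at hx
  exact Real.smoothTransition.zero_of_nonpos (by nlinarith)

variable (𝕜 : Type*) [RCLike 𝕜]

/-- The element of `H¹` given by a test function. -/
def ofTest {φ : EuclideanSpace ℝ (Fin N) → ℝ} (hφ : ContDiff ℝ ∞ φ) (hc : HasCompactSupport φ) :
    H1 𝕜 N :=
  have hd : ∀ i : Fin N, MemLp (fun x => (fderiv ℝ φ x (EuclideanSpace.single i 1) : 𝕜)) 2 volume :=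
    fun i => (((hφ.continuous_fderiv (by simp)).clm_apply continuous_const).memLp_of_hasCompactSupport
      (hc.fderiv_apply (𝕜 := ℝ) (EuclideanSpace.single i 1))).ofReal
  have h0 : MemLp (fun x => (φ x : 𝕜)) 2 volume :=
    (hφ.continuous.memLp_of_hasCompactSupport hc).ofReal
  ⟨WithLp.toLp 2 (h0.toLp _, WithLp.toLp 2 fun i => (hd i).toLp _), by
    intro i ψ hψ hψc
    have e1 : ∫ x, (fderiv ℝ ψ x (EuclideanSpace.single i 1)) • (h0.toLp _ : L2 𝕜 N) x
        = ((∫ x, fderiv ℝ ψ x (EuclideanSpace.single i 1) * φ x : ℝ) : 𝕜) := by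
      rw [← integral_ofReal]
      refine integral_congr_ae ?_
      filter_upwards [h0.coeFn_toLp] with x hx
      rw [hx, RCLike.real_smul_eq_coe_mul, RCLike.ofReal_mul]
    have e2 : ∫ x, ψ x • ((hd i).toLp _ : L2 𝕜 N) x
        = ((∫ x, ψ x * fderiv ℝ φ x (EuclideanSpace.single i 1) : ℝ) : 𝕜) := by
      rw [← integral_ofReal]
      refine integral_congr_ae ?_
      filter_upwards [(hd i).coeFn_toLp] with x hx
      rw [hx, RCLike.real_smul_eq_coe_mul, RCLike.ofReal_mul]
    refine e1.trans (Eq.trans ?_ (congrArg Neg.neg e2.symm))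
    rw [← RCLike.ofReal_neg]
    congr 1
    have cφ' : Continuous fun x => fderiv ℝ φ x (EuclideanSpace.single i 1) :=
      (hφ.continuous_fderiv (by simp)).clm_apply continuous_const
    have cψ' : Continuous fun x => fderiv ℝ ψ x (EuclideanSpace.single i 1) :=
      (hψ.continuous_fderiv (by simp)).clm_apply continuous_const
    have ibp := integral_mul_fderiv_eq_neg_fderiv_mul_of_integrable
      (μ := (volume : Measure (EuclideanSpace ℝ (Fin N)))) (f := ψ) (g := φ)
      (v := EuclideanSpace.single i 1)
      ((cψ'.mul hφ.continuous).integrable_of_hasCompactSupport hc.mul_left)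
      ((hψ.continuous.mul cφ').integrable_of_hasCompactSupport hψc.mul_right)
      ((hψ.continuous.mul hφ.continuous).integrable_of_hasCompactSupport hc.mul_left)
      (fun x _ => hψ.differentiable (by simp) x) (fun x _ => hφ.differentiable (by simp) x)
    rw [ibp, neg_neg]⟩

theorem ofTest_fn {φ : EuclideanSpace ℝ (Fin N) → ℝ} (hφ : ContDiff ℝ ∞ φ)
    (hc : HasCompactSupport φ) : ∀ᵐ x, (ofTest 𝕜 hφ hc).fn x = (φ x : 𝕜) :=
  (hφ.continuous.memLp_of_hasCompactSupport hc).ofReal.coeFn_toLp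

/-- Rescaled, this function shows that `S_r(c)` is nonempty; it also makes the best constants
nondegenerate. -/
theorem exists_radial_ne_zero (N : ℕ) : ∃ u ∈ radialSet 𝕜 N, u.fn ≠ 0 := by
  refine ⟨ofTest 𝕜 contDiff_radialBump hasCompactSupport_radialBump, fun R => ?_, fun h0 => ?_⟩
  · have h := ofTest_fn 𝕜 (contDiff_radialBump (N := N)) hasCompactSupport_radialBump
    filter_upwards [h, R.measurePreserving.quasiMeasurePreserving.ae h] with x hx hRx
    rw [hx, hRx, radialBump, radialBump, R.norm_map]
  · have h := ofTest_fn 𝕜 (contDiff_radialBump (N := N)) hasCompactSupport_radialBump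
    rw [h0] at h
    have hz : (fun x => (radialBump N x : 𝕜)) =ᵐ[volume] fun _ => (0 : 𝕜) := by
      filter_upwards [h, Lp.coeFn_zero 𝕜 2 (volume : Measure (EuclideanSpace ℝ (Fin N)))]
        with x hx h0
      rw [← hx, h0, Pi.zero_apply]
    have hcont : Continuous fun x => (radialBump N x : 𝕜) :=
      RCLike.continuous_ofReal.comp contDiff_radialBump.continuous
    have h1 := congrFun ((Continuous.ae_eq_iff_eq _ hcont continuous_const).1 hz) 0
    simp only [radialBump, norm_zero] at h1
    rw [Real.smoothTransition.one_of_one_le (by norm_num)] at h1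
    simp at h1

end Radial

/-! ### The mass preserving dilations `(s ⋆ u)(x) = e^{Ns/2} u(e^s x)` -/

section Dilation

variable {𝕜 : Type*} [RCLike 𝕜] {N : ℕ}

theorem ae_comp_exp_smul (s : ℝ) {P : EuclideanSpace ℝ (Fin N) → Prop} (h : ∀ᵐ x, P x) :
    ∀ᵐ x, P (Real.exp s • x) :=
  (Measure.quasiMeasurePreserving_smul volume (Real.exp_ne_zero s)).ae h

theorem memLp_dilate (s : ℝ) (f : L2 𝕜 N) :
    MemLp (fun x => Real.exp (N * s / 2) • f (Real.exp s • x)) 2 volume := by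
  have h1 : MemLp f 2 (Measure.map (fun x : EuclideanSpace ℝ (Fin N) => Real.exp s • x) volume) := by
    rw [Measure.map_addHaar_smul volume (Real.exp_ne_zero s)]
    exact (Lp.memLp f).smul_measure ENNReal.ofReal_ne_top
  have h2 : MemLp (fun x => f (Real.exp s • x)) 2 volume :=
    h1.comp_of_map (measurable_const_smul _).aemeasurable
  exact h2.const_smul (Real.exp (N * s / 2))

theorem integral_comp_exp_smul {F : Type*} [NormedAddCommGroup F] [NormedSpace ℝ F] (s : ℝ)
    (f : EuclideanSpace ℝ (Fin N) → F) :
    ∫ x, f (Real.exp s • x) = Real.exp (-(N * s)) • ∫ x, f x := by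
  rw [Measure.integral_comp_smul, finrank_euclideanSpace_fin, abs_of_pos (by positivity),
    ← Real.exp_nat_mul, ← Real.exp_neg]

theorem norm_L2_sq (f : L2 𝕜 N) : ‖f‖ ^ 2 = ∫ x, ‖f x‖ ^ 2 := by
  rw [← real_inner_self_eq_norm_sq, L2.inner_def]
  exact integral_congr_ae (ae_of_all _ fun x => by simp only [real_inner_self_eq_norm_sq])

/-- Dilations as linear isometries of `L²`. -/
def dilL2 (𝕜 : Type*) [RCLike 𝕜] (N : ℕ) (s : ℝ) : L2 𝕜 N →ₗᵢ[ℝ] L2 𝕜 N where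
  toFun f := (memLp_dilate s f).toLp _
  map_add' f g := by
    rw [← MemLp.toLp_add]
    refine MemLp.toLp_congr _ _ ?_
    filter_upwards [ae_comp_exp_smul s (Lp.coeFn_add f g)] with x hx
    rw [hx, Pi.add_apply, Pi.add_apply, smul_add]
  map_smul' a f := by
    rw [RingHom.id_apply, ← MemLp.toLp_const_smul]
    refine MemLp.toLp_congr _ _ ?_
    filter_upwards [ae_comp_exp_smul s (Lp.coeFn_smul a f)] with x hx
    rw [hx, Pi.smul_apply, Pi.smul_apply, smul_comm]
  norm_map' f := by
    simp only [LinearMap.coe_mk, AddHom.coe_mk]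
    rw [← sq_eq_sq₀ (norm_nonneg _) (norm_nonneg _), norm_L2_sq, norm_L2_sq]
    have e : ∫ x, ‖((memLp_dilate s f).toLp _ : L2 𝕜 N) x‖ ^ 2
        = Real.exp (-(N * s)) • ∫ y, Real.exp (N * s) * ‖f y‖ ^ 2 := by
      rw [← integral_comp_exp_smul s (fun y => Real.exp (N * s) * ‖f y‖ ^ 2)]
      refine integral_congr_ae ?_
      filter_upwards [(memLp_dilate s f).coeFn_toLp] with x hx
      rw [hx, norm_smul, Real.norm_of_nonneg (Real.exp_pos _).le, mul_pow, ← Real.exp_nat_mul]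
      congr 2
      push_cast
      ring
    rw [e, integral_const_mul, smul_eq_mul, ← mul_assoc, ← Real.exp_add]
    simp

theorem dilL2_ae (s : ℝ) (f : L2 𝕜 N) :
    ∀ᵐ x, dilL2 𝕜 N s f x = Real.exp (N * s / 2) • f (Real.exp s • x) :=
  (memLp_dilate s f).coeFn_toLp

theorem dilL2_dilL2_neg (s : ℝ) (f : L2 𝕜 N) : dilL2 𝕜 N s (dilL2 𝕜 N (-s) f) = f := by
  refine Lp.ext ?_
  filter_upwards [dilL2_ae s (dilL2 𝕜 N (-s) f), ae_comp_exp_smul s (dilL2_ae (-s) f)] with x h1 h2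
  rw [h1, h2, smul_smul, smul_smul, ← Real.exp_add, ← Real.exp_add,
    show (N : ℝ) * s / 2 + N * -s / 2 = 0 by ring]
  simp

/-- Dilations are isometries, so density reduces the claim to continuous functions with compact
support. For these, equality of norms reduces norm convergence to convergence of inner products. -/
theorem tendsto_dilL2 (s₀ : ℝ) (f : L2 𝕜 N) :
    Tendsto (fun s => dilL2 𝕜 N s f) (𝓝 s₀) (𝓝 (dilL2 𝕜 N s₀ f)) := by
  -- continuous functions with compact support
  have hcore : ∀ g : EuclideanSpace ℝ (Fin N) → 𝕜, Continuous g → HasCompactSupport g →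
      ∀ hm : MemLp g 2 volume, Tendsto (fun s => dilL2 𝕜 N s (hm.toLp g)) (𝓝 s₀)
        (𝓝 (dilL2 𝕜 N s₀ (hm.toLp g))) := by
    intro g hg hgc hm
    set G : L2 𝕜 N := hm.toLp g
    have hG : ∀ s, ∀ᵐ x, dilL2 𝕜 N s G x = Real.exp (N * s / 2) • g (Real.exp s • x) := by
      intro s
      filter_upwards [dilL2_ae s G, ae_comp_exp_smul s hm.coeFn_toLp] with x h1 h2
      rw [h1, h2]
    obtain ⟨M, hM⟩ := hg.bounded_above_of_compact_support hgc
    have hM0 : 0 ≤ M := (norm_nonneg _).trans (hM 0)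
    -- Dominated convergence is easy for the inner product, because the factor at `s₀` is fixed and
    -- compactly supported.
    have hinner : Tendsto (fun s => inner ℝ (dilL2 𝕜 N s G) (dilL2 𝕜 N s₀ G)) (𝓝 s₀)
        (𝓝 (inner ℝ (dilL2 𝕜 N s₀ G) (dilL2 𝕜 N s₀ G))) := by
      have e : ∀ s, inner ℝ (dilL2 𝕜 N s G) (dilL2 𝕜 N s₀ G)
          = ∫ x, inner ℝ (Real.exp (N * s / 2) • g (Real.exp s • x))
            (Real.exp (N * s₀ / 2) • g (Real.exp s₀ • x)) := by
        intro s
        rw [L2.inner_def]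
        refine integral_congr_ae ?_
        filter_upwards [hG s, hG s₀] with x h1 h2
        rw [h1, h2]
      simp only [e]
      have hgs : ∀ s, Continuous fun x : EuclideanSpace ℝ (Fin N) =>
          Real.exp (N * s / 2) • g (Real.exp s • x) := fun s => by fun_prop
      refine tendsto_integral_filter_of_dominated_convergence
        (fun x => Real.exp (N * (s₀ + 1) / 2) * M * ‖Real.exp (N * s₀ / 2) • g (Real.exp s₀ • x)‖)
        (Eventually.of_forall fun s => ((hgs s).inner (hgs s₀)).aestronglyMeasurable) ?_ ?_ ?_
      · filter_upwards [Metric.ball_mem_nhds s₀ one_pos] with s hs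
        refine ae_of_all _ fun x => (norm_inner_le_norm _ _).trans ?_
        refine mul_le_mul_of_nonneg_right ?_ (norm_nonneg _)
        rw [norm_smul, Real.norm_of_nonneg (Real.exp_pos _).le]
        have hs' : s ≤ s₀ + 1 := by
          have := (abs_lt.1 (by rwa [Metric.mem_ball, Real.dist_eq] at hs)).2
          linarith
        have : Real.exp (N * s / 2) ≤ Real.exp (N * (s₀ + 1) / 2) := by gcongr
        exact mul_le_mul this (hM _) (norm_nonneg _) (Real.exp_pos _).le
      · refine Integrable.const_mul ?_ _
        refine (hgs s₀).norm.integrable_of_hasCompactSupport ?_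
        exact ((hgc.comp_smul (Real.exp_ne_zero s₀)).smul_left (f := fun _ => Real.exp (N * s₀ / 2))).norm
      · refine ae_of_all _ fun x => ?_
        have : Continuous fun s => inner ℝ (Real.exp (N * s / 2) • g (Real.exp s • x))
            (Real.exp (N * s₀ / 2) • g (Real.exp s₀ • x)) := by fun_prop
        exact this.tendsto s₀
    rw [tendsto_iff_norm_sub_tendsto_zero]
    have hsq : Tendsto (fun s => ‖dilL2 𝕜 N s G - dilL2 𝕜 N s₀ G‖ ^ 2) (𝓝 s₀) (𝓝 0) := by
      have e : ∀ s, ‖dilL2 𝕜 N s G - dilL2 𝕜 N s₀ G‖ ^ 2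
          = 2 * ‖G‖ ^ 2 - 2 * inner ℝ (dilL2 𝕜 N s G) (dilL2 𝕜 N s₀ G) := by
        intro s
        rw [norm_sub_sq_real, LinearIsometry.norm_map, LinearIsometry.norm_map]
        ring
      simp only [e]
      have := (hinner.const_mul 2).const_sub (2 * ‖G‖ ^ 2)
      rwa [real_inner_self_eq_norm_sq, LinearIsometry.norm_map, sub_self] at this
    have := hsq.sqrt
    simpa [Real.sqrt_sq (norm_nonneg _)] using this
  rw [Metric.tendsto_nhds]
  intro ε hε
  obtain ⟨g, hgc, hgε, hg, hgm⟩ := (Lp.memLp f).exists_hasCompactSupport_eLpNorm_sub_le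
    (by norm_num) (ε := ENNReal.ofReal (ε / 4)) (by simpa using hε)
  have hfg : ‖f - hgm.toLp g‖ ≤ ε / 4 := by
    have : f - hgm.toLp g = ((Lp.memLp f).sub hgm).toLp _ := by
      rw [MemLp.toLp_sub (Lp.memLp f) hgm, Lp.toLp_coeFn f (Lp.memLp f)]
    rw [this, Lp.norm_toLp]
    exact ENNReal.toReal_le_of_le_ofReal (by linarith) hgε
  filter_upwards [Metric.tendsto_nhds.1 (hcore g hg hgc hgm) (ε / 4) (by linarith)] with s hs
  have hd : ∀ t, dist (dilL2 𝕜 N t f) (dilL2 𝕜 N t (hgm.toLp g)) ≤ ε / 4 := fun t => by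
    rw [(dilL2 𝕜 N t).isometry.dist_eq, dist_eq_norm]
    exact hfg
  calc dist (dilL2 𝕜 N s f) (dilL2 𝕜 N s₀ f)
      ≤ dist (dilL2 𝕜 N s f) (dilL2 𝕜 N s (hgm.toLp g))
        + dist (dilL2 𝕜 N s (hgm.toLp g)) (dilL2 𝕜 N s₀ (hgm.toLp g))
        + dist (dilL2 𝕜 N s₀ (hgm.toLp g)) (dilL2 𝕜 N s₀ f) := dist_triangle4 _ _ _ _
    _ < ε := by
        have h1 := hd s
        have h2 := hd s₀
        rw [dist_comm] at h2
        linarith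

/-- Joint continuity follows from continuity in `s` alone, because the maps are isometries and hence
equicontinuous in `f`. -/
theorem continuous_dilL2 : Continuous fun p : L2 𝕜 N × ℝ => dilL2 𝕜 N p.2 p.1 := by
  rw [continuous_iff_continuousAt]
  rintro ⟨f₀, s₀⟩
  rw [ContinuousAt, tendsto_iff_dist_tendsto_zero]
  have h1 : Tendsto (fun p : L2 𝕜 N × ℝ => dist p.1 f₀ + dist (dilL2 𝕜 N p.2 f₀) (dilL2 𝕜 N s₀ f₀))
      (𝓝 (f₀, s₀)) (𝓝 (0 + 0)) := by
    refine Tendsto.add ?_ ?_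
    · exact tendsto_iff_dist_tendsto_zero.1 (continuous_fst.tendsto (f₀, s₀))
    · exact tendsto_iff_dist_tendsto_zero.1
        ((tendsto_dilL2 s₀ f₀).comp (continuous_snd.tendsto (f₀, s₀)))
  rw [add_zero] at h1
  refine squeeze_zero (fun _ => dist_nonneg) (fun p => ?_) h1
  refine (dist_triangle _ (dilL2 𝕜 N p.2 f₀) _).trans ?_
  rw [(dilL2 𝕜 N p.2).isometry.dist_eq]

theorem isWeakPartialDeriv_dilate (s : ℝ) (i : Fin N) {u g : L2 𝕜 N} (h : IsWeakPartialDeriv i u g) :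
    IsWeakPartialDeriv i (dilL2 𝕜 N s u) (Real.exp s • dilL2 𝕜 N s g : L2 𝕜 N) := by
  intro φ hφ hc
  -- The dilation is transferred to the test function by the change of variables `y = e^s x`.
  let ψ : EuclideanSpace ℝ (Fin N) → ℝ := fun y => φ (Real.exp (-s) • y)
  have hψ : ContDiff ℝ ∞ ψ := hφ.comp (contDiff_const_smul _)
  have hψc : HasCompactSupport ψ := hc.comp_smul (Real.exp_ne_zero _)
  have hcancel : ∀ x : EuclideanSpace ℝ (Fin N), Real.exp (-s) • Real.exp s • x = x := fun x => by
    rw [smul_smul, ← Real.exp_add]; simp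
  have hψd : ∀ x, fderiv ℝ φ x (EuclideanSpace.single i 1)
      = Real.exp s * fderiv ℝ ψ (Real.exp s • x) (EuclideanSpace.single i 1) := by
    intro x
    have : fderiv ℝ ψ (Real.exp s • x) = Real.exp (-s) • fderiv ℝ φ (Real.exp (-s) • Real.exp s • x) :=
      fderiv_comp_smul (Real.exp (-s))
    rw [this, hcancel, smul_apply, smul_eq_mul, ← mul_assoc, ← Real.exp_add]
    simp
  have e1 : ∫ x, (fderiv ℝ φ x (EuclideanSpace.single i 1)) • dilL2 𝕜 N s u x
      = Real.exp (-(N * s)) • ∫ y, (Real.exp (N * s / 2) * Real.exp s) •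
        ((fderiv ℝ ψ y (EuclideanSpace.single i 1)) • u y) := by
    rw [← integral_comp_exp_smul s (fun y => (Real.exp (N * s / 2) * Real.exp s) •
        ((fderiv ℝ ψ y (EuclideanSpace.single i 1)) • u y))]
    refine integral_congr_ae ?_
    filter_upwards [dilL2_ae s u] with x hx
    rw [hx, hψd]
    simp only [smul_smul]
    congr 1
    ring
  have e2 : ∫ x, φ x • (Real.exp s • dilL2 𝕜 N s g : L2 𝕜 N) x
      = Real.exp (-(N * s)) • ∫ y, (Real.exp (N * s / 2) * Real.exp s) • (ψ y • g y) := by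
    rw [← integral_comp_exp_smul s
      (fun y => (Real.exp (N * s / 2) * Real.exp s) • (ψ y • g y))]
    refine integral_congr_ae ?_
    filter_upwards [dilL2_ae s g, Lp.coeFn_smul (Real.exp s) (dilL2 𝕜 N s g)] with x hx hx2
    rw [hx2, Pi.smul_apply, hx]
    simp only [smul_smul, ψ, hcancel]
    congr 1
    ring
  rw [e1, e2, integral_smul, integral_smul,
    h ψ hψ hψc, smul_neg, smul_neg]

/-- The element of `H¹` with given function and given weak derivatives. -/
def H1.mk (f : L2 𝕜 N) (g : Fin N → L2 𝕜 N) (h : ∀ i, IsWeakPartialDeriv i f (g i)) : H1 𝕜 N :=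
  ⟨WithLp.toLp 2 (f, WithLp.toLp 2 g), h⟩

@[simp] theorem H1.mk_fn (f : L2 𝕜 N) (g : Fin N → L2 𝕜 N) (h) : (H1.mk f g h).fn = f := rfl

@[simp] theorem H1.mk_grad (f : L2 𝕜 N) (g : Fin N → L2 𝕜 N) (h) (i : Fin N) :
    (H1.mk f g h).grad i = g i := rfl

theorem H1.ext_of_grad {u v : H1 𝕜 N} (h : u.fn = v.fn) (h' : ∀ i, u.grad i = v.grad i) : u = v :=
  Subtype.ext (WithLp.ofLp_injective 2 (Prod.ext h (WithLp.ofLp_injective 2 (funext h'))))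

@[simp] theorem H1.add_fn (u v : H1 𝕜 N) : (u + v).fn = u.fn + v.fn := rfl

@[simp] theorem H1.add_grad (u v : H1 𝕜 N) (i : Fin N) : (u + v).grad i = u.grad i + v.grad i := rfl

@[simp] theorem H1.smul_grad (a : ℝ) (u : H1 𝕜 N) (i : Fin N) :
    (a • u).grad i = a • u.grad i := rfl

@[simp] theorem H1.smul_fn (a : ℝ) (u : H1 𝕜 N) : (a • u).fn = a • u.fn := rfl

/-- The dilation `e^{Ns/2} u(e^s ·)` of an element of `H¹`. -/
def dilFun (s : ℝ) (u : H1 𝕜 N) : H1 𝕜 N :=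
  H1.mk (dilL2 𝕜 N s u.fn) (fun i => Real.exp s • dilL2 𝕜 N s (u.grad i))
    fun i => isWeakPartialDeriv_dilate s i (u.isWeakPartialDeriv i)

theorem norm_dilFun_le (s : ℝ) (u : H1 𝕜 N) : ‖dilFun s u‖ ≤ max 1 (Real.exp s) * ‖u‖ := by
  refine le_of_sq_le_sq ?_ (by positivity)
  rw [norm_sq_eq, mul_pow, norm_sq_eq, norm_grad_sq, norm_grad_sq]
  simp only [dilFun, H1.mk_fn, H1.mk_grad, LinearIsometry.norm_map, norm_smul, mul_pow,
    Real.norm_of_nonneg (Real.exp_pos s).le]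
  rw [← Finset.mul_sum, mul_add]
  have a1 : (1 : ℝ) ≤ max 1 (Real.exp s) ^ 2 := one_le_pow₀ (le_max_left _ _)
  have a2 : Real.exp s ^ 2 ≤ max 1 (Real.exp s) ^ 2 :=
    pow_le_pow_left₀ (Real.exp_pos s).le (le_max_right _ _) 2
  have a3 : 0 ≤ ∑ i, ‖u.grad i‖ ^ 2 := by positivity
  nlinarith [sq_nonneg ‖u.fn‖]

/-- Dilations as continuous linear maps of `H¹`. -/
def dil (𝕜 : Type*) [RCLike 𝕜] (N : ℕ) (s : ℝ) : H1 𝕜 N →L[ℝ] H1 𝕜 N :=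
  LinearMap.mkContinuous
    { toFun := dilFun s
      map_add' := fun u v => H1.ext_of_grad (by simp [dilFun]) (by simp [dilFun])
      map_smul' := fun a u => H1.ext_of_grad (by simp [dilFun])
        (fun i => by
          simp only [dilFun, H1.mk_grad, H1.smul_grad, map_smul, RingHom.id_apply]
          exact smul_comm _ _ _) }
    (max 1 (Real.exp s)) (norm_dilFun_le s)

theorem dil_fn (s : ℝ) (u : H1 𝕜 N) : (dil 𝕜 N s u).fn = dilL2 𝕜 N s u.fn := rfl

theorem dil_grad (s : ℝ) (u : H1 𝕜 N) (i : Fin N) :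
    (dil 𝕜 N s u).grad i = Real.exp s • dilL2 𝕜 N s (u.grad i) := rfl

theorem norm_dil_le (s : ℝ) (u : H1 𝕜 N) : ‖dil 𝕜 N s u‖ ≤ max 1 (Real.exp s) * ‖u‖ :=
  norm_dilFun_le s u

theorem norm_dil_fn (s : ℝ) (u : H1 𝕜 N) : ‖(dil 𝕜 N s u).fn‖ = ‖u.fn‖ :=
  LinearIsometry.norm_map _ _

theorem inner_dil_fn (s : ℝ) (u v : H1 𝕜 N) :
    inner ℝ (dil 𝕜 N s u).fn (dil 𝕜 N s v).fn = inner ℝ u.fn v.fn :=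
  LinearIsometry.inner_map_map _ _ _

theorem norm_dil_grad_sq (s : ℝ) (u : H1 𝕜 N) :
    ‖(dil 𝕜 N s u).grad‖ ^ 2 = Real.exp (2 * s) * ‖u.grad‖ ^ 2 := by
  rw [norm_grad_sq, norm_grad_sq, Finset.mul_sum]
  refine Finset.sum_congr rfl fun i _ => ?_
  rw [dil_grad, norm_smul, LinearIsometry.norm_map, Real.norm_of_nonneg (Real.exp_pos _).le,
    mul_pow, ← Real.exp_nat_mul, Nat.cast_ofNat]

theorem powInt_dil (p s : ℝ) (u : H1 𝕜 N) :
    powInt p (dil 𝕜 N s u) = Real.exp (N * (p - 2) / 2 * s) * powInt p u := by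
  have e : powInt p (dil 𝕜 N s u)
      = Real.exp (-(N * s)) • ∫ y, Real.exp (N * s / 2 * p) * ‖u.fn y‖ ^ p := by
    rw [← integral_comp_exp_smul s (fun y => Real.exp (N * s / 2 * p) * ‖u.fn y‖ ^ p)]
    refine integral_congr_ae ?_
    filter_upwards [dilL2_ae s u.fn] with x hx
    rw [dil_fn, hx, norm_smul, Real.norm_of_nonneg (Real.exp_pos _).le,
      Real.mul_rpow (Real.exp_pos _).le (norm_nonneg _), ← Real.exp_mul]
  rw [e, integral_const_mul, smul_eq_mul, ← mul_assoc, ← Real.exp_add,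
    powInt]
  congr 2
  ring

theorem dil_dil_neg (s : ℝ) (u : H1 𝕜 N) : dil 𝕜 N s (dil 𝕜 N (-s) u) = u := by
  refine H1.ext_of_grad ?_ fun i => ?_
  · rw [dil_fn, dil_fn, dilL2_dilL2_neg]
  · rw [dil_grad, dil_grad, map_smul, smul_smul, ← Real.exp_add, dilL2_dilL2_neg]
    simp

theorem continuous_dil : Continuous fun p : H1 𝕜 N × ℝ => dil 𝕜 N p.2 p.1 := by
  have h1 : Continuous fun p : H1 𝕜 N × ℝ => dilL2 𝕜 N p.2 p.1.fn :=
    continuous_dilL2.comp (((fnL 𝕜 N).continuous.comp continuous_fst).prodMk continuous_snd)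
  have h2 : ∀ i, Continuous fun p : H1 𝕜 N × ℝ =>
      Real.exp p.2 • dilL2 𝕜 N p.2 (p.1.grad i) := fun i =>
    (Real.continuous_exp.comp continuous_snd).smul (continuous_dilL2.comp
      ((((PiLp.proj (𝕜 := ℝ) 2 (fun _ : Fin N => L2 𝕜 N) i).continuous.comp
        (gradL 𝕜 N).continuous).comp continuous_fst).prodMk continuous_snd))
  have h3 := (WithLp.prod_continuous_toLp 2 (L2 𝕜 N) (PiLp 2 (fun _ : Fin N => L2 𝕜 N))).comp
    (h1.prodMk ((PiLp.continuous_toLp 2 (fun _ : Fin N => L2 𝕜 N)).comp (continuous_pi h2)))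
  exact Continuous.subtype_mk h3 _

theorem dil_mem_radialSet (s : ℝ) {u : H1 𝕜 N} (hu : u ∈ radialSet 𝕜 N) :
    dil 𝕜 N s u ∈ radialSet 𝕜 N := by
  intro R
  have h := dilL2_ae s u.fn
  filter_upwards [h, R.measurePreserving.quasiMeasurePreserving.ae h,
    ae_comp_exp_smul s (hu R)] with x h1 h2 h3
  rw [dil_fn, h1, h2, ← h3, map_smul]

end Dilation

/-! ### Rotations and symmetric criticality -/

/-- An orthogonal matrix acting on the index of a family of vectors preserves the sum of squares.
For the partial derivatives this makes rotations isometries of `H¹`. -/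
theorem sum_norm_sq_orthogonal {V ι : Type*} [NormedAddCommGroup V] [InnerProductSpace ℝ V]
    [Fintype ι] [DecidableEq ι] (a : ι → ι → ℝ)
    (ha : ∀ j k, ∑ i, a i j * a i k = if j = k then 1 else 0) (w : ι → V) :
    ∑ i, ‖∑ j, a i j • w j‖ ^ 2 = ∑ j, ‖w j‖ ^ 2 := by
  have h1 : ∀ i, ‖∑ j, a i j • w j‖ ^ 2 = ∑ j, ∑ k, (a i j * a i k) * inner ℝ (w j) (w k) := by
    intro i
    rw [← real_inner_self_eq_norm_sq, sum_inner]
    refine Finset.sum_congr rfl fun j _ => ?_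
    rw [inner_sum]
    refine Finset.sum_congr rfl fun k _ => ?_
    rw [real_inner_smul_left, real_inner_smul_right, mul_assoc]
  simp only [h1]
  rw [Finset.sum_comm]
  refine Finset.sum_congr rfl fun j _ => ?_
  rw [Finset.sum_comm]
  simp only [← Finset.sum_mul, ha, ite_mul, one_mul, zero_mul, Finset.sum_ite_eq,
    Finset.mem_univ, if_true, real_inner_self_eq_norm_sq]

section Rotation

variable {𝕜 : Type*} [RCLike 𝕜] {N : ℕ}

/-- Composition with a linear isometry of `ℝᴺ`, as a linear isometry of `L²`. -/
def rotL2 (𝕜 : Type*) [RCLike 𝕜] {N : ℕ}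
    (R : EuclideanSpace ℝ (Fin N) ≃ₗᵢ[ℝ] EuclideanSpace ℝ (Fin N)) : L2 𝕜 N →ₗᵢ[ℝ] L2 𝕜 N :=
  Lp.compMeasurePreservingₗᵢ ℝ R R.measurePreserving

theorem rotL2_ae (R : EuclideanSpace ℝ (Fin N) ≃ₗᵢ[ℝ] EuclideanSpace ℝ (Fin N)) (f : L2 𝕜 N) :
    ∀ᵐ x, rotL2 𝕜 R f x = f (R x) :=
  Lp.coeFn_compMeasurePreserving f R.measurePreserving

theorem integral_comp_isometry {F : Type*} [NormedAddCommGroup F] [NormedSpace ℝ F]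
    (R : EuclideanSpace ℝ (Fin N) ≃ₗᵢ[ℝ] EuclideanSpace ℝ (Fin N))
    (f : EuclideanSpace ℝ (Fin N) → F) : ∫ x, f (R x) = ∫ x, f x :=
  R.measurePreserving.integral_comp R.toHomeomorph.measurableEmbedding f

theorem isWeakPartialDeriv_rot (R : EuclideanSpace ℝ (Fin N) ≃ₗᵢ[ℝ] EuclideanSpace ℝ (Fin N))
    {u : L2 𝕜 N} {g : Fin N → L2 𝕜 N} (h : ∀ j, IsWeakPartialDeriv j u (g j)) (i : Fin N) :
    IsWeakPartialDeriv i (rotL2 𝕜 R u)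
      (∑ j, (R (EuclideanSpace.single i 1) : EuclideanSpace ℝ (Fin N)) j • rotL2 𝕜 R (g j) : L2 𝕜 N) := by
  intro φ hφ hc
  set a : Fin N → ℝ := fun j => (R (EuclideanSpace.single i 1) : EuclideanSpace ℝ (Fin N)) j
  let ψ : EuclideanSpace ℝ (Fin N) → ℝ := fun y => φ (R.symm y)
  have hψ : ContDiff ℝ ∞ ψ := hφ.comp R.symm.contDiff
  have hψc : HasCompactSupport ψ := hc.comp_homeomorph R.symm.toHomeomorph
  have hd : ∀ x, fderiv ℝ φ x (EuclideanSpace.single i 1)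
      = ∑ j, a j * fderiv ℝ ψ (R x) (EuclideanSpace.single j 1) := by
    intro x
    have e : φ = fun x => ψ (R x) := by ext x; simp [ψ]
    have h1 : HasFDerivAt (fun x => ψ (R x)) _ x :=
      ((hψ.differentiable (by simp)) (R x)).hasFDerivAt.comp x
        R.toContinuousLinearEquiv.toContinuousLinearMap.hasFDerivAt
    rw [← e] at h1
    rw [h1.fderiv]
    have h2 := (EuclideanSpace.basisFun (Fin N) ℝ).sum_repr (R (EuclideanSpace.single i 1))
    show fderiv ℝ ψ (R x) (R (EuclideanSpace.single i 1)) = _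
    conv_lhs => rw [← h2]
    simp [a]
  have e1 : ∫ x, (fderiv ℝ φ x (EuclideanSpace.single i 1)) • rotL2 𝕜 R u x
      = ∫ y, ∑ j, a j • ((fderiv ℝ ψ y (EuclideanSpace.single j 1)) • u y) := by
    rw [← integral_comp_isometry R
      (fun y => ∑ j, a j • ((fderiv ℝ ψ y (EuclideanSpace.single j 1)) • u y))]
    refine integral_congr_ae ?_
    filter_upwards [rotL2_ae R u] with x hx
    rw [hx, hd, Finset.sum_smul]
    simp only [smul_smul]
  have e2 : ∫ x, φ x • (∑ j, a j • rotL2 𝕜 R (g j) : L2 𝕜 N) x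
      = ∫ y, ∑ j, a j • (ψ y • g j y) := by
    rw [← integral_comp_isometry R (fun y => ∑ j, a j • (ψ y • g j y))]
    refine integral_congr_ae ?_
    have h1 : ∀ᵐ x, ∀ j, rotL2 𝕜 R (g j) x = g j (R x) := ae_all_iff.2 fun j => rotL2_ae R (g j)
    have h2 : ∀ᵐ x, ∀ j, (a j • rotL2 𝕜 R (g j) : L2 𝕜 N) x = a j • rotL2 𝕜 R (g j) x :=
      ae_all_iff.2 fun j => Lp.coeFn_smul _ _
    have h3 : ((∑ j, a j • rotL2 𝕜 R (g j) : L2 𝕜 N) : EuclideanSpace ℝ (Fin N) → 𝕜)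
        =ᵐ[volume] ∑ j, ((a j • rotL2 𝕜 R (g j) : L2 𝕜 N) : EuclideanSpace ℝ (Fin N) → 𝕜) :=
      Lp.coeFn_finsetSum _ _
    filter_upwards [h1, h2, h3] with x hx1 hx2 hx3
    rw [hx3, Finset.sum_apply, Finset.smul_sum]
    refine Finset.sum_congr rfl fun j _ => ?_
    rw [hx2, hx1, smul_comm]
    simp [ψ]
  rw [e1, e2, integral_finsetSum, integral_finsetSum, ← Finset.sum_neg_distrib]
  · refine Finset.sum_congr rfl fun j _ => ?_
    rw [integral_smul, integral_smul, h j ψ hψ hψc, smul_neg]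
  · exact fun j _ => (integrable_smul_of_test hψ.continuous hψc (g j)).smul (a j)
  · exact fun j _ => (integrable_deriv_smul_of_test j hψ hψc u).smul (a j)

/-- Parseval's identity for the orthonormal basis `R eᵢ`. -/
theorem sum_isometry_coord_mul (R : EuclideanSpace ℝ (Fin N) ≃ₗᵢ[ℝ] EuclideanSpace ℝ (Fin N))
    (j k : Fin N) : ∑ i, (R (EuclideanSpace.single i 1) : EuclideanSpace ℝ (Fin N)) j
      * (R (EuclideanSpace.single i 1) : EuclideanSpace ℝ (Fin N)) k = if j = k then 1 else 0 := by
  have h := ((EuclideanSpace.basisFun (Fin N) ℝ).map R).sum_inner_mul_inner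
    (EuclideanSpace.single j (1 : ℝ)) (EuclideanSpace.single k (1 : ℝ))
  simpa [EuclideanSpace.inner_single_left, EuclideanSpace.inner_single_right, Pi.single_apply,
    eq_comm] using h

/-- Composition with a linear isometry of `ℝᴺ`, as a map of `H¹`. -/
def rotFun (R : EuclideanSpace ℝ (Fin N) ≃ₗᵢ[ℝ] EuclideanSpace ℝ (Fin N)) (u : H1 𝕜 N) : H1 𝕜 N :=
  H1.mk (rotL2 𝕜 R u.fn)
    (fun i => ∑ j, (R (EuclideanSpace.single i 1) : EuclideanSpace ℝ (Fin N)) j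
      • rotL2 𝕜 R (u.grad j))
    (isWeakPartialDeriv_rot R u.isWeakPartialDeriv)

theorem norm_rotFun_grad (R : EuclideanSpace ℝ (Fin N) ≃ₗᵢ[ℝ] EuclideanSpace ℝ (Fin N))
    (u : H1 𝕜 N) : ‖(rotFun R u).grad‖ = ‖u.grad‖ := by
  rw [← sq_eq_sq₀ (norm_nonneg _) (norm_nonneg _), norm_grad_sq, norm_grad_sq]
  simp only [rotFun, H1.mk_grad]
  rw [sum_norm_sq_orthogonal _ (sum_isometry_coord_mul R)]
  simp only [LinearIsometry.norm_map]

/-- Composition with a linear isometry of `ℝᴺ`, as a linear isometry of `H¹`. -/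
def rot (R : EuclideanSpace ℝ (Fin N) ≃ₗᵢ[ℝ] EuclideanSpace ℝ (Fin N)) :
    H1 𝕜 N →ₗᵢ[ℝ] H1 𝕜 N where
  toFun := rotFun R
  map_add' u v := H1.ext_of_grad (by simp [rotFun]) (fun i => by
    simp only [rotFun, H1.mk_grad, H1.add_grad, map_add, smul_add, Finset.sum_add_distrib])
  map_smul' a u := H1.ext_of_grad (by simp [rotFun]) (fun i => by
    simp only [rotFun, H1.mk_grad, H1.smul_grad, map_smul, RingHom.id_apply, Finset.smul_sum]
    exact Finset.sum_congr rfl fun j _ => smul_comm _ _ _)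
  norm_map' u := by
    rw [← sq_eq_sq₀ (norm_nonneg _) (norm_nonneg _), norm_sq_eq, norm_sq_eq]
    simp only [LinearMap.coe_mk, AddHom.coe_mk]
    rw [norm_rotFun_grad]
    simp [rotFun]

theorem rot_fn (R : EuclideanSpace ℝ (Fin N) ≃ₗᵢ[ℝ] EuclideanSpace ℝ (Fin N)) (u : H1 𝕜 N) :
    (rot R u).fn = rotL2 𝕜 R u.fn := rfl

theorem powInt_rot (p : ℝ) (R : EuclideanSpace ℝ (Fin N) ≃ₗᵢ[ℝ] EuclideanSpace ℝ (Fin N))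
    (u : H1 𝕜 N) : powInt p (rot R u) = powInt p u := by
  rw [powInt, powInt, ← integral_comp_isometry R (fun y => ‖u.fn y‖ ^ p)]
  refine integral_congr_ae ?_
  filter_upwards [rotL2_ae R u.fn] with x hx
  rw [rot_fn, hx]

theorem energy_rot (q μ : ℝ) (R : EuclideanSpace ℝ (Fin N) ≃ₗᵢ[ℝ] EuclideanSpace ℝ (Fin N))
    (u : H1 𝕜 N) : energy q μ (rot R u) = energy q μ u := by
  rw [energy, energy, powInt_rot, powInt_rot]
  congr 4
  exact norm_rotFun_grad R u

/-- The weak gradient is determined by the function. -/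
theorem H1.ext_of_fn {u v : H1 𝕜 N} (h : u.fn = v.fn) : u = v := by
  refine H1.ext_of_grad h fun i => Lp.ext ?_
  refine ae_eq_of_integral_contDiff_smul_eq (locallyIntegrable_L2 _) (locallyIntegrable_L2 _)
    fun φ hφ hc => ?_
  have h1 := u.isWeakPartialDeriv i φ hφ hc
  have h2 := v.isWeakPartialDeriv i φ hφ hc
  rw [h, h2, neg_inj] at h1
  exact h1.symm

/-- Radial functions become the common fixed points of isometries of `H¹`. This gives a closed
subspace and the setting of `abs_le_of_invariant`. -/
theorem mem_radialSet_iff {u : H1 𝕜 N} :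
    u ∈ radialSet 𝕜 N ↔ ∀ R : EuclideanSpace ℝ (Fin N) ≃ₗᵢ[ℝ] EuclideanSpace ℝ (Fin N),
      rot R u = u := by
  refine forall_congr' fun R => ⟨fun h => H1.ext_of_fn (Lp.ext ?_), fun h => ?_⟩
  · filter_upwards [h, rotL2_ae R u.fn] with x h1 h2
    rw [rot_fn, h2, h1]
  · have h3 := rotL2_ae R u.fn
    rw [← rot_fn, h] at h3
    filter_upwards [h3] with x hx
    exact hx.symm

/-- The closed subspace `H¹_r` of radial functions. -/
def radialSubmodule (𝕜 : Type*) [RCLike 𝕜] (N : ℕ) : Submodule ℝ (H1 𝕜 N) where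
  carrier := radialSet 𝕜 N
  add_mem' {u v} hu hv := by
    rw [mem_radialSet_iff] at *
    intro R
    rw [map_add, hu R, hv R]
  zero_mem' := mem_radialSet_iff.2 fun R => map_zero _
  smul_mem' a u hu := by
    rw [mem_radialSet_iff] at *
    intro R
    rw [map_smul, hu R]

theorem isClosed_radialSubmodule : IsClosed (radialSubmodule 𝕜 N : Set (H1 𝕜 N)) := by
  have e : (radialSubmodule 𝕜 N : Set (H1 𝕜 N))
      = ⋂ R : EuclideanSpace ℝ (Fin N) ≃ₗᵢ[ℝ] EuclideanSpace ℝ (Fin N), {u | rot R u = u} := by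
    ext u
    rw [Set.mem_iInter]
    exact mem_radialSet_iff
  rw [e]
  exact isClosed_iInter fun R => isClosed_eq (rot R).continuous continuous_id

instance : CompleteSpace (radialSubmodule 𝕜 N) := isClosed_radialSubmodule.completeSpace_coe

theorem fderiv_energy_rot (q μ : ℝ)
    (R : EuclideanSpace ℝ (Fin N) ≃ₗᵢ[ℝ] EuclideanSpace ℝ (Fin N)) {v : H1 𝕜 N}
    (hd : DifferentiableAt ℝ (energy q μ) v) (hv : rot R v = v) (w : H1 𝕜 N) :
    fderiv ℝ (energy q μ) v (rot R w) = fderiv ℝ (energy q μ) v w := by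
  have e : (energy q μ : H1 𝕜 N → ℝ) = energy q μ ∘ rot R := by
    ext u; exact (energy_rot q μ R u).symm
  have h2 : DifferentiableAt ℝ (energy q μ) (rot R v) := by rwa [hv]
  have h1 : HasFDerivAt (energy q μ ∘ rot R) _ v :=
    h2.hasFDerivAt.comp v (rot (𝕜 := 𝕜) R).toContinuousLinearMap.hasFDerivAt
  rw [← e] at h1
  conv_rhs => rw [h1.fderiv, hv]
  rfl

theorem norm_comp_subtypeL_le {E : Type*} [NormedAddCommGroup E] [NormedSpace ℝ E]
    (p : Submodule ℝ E) (f : E →L[ℝ] ℝ) {K : ℝ} (hK : 0 ≤ K) (h : ∀ w ∈ p, |f w| ≤ K * ‖w‖) :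
    ‖f.comp p.subtypeL‖ ≤ K :=
  ContinuousLinearMap.opNorm_le_bound _ hK fun w => h w w.2

/-- Symmetric criticality: at a radial function, the differential of the energy on the tangent
space to the mass sphere is controlled by its restriction to radial directions. -/
theorem norm_fderiv_energy_tangent_le {q μ K : ℝ} (hK : 0 ≤ K)
    {v : H1 𝕜 N} (hd : DifferentiableAt ℝ (energy q μ) v) (hv : v ∈ radialSet 𝕜 N)
    (hv0 : v.fn ≠ 0)
    (h : ∀ w ∈ radialSet 𝕜 N, inner ℝ v.fn w.fn = 0 → |fderiv ℝ (energy q μ) v w| ≤ K * ‖w‖) :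
    ‖(fderiv ℝ (energy q μ) v).comp (tangentSpace v).subtypeL‖ ≤ K := by
  have hL : ∀ (R : EuclideanSpace ℝ (Fin N) ≃ₗᵢ[ℝ] EuclideanSpace ℝ (Fin N)) (w : H1 𝕜 N),
      inner ℝ v.fn (rot R w).fn = inner ℝ v.fn w.fn := by
    intro R w
    conv_lhs => rw [← mem_radialSet_iff.1 hv R]
    exact (rotL2 𝕜 R).inner_map_map v.fn w.fn
  refine norm_comp_subtypeL_le (tangentSpace v) (fderiv ℝ (energy q μ) v) hK fun w hw0 => ?_
  -- The tangent space uses the real part of the `𝕜`-valued inner product, which is the real `L²`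
  -- inner product of the Hilbert space argument.
  have hw : inner ℝ v.fn w.fn = 0 := by
    have h6 : RCLike.re (inner 𝕜 v.fn w.fn) = 0 := hw0
    rw [← h6, L2.inner_def, L2.inner_def, ← integral_re (L2.integrable_inner _ _)]
    rfl
  exact abs_le_of_invariant (fnL 𝕜 N) (fderiv ℝ (energy q μ) v) (fun R => rot R) hv0
    (fun R => fderiv_energy_rot q μ R hd (mem_radialSet_iff.1 hv R)) hL hK
    (fun x hx => h x (mem_radialSet_iff.2 hx)) hw

end Rotation

/-! ### Best constants and the lower bound of the energy in terms of the gradient norm -/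

section Constants

variable {𝕜 : Type*} [RCLike 𝕜] {N : ℕ} {q μ c : ℝ}

theorem powInt_pos {p : ℝ} (hp : 0 < p) {u : H1 𝕜 N}
    (hm : MemLp u.fn (ENNReal.ofReal p) volume) (hu : u.fn ≠ 0) : 0 < powInt p u := by
  refine (powInt_nonneg p u).lt_of_ne' fun h => hu ?_
  have h0 := (integral_eq_zero_iff_of_nonneg (fun x => by positivity)
    (integrable_norm_rpow_of_memLp hp hm)).1 h
  rw [Lp.eq_zero_iff_ae_eq_zero]
  filter_upwards [h0] with x hx
  have hx' : ‖u.fn x‖ ^ p = 0 := hx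
  rw [Real.rpow_eq_zero (norm_nonneg _) hp.ne'] at hx'
  simpa using hx'

theorem powInt_critExp_pos (hN : 3 ≤ N) {u : H1 𝕜 N} (hu : u.fn ≠ 0) :
    0 < powInt (critExp N) u :=
  powInt_pos (by linarith [two_lt_critExp hN]) (memLp_critExp hN u) hu

theorem powInt_subcritical_pos (hN : 3 ≤ N) (hq : 2 < q) (hq' : q < critExp N) {u : H1 𝕜 N}
    (hu : u.fn ≠ 0) : 0 < powInt q u :=
  powInt_pos (by linarith) (powInt_interpolation hN hq hq' u).1 hu

theorem lpNorm_critExp_pos (hN : 3 ≤ N) {u : H1 𝕜 N} (hu : u.fn ≠ 0) :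
    0 < lpNorm (critExp N) u :=
  Real.rpow_pos_of_pos (powInt_critExp_pos hN hu) _

theorem sobolevConst_le_div (hN : 3 ≤ N) {A : ℝ}
    (hA : ∀ u : H1 𝕜 N, A * lpNorm (critExp N) u ^ 2 ≤ ‖u.grad‖ ^ 2) {u : H1 𝕜 N}
    (hu : u.fn ≠ 0) : A ≤ ‖u.grad‖ ^ 2 / lpNorm (critExp N) u ^ 2 :=
  (le_div_iff₀ (pow_pos (lpNorm_critExp_pos hN hu) 2)).2 (hA u)

theorem exists_sobolev_pos (𝕜 : Type*) [RCLike 𝕜] (hN : 3 ≤ N) :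
    ∃ A : ℝ, 0 < A ∧ ∀ u : H1 𝕜 N, A * lpNorm (critExp N) u ^ 2 ≤ ‖u.grad‖ ^ 2 := by
  obtain ⟨C, hC0, hC⟩ := exists_lpNorm_critExp_le 𝕜 hN
  refine ⟨1 / (C ^ 2 + 1), by positivity, fun u => ?_⟩
  rw [one_div_mul_eq_div, div_le_iff₀ (by positivity)]
  have h : lpNorm (critExp N) u ^ 2 ≤ (C * ‖u.grad‖) ^ 2 :=
    pow_le_pow_left₀ (lpNorm_nonneg _ u) (hC u) 2
  nlinarith [sq_nonneg ‖u.grad‖]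

/-- Without an upper bound, `sSup` would take its default value `0`. -/
theorem bddAbove_sobolev (𝕜 : Type*) [RCLike 𝕜] (hN : 3 ≤ N) :
    BddAbove {A : ℝ | ∀ u : H1 𝕜 N, A * lpNorm (critExp N) u ^ 2 ≤ ‖u.grad‖ ^ 2} := by
  obtain ⟨u, -, hu⟩ := exists_radial_ne_zero 𝕜 N
  exact ⟨_, fun A hA => sobolevConst_le_div hN hA hu⟩

theorem sobolevConst_pos (𝕜 : Type*) [RCLike 𝕜] (hN : 3 ≤ N) : 0 < sobolevConst 𝕜 N := by
  obtain ⟨A, hA0, hA⟩ := exists_sobolev_pos 𝕜 hN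
  exact hA0.trans_le (le_csSup (bddAbove_sobolev 𝕜 hN) hA)

theorem sobolevConst_mul_le (hN : 3 ≤ N) (u : H1 𝕜 N) :
    sobolevConst 𝕜 N * lpNorm (critExp N) u ^ 2 ≤ ‖u.grad‖ ^ 2 := by
  obtain ⟨A, -, hA⟩ := exists_sobolev_pos 𝕜 hN
  rcases (lpNorm_nonneg (critExp N) u).eq_or_lt' with h | h
  · rw [h]; simp
  · rw [← le_div_iff₀ (by positivity)]
    exact csSup_le ⟨A, hA⟩ fun B hB => (le_div_iff₀ (by positivity)).2 (hB u)

theorem powInt_critExp_le (hN : 3 ≤ N) (u : H1 𝕜 N) :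
    powInt (critExp N) u
      ≤ 1 / sobolevConst 𝕜 N ^ (critExp N / 2) * (‖u.grad‖ ^ 2) ^ (critExp N / 2) := by
  have hS := sobolevConst_pos 𝕜 hN
  have hp := two_lt_critExp hN
  have h : lpNorm (critExp N) u ^ 2 ≤ ‖u.grad‖ ^ 2 / sobolevConst 𝕜 N := by
    rw [le_div_iff₀ hS, mul_comm]; exact sobolevConst_mul_le hN u
  have h2 := Real.rpow_le_rpow (by positivity) h (by linarith : 0 ≤ critExp N / 2)
  rw [← Real.rpow_natCast, ← Real.rpow_mul (lpNorm_nonneg _ u), Nat.cast_ofNat,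
    mul_div_cancel₀ _ two_ne_zero, lpNorm_rpow (by linarith),
    Real.div_rpow (by positivity) hS.le] at h2
  rwa [one_div_mul_eq_div]

theorem grad_ne_zero (hN : 3 ≤ N) {u : H1 𝕜 N} (hu : u.fn ≠ 0) : 0 < ‖u.grad‖ := by
  have h := sobolevConst_mul_le hN u
  have h2 := mul_pos (sobolevConst_pos 𝕜 hN) (pow_pos (lpNorm_critExp_pos hN hu) 2)
  refine (norm_nonneg _).lt_of_ne' fun h0 => ?_
  rw [h0] at h
  norm_num at h
  linarith

theorem gagliardoConst_nonneg (𝕜 : Type*) [RCLike 𝕜] (N : ℕ) (q : ℝ) : 0 ≤ gagliardoConst 𝕜 N q :=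
  Real.sInf_nonneg fun _ h => h.1

theorem lpNorm_le_gagliardoConst (hN : 3 ≤ N) (hq : 2 < q) (hq' : q < critExp N) (u : H1 𝕜 N) :
    lpNorm q u ≤ gagliardoConst 𝕜 N q * ‖u.grad‖ ^ (N * (1 / 2 - 1 / q) : ℝ)
        * ‖u.fn‖ ^ (1 - N * (1 / 2 - 1 / q) : ℝ) := by
  obtain ⟨C, hC0, hC⟩ := exists_gagliardo 𝕜 hN hq hq'
  set y := ‖u.grad‖ ^ (N * (1 / 2 - 1 / q) : ℝ) * ‖u.fn‖ ^ (1 - N * (1 / 2 - 1 / q) : ℝ) with hy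
  have hy0 : 0 ≤ y := by positivity
  rw [mul_assoc, ← hy]
  rcases hy0.eq_or_lt' with h | h
  · rw [h, mul_zero]
    refine (hC u).trans_eq ?_
    rw [mul_assoc, ← hy, h, mul_zero]
  · rw [← div_le_iff₀ h]
    refine le_csInf ⟨C, hC0, hC⟩ fun B hB => ?_
    rw [div_le_iff₀ h, hy, ← mul_assoc]
    exact hB.2 u

theorem gagliardoConst_pos (𝕜 : Type*) [RCLike 𝕜] (hN : 3 ≤ N) (hq : 2 < q)
    (hq' : q < critExp N) : 0 < gagliardoConst 𝕜 N q := by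
  obtain ⟨u, -, hu⟩ := exists_radial_ne_zero 𝕜 N
  refine (gagliardoConst_nonneg 𝕜 N q).lt_of_ne' fun h0 => ?_
  have h := lpNorm_le_gagliardoConst hN hq hq' u
  rw [h0, zero_mul, zero_mul] at h
  exact absurd h (not_le.2 (Real.rpow_pos_of_pos (powInt_subcritical_pos hN hq hq' hu) _))

/-- The signs express that the `q`-term is of lower order than `‖∇u‖₂²` and the critical term of
higher order. The last identity makes both terms of `f(c₀, ρ₀)` carry the same power `2/N` of `c₀`.
-/
theorem alpha_facts (hN : 3 ≤ N) (hq : 2 < q) (hq' : q < 2 + 4 / N) :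
    -1 < alphaZero N q ∧ alphaZero N q < 0 ∧ 0 < alphaOne N q ∧ 0 < alphaTwo N ∧
      critExp N / 2 = 1 + alphaTwo N ∧
      N * alphaOne N q = (N - 2) * (alphaTwo N - alphaZero N q) := by
  obtain ⟨h2, h3, h4⟩ := critExp_facts hN
  have hqc := lt_critExp hN hq'
  have hd : (0 : ℝ) < N - 2 := by linarith
  have hqN : (q - 2) * N < 4 := by
    rw [← lt_div_iff₀ (by linarith)]; linarith
  have hqm : q * (N - 2) < 2 * N := by rw [← h3]; exact mul_lt_mul_of_pos_right hqc hd
  refine ⟨?_, ?_, ?_, div_pos two_pos hd, ?_, ?_⟩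
  · rw [alphaZero]; nlinarith
  · rw [alphaZero]; linarith
  · rw [alphaOne]; linarith
  · rw [critExp, alphaTwo]; field_simp; ring
  · rw [alphaOne, alphaTwo, alphaZero]; field_simp; ring

theorem powInt_le_gagliardo (hN : 3 ≤ N) (hq : 2 < q) (hq' : q < critExp N) (u : H1 𝕜 N) :
    powInt q u ≤ gagliardoConst 𝕜 N q ^ q
      * ((‖u.grad‖ ^ 2) ^ (1 + alphaZero N q) * (‖u.fn‖ ^ 2) ^ alphaOne N q) := by
  have h := Real.rpow_le_rpow (lpNorm_nonneg q u) (lpNorm_le_gagliardoConst hN hq hq' u)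
    (by linarith : 0 ≤ q)
  have hC := gagliardoConst_nonneg 𝕜 N q
  rw [lpNorm_rpow (by linarith), mul_assoc, Real.mul_rpow hC (by positivity),
    Real.mul_rpow (by positivity) (by positivity), ← Real.rpow_mul (norm_nonneg _),
    ← Real.rpow_mul (norm_nonneg _)] at h
  have e : ∀ {x k : ℝ}, 0 ≤ x → (x ^ 2) ^ k = x ^ (2 * k) := fun {x k} hx => by
    rw [← Real.rpow_natCast, ← Real.rpow_mul hx]; norm_num
  rw [e (norm_nonneg _), e (norm_nonneg _)]
  have e1 : 2 * (1 + alphaZero N q) = N * (1 / 2 - 1 / q) * q := by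
    rw [alphaZero]; field_simp; ring
  have e2 : 2 * alphaOne N q = (1 - N * (1 / 2 - 1 / q)) * q := by
    rw [alphaOne]; field_simp; ring
  rwa [e1, e2]

variable (𝕜 N q μ) in
/-- The lower bound `ρ f(c, ρ)` for the energy of the functions of mass `c` with `‖∇u‖₂² = ρ`. -/
def wellFun (c ρ : ℝ) : ℝ :=
  1 / 2 * ρ - μ / q * gagliardoConst 𝕜 N q ^ q * (ρ ^ (1 + alphaZero N q) * c ^ alphaOne N q)
    - 1 / critExp N * (1 / sobolevConst 𝕜 N ^ (critExp N / 2)) * ρ ^ (1 + alphaTwo N)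

theorem wellFun_le_energy (hN : 3 ≤ N) (hq : 2 < q) (hq' : q < 2 + 4 / N) (hμ : 0 < μ)
    {u : H1 𝕜 N} (hu : u ∈ massSphere 𝕜 N c) :
    wellFun 𝕜 N q μ c (‖u.grad‖ ^ 2) ≤ energy q μ u := by
  have h1 := powInt_le_gagliardo hN hq (lt_critExp hN hq') u
  have h2 := powInt_critExp_le hN u
  have hu' : ‖u.fn‖ ^ 2 = c := hu
  rw [hu'] at h1
  have hp := two_lt_critExp hN
  have h3 := mul_le_mul_of_nonneg_left h1 (by positivity : 0 ≤ μ / q)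
  have h4 := mul_le_mul_of_nonneg_left h2 (by positivity : 0 ≤ 1 / critExp N)
  rw [wellFun, energy, ← (alpha_facts hN hq hq').2.2.2.2.1]
  rw [← mul_assoc] at h3 h4
  linarith

theorem thresholdBase_pos (𝕜 : Type*) [RCLike 𝕜] (hN : 3 ≤ N) (hq : 2 < q) (hq' : q < 2 + 4 / N)
    (hμ : 0 < μ) : 0 < thresholdBase 𝕜 N q μ := by
  obtain ⟨h1, h2, h3, h4, -, -⟩ := alpha_facts hN hq hq'
  have := sobolevConst_pos 𝕜 hN
  have := gagliardoConst_pos 𝕜 hN hq (lt_critExp hN hq')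
  have := two_lt_critExp hN
  exact mul_pos (neg_pos.2 (div_neg_of_neg_of_pos h2 h4)) (by positivity)

theorem thresholdK_pos (𝕜 : Type*) [RCLike 𝕜] (hN : 3 ≤ N) (hq : 2 < q) (hq' : q < 2 + 4 / N)
    (hμ : 0 < μ) : 0 < thresholdK 𝕜 N q μ := by
  have := sobolevConst_pos 𝕜 hN
  have := gagliardoConst_pos 𝕜 hN hq (lt_critExp hN hq')
  have := two_lt_critExp hN
  have := thresholdBase_pos 𝕜 hN hq hq' hμ
  rw [thresholdK]
  positivity

theorem massThreshold_pos (𝕜 : Type*) [RCLike 𝕜] (hN : 3 ≤ N) (hq : 2 < q) (hq' : q < 2 + 4 / N)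
    (hμ : 0 < μ) : 0 < massThreshold 𝕜 N q μ := by
  have := thresholdK_pos 𝕜 hN hq hq' hμ
  rw [massThreshold]
  positivity

theorem rhoZero_pos (𝕜 : Type*) [RCLike 𝕜] (hN : 3 ≤ N) (hq : 2 < q) (hq' : q < 2 + 4 / N)
    (hμ : 0 < μ) : 0 < rhoZero 𝕜 N q μ := by
  have := thresholdBase_pos 𝕜 hN hq hq' hμ
  have := massThreshold_pos 𝕜 hN hq hq' hμ
  rw [rhoZero]
  positivity

/-- Only `f(c₀, ρ₀) = 0` and the strict decrease of `f(·, ρ₀)` are needed, not that `ρ₀` is a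
maximum point. -/
theorem wellFun_rhoZero_pos (hN : 3 ≤ N) (hq : 2 < q) (hq' : q < 2 + 4 / N)
    (hμ : 0 < μ) (hc : 0 < c) (hc' : c < massThreshold 𝕜 N q μ) :
    0 < wellFun 𝕜 N q μ c (rhoZero 𝕜 N q μ) := by
  obtain ⟨h1, h2, h3, h4, -, h6⟩ := alpha_facts hN hq hq'
  have hb := thresholdBase_pos 𝕜 hN hq hq' hμ
  have hK := thresholdK_pos 𝕜 hN hq hq' hμ
  have hm := massThreshold_pos 𝕜 hN hq hq' hμ
  have hρ := rhoZero_pos 𝕜 hN hq hq' hμ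
  have hC := gagliardoConst_pos 𝕜 hN hq (lt_critExp hN hq')
  have hN2 := (critExp_facts hN).1
  have hα : alphaTwo N * (N - 2) = 2 := by rw [alphaTwo]; exact div_mul_cancel₀ _ (by linarith)
  set δ := alphaTwo N - alphaZero N q with hδ
  have hδ0 : 0 < δ := by linarith
  have e1 : alphaOne N q / δ * alphaTwo N = 2 / N := by
    rw [div_mul_eq_mul_div, div_eq_div_iff hδ0.ne' (by linarith)]
    linear_combination (alphaTwo N) * h6 + δ * hα
  have e2 : alphaOne N q + alphaOne N q / δ * alphaZero N q = 2 / N := by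
    rw [← e1]; field_simp; rw [hδ]; ring
  have hcN : massThreshold 𝕜 N q μ ^ (2 / N : ℝ) = 1 / (2 * thresholdK 𝕜 N q μ) := by
    rw [massThreshold, ← Real.rpow_mul (by positivity)]
    rw [show (N : ℝ) / 2 * (2 / N) = 1 by field_simp, Real.rpow_one]
  have hr : ∀ k, rhoZero 𝕜 N q μ ^ k = thresholdBase 𝕜 N q μ ^ (k / δ)
      * massThreshold 𝕜 N q μ ^ (alphaOne N q / δ * k) := by
    intro k
    rw [rhoZero, Real.mul_rpow (by positivity) (by positivity), ← Real.rpow_mul hb.le,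
      ← Real.rpow_mul hm.le, one_div_mul_eq_div]
  -- This is `f(c₀, ρ₀) = 0`: after substituting `ρ₀`, the left side is `K c₀^{2/N}`, and `c₀^{2/N}
  -- = 1/(2K)`.
  have key : μ / q * gagliardoConst 𝕜 N q ^ q
        * (rhoZero 𝕜 N q μ ^ alphaZero N q * massThreshold 𝕜 N q μ ^ alphaOne N q)
      + 1 / critExp N * (1 / sobolevConst 𝕜 N ^ (critExp N / 2)) * rhoZero 𝕜 N q μ ^ alphaTwo N
      = 1 / 2 := by
    have e3 : massThreshold 𝕜 N q μ ^ (alphaOne N q / δ * alphaZero N q)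
        * massThreshold 𝕜 N q μ ^ alphaOne N q = 1 / (2 * thresholdK 𝕜 N q μ) := by
      rw [← Real.rpow_add hm, add_comm, e2, hcN]
    rw [hr, hr, mul_assoc (thresholdBase 𝕜 N q μ ^ (alphaZero N q / δ)), e3, e1, hcN]
    have e4 : thresholdK 𝕜 N q μ * (1 / (2 * thresholdK 𝕜 N q μ)) = 1 / 2 := by field_simp
    rw [← e4]
    have e5 : thresholdK 𝕜 N q μ = _ := thresholdK.eq_1 𝕜 N q μ
    rw [← hδ] at e5
    generalize 1 / (2 * thresholdK 𝕜 N q μ) = x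
    rw [e5]
    ring
  have hlt : c ^ alphaOne N q < massThreshold 𝕜 N q μ ^ alphaOne N q :=
    Real.rpow_lt_rpow hc.le hc' h3
  have hlt2 := mul_lt_mul_of_pos_left (mul_lt_mul_of_pos_left hlt
    (Real.rpow_pos_of_pos hρ (alphaZero N q))) (by positivity : 0 < μ / q * gagliardoConst 𝕜 N q ^ q)
  have : wellFun 𝕜 N q μ c (rhoZero 𝕜 N q μ) = rhoZero 𝕜 N q μ * (1 / 2
      - μ / q * gagliardoConst 𝕜 N q ^ q * (rhoZero 𝕜 N q μ ^ alphaZero N q * c ^ alphaOne N q)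
      - 1 / critExp N * (1 / sobolevConst 𝕜 N ^ (critExp N / 2))
        * rhoZero 𝕜 N q μ ^ alphaTwo N) := by
    rw [wellFun, Real.rpow_add hρ, Real.rpow_add hρ, Real.rpow_one]
    ring
  rw [this]
  exact mul_pos hρ (by linarith)

end Constants

/-! ### The energy along dilations -/

section Fiber

/-- The energy along the dilations of a function, as a function of the coefficients. -/
def fiberFun (k l A a b s : ℝ) : ℝ :=
  1 / 2 * (Real.exp (2 * s) * A) - Real.exp (2 * (1 + k) * s) * a - Real.exp (2 * (1 + l) * s) * b

variable {k l A a b : ℝ}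

theorem hasDerivAt_fiberFun (s : ℝ) : HasDerivAt (fiberFun k l A a b)
    (Real.exp (2 * s) * A - 2 * (1 + k) * (Real.exp (2 * (1 + k) * s) * a)
      - 2 * (1 + l) * (Real.exp (2 * (1 + l) * s) * b)) s := by
  have h : ∀ r : ℝ, HasDerivAt (fun s => Real.exp (r * s)) (Real.exp (r * s) * (r * 1)) s :=
    fun r => ((hasDerivAt_id s).const_mul r).exp
  refine (((((h 2).mul_const A).const_mul (1 / 2)).sub ((h (2 * (1 + k))).mul_const a)).sub
    ((h (2 * (1 + l))).mul_const b)).congr_deriv ?_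
  ring

theorem fiberFun_eq (s : ℝ) : fiberFun k l A a b s = Real.exp (2 * s) *
    (1 / 2 * A - Real.exp (2 * k * s) * a - Real.exp (2 * l * s) * b) := by
  rw [fiberFun, show 2 * (1 + k) * s = 2 * s + 2 * k * s by ring,
    show 2 * (1 + l) * s = 2 * s + 2 * l * s by ring, Real.exp_add, Real.exp_add]
  ring

/-- The hypothesis on `A` says that `s = 0` is critical. Then `A/2 - a - b = k a + l b ≤ 0`, and
`e^x ≥ 1 + x` shows that the value stays nonpositive for `s ≤ 0`. -/
theorem fiberFun_le (ha : 0 ≤ a) (hb : 0 ≤ b) (hA : A = 2 * (1 + k) * a + 2 * (1 + l) * b)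
    (h0 : 1 / 2 * A - a - b ≤ 0) {s : ℝ} (hs : s ≤ 0) :
    fiberFun k l A a b s ≤ Real.exp (2 * s) * (1 / 2 * A - a - b) := by
  rw [fiberFun_eq]
  refine mul_le_mul_of_nonneg_left ?_ (Real.exp_pos _).le
  have h1 := mul_le_mul_of_nonneg_right (Real.add_one_le_exp (2 * k * s)) ha
  have h2 := mul_le_mul_of_nonneg_right (Real.add_one_le_exp (2 * l * s)) hb
  have h3 : 0 ≤ (k * a + l * b) * s := mul_nonneg_of_nonpos_of_nonpos (by linarith) hs
  nlinarith

theorem tendsto_exp_mul_atBot {r : ℝ} (hr : 0 < r) :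
    Tendsto (fun s => Real.exp (r * s)) atBot (𝓝 0) :=
  Real.tendsto_exp_atBot.comp (tendsto_id.const_mul_atBot hr)

theorem tendsto_fiberFun_atTop (ha : 0 ≤ a) (hl : 0 < l) (hb : 0 < b) :
    Tendsto (fiberFun k l A a b) atTop atBot := by
  have h1 : Tendsto (fun s => Real.exp (2 * l * s) * b) atTop atTop :=
    (Real.tendsto_exp_atTop.comp (tendsto_id.const_mul_atTop (by positivity))).atTop_mul_const hb
  have h2 : Tendsto (fun s => Real.exp (2 * s)) atTop atTop :=
    Real.tendsto_exp_atTop.comp (tendsto_id.const_mul_atTop two_pos)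
  have h3 : Tendsto (fun s => 1 / 2 * A - Real.exp (2 * l * s) * b) atTop atBot :=
    tendsto_const_nhds.add_atBot (tendsto_neg_atTop_atBot.comp h1)
  refine tendsto_atBot_mono (fun s => ?_) (h2.atTop_mul_atBot₀ h3)
  rw [fiberFun_eq]
  refine mul_le_mul_of_nonneg_left ?_ (Real.exp_pos _).le
  have := mul_nonneg (Real.exp_pos (2 * k * s)).le ha
  linarith

theorem tendsto_fiberFun_atBot (hk : -1 < k) (hl : 0 < l) :
    Tendsto (fiberFun k l A a b) atBot (𝓝 0) := by
  have h : Tendsto (fiberFun k l A a b) atBot (𝓝 (1 / 2 * (0 * A) - 0 * a - 0 * b)) :=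
    ((((tendsto_exp_mul_atBot two_pos).mul_const A).const_mul (1 / 2)).sub
      ((tendsto_exp_mul_atBot (by linarith)).mul_const a)).sub
      ((tendsto_exp_mul_atBot (by linarith)).mul_const b)
  simpa using h

/-- As `s → -∞` the term `e^{2(1+k)s} a` dominates `e^{2s} A`, because `k < 0`. -/
theorem eventually_fiberFun_neg (hk : k < 0) (ha : 0 < a) (hb : 0 ≤ b) :
    ∀ᶠ s in atBot, fiberFun k l A a b s < 0 := by
  have h1 : Tendsto (fun s => Real.exp (-2 * k * s) * (1 / 2 * A)) atBot (𝓝 (0 * (1 / 2 * A))) :=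
    (tendsto_exp_mul_atBot (by linarith)).mul_const _
  rw [zero_mul] at h1
  filter_upwards [h1.eventually_lt_const ha] with s hs
  rw [fiberFun_eq]
  refine mul_neg_of_pos_of_neg (Real.exp_pos _) ?_
  have h2 := mul_lt_mul_of_pos_left hs (Real.exp_pos (2 * k * s))
  rw [← mul_assoc, ← Real.exp_add, show 2 * k * s + -2 * k * s = 0 by ring, Real.exp_zero,
    one_mul] at h2
  have := mul_nonneg (Real.exp_pos (2 * l * s)).le hb
  linarith

/-- If the fiber map is positive where `e^{2s} A = R`, it has a critical point with negative
value. -/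
theorem exists_fiberFun_crit (hk : -1 < k) (hk' : k < 0) (hl : 0 < l) (ha : 0 < a) (hb : 0 ≤ b)
    {σ : ℝ} (hσ : 0 < fiberFun k l A a b σ) :
    ∃ s, fiberFun k l A a b s < 0 ∧ deriv (fiberFun k l A a b) s = 0 := by
  -- Choose `s₁ < σ` with a negative value, then `s₀ < s₁` with a larger value, since the function
  -- tends to `0` at `-∞`. The minimum over `[s₀, σ]` is then interior.
  obtain ⟨s₁, h1, h1σ⟩ := ((eventually_fiberFun_neg (l := l) (A := A) hk' ha hb).and
    (eventually_lt_atBot σ)).exists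
  obtain ⟨s₀, h0, h01⟩ := (((tendsto_fiberFun_atBot (A := A) (a := a) (b := b) hk hl).eventually_const_lt
    h1).and (eventually_lt_atBot s₁)).exists
  have hcont : Continuous (fiberFun k l A a b) :=
    continuous_iff_continuousAt.2 fun s => (hasDerivAt_fiberFun s).continuousAt
  obtain ⟨s, hs, hmin⟩ := isCompact_Icc.exists_isMinOn
    (⟨s₁, h01.le, h1σ.le⟩ : (Set.Icc s₀ σ).Nonempty) hcont.continuousOn
  have hle : fiberFun k l A a b s ≤ fiberFun k l A a b s₁ := hmin ⟨h01.le, h1σ.le⟩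
  have hs0 : s₀ < s := hs.1.lt_of_ne fun e => by rw [← e] at hle; linarith
  have hsσ : s < σ := hs.2.lt_of_ne fun e => by rw [e] at hle; linarith
  exact ⟨s, hle.trans_lt h1, (hmin.isLocalMin (Icc_mem_nhds hs0 hsσ)).deriv_eq_zero⟩

end Fiber

/-! ### The mountain pass geometry. -/

section Geometry

variable {𝕜 : Type*} [RCLike 𝕜] {N : ℕ} {q μ c : ℝ}

theorem energy_dil (hN : 3 ≤ N) (s : ℝ) (u : H1 𝕜 N) :
    energy q μ (dil 𝕜 N s u) = fiberFun (alphaZero N q) (alphaTwo N) (‖u.grad‖ ^ 2)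
      (μ / q * powInt q u) (1 / critExp N * powInt (critExp N) u) s := by
  obtain ⟨h2, h3, h4⟩ := critExp_facts hN
  have hd : (0 : ℝ) < N - 2 := by linarith
  rw [energy, norm_dil_grad_sq, powInt_dil, powInt_dil, fiberFun]
  have e1 : (N : ℝ) * (q - 2) / 2 = 2 * (1 + alphaZero N q) := by rw [alphaZero]; ring
  have e2 : (N : ℝ) * (critExp N - 2) / 2 = 2 * (1 + alphaTwo N) := by
    rw [critExp, alphaTwo]; field_simp; ring
  rw [e1, e2]
  ring

theorem pohozaev_eq (hN : 3 ≤ N) (hq : 2 < q) (u : H1 𝕜 N) :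
    pohozaev q μ u = ‖u.grad‖ ^ 2 - 2 * (1 + alphaZero N q) * (μ / q * powInt q u)
      - 2 * (1 + alphaTwo N) * (1 / critExp N * powInt (critExp N) u) := by
  have hp := two_lt_critExp hN
  have hd : (0 : ℝ) < N - 2 := by linarith [(critExp_facts hN).1]
  have e1 : μ * gammaExp N q = 2 * (1 + alphaZero N q) * (μ / q) := by
    rw [gammaExp, alphaZero]; field_simp; ring
  have e2 : 2 * (1 + alphaTwo N) * (1 / critExp N) = 1 := by
    have : critExp N = 2 * (1 + alphaTwo N) := by
      rw [critExp, alphaTwo]; field_simp; ring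
    rw [← this]; field_simp
  rw [pohozaev, e1, ← mul_assoc (2 * (1 + alphaTwo N)), e2]
  ring

/-- Critical points along dilations are thus the points of `Λ(c)`, and `Q_μ` is the derivative of
`Φ(u, s)` in `s`. -/
theorem hasDerivAt_energy_dil (hN : 3 ≤ N) (hq : 2 < q) (s : ℝ) (u : H1 𝕜 N) :
    HasDerivAt (fun s => energy q μ (dil 𝕜 N s u)) (pohozaev q μ (dil 𝕜 N s u)) s := by
  obtain ⟨h2, h3, h4⟩ := critExp_facts hN
  have hd : (0 : ℝ) < N - 2 := by linarith
  simp_rw [energy_dil hN]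
  convert hasDerivAt_fiberFun s using 1
  rw [pohozaev_eq hN hq, norm_dil_grad_sq, powInt_dil, powInt_dil]
  have e1 : (N : ℝ) * (q - 2) / 2 = 2 * (1 + alphaZero N q) := by rw [alphaZero]; ring
  have e2 : (N : ℝ) * (critExp N - 2) / 2 = 2 * (1 + alphaTwo N) := by
    rw [critExp, alphaTwo]; field_simp; ring
  rw [e1, e2]
  ring

theorem dil_mem_massSphere (s : ℝ) {u : H1 𝕜 N} (hu : u ∈ massSphere 𝕜 N c) :
    dil 𝕜 N s u ∈ massSphere 𝕜 N c := by
  have hu' : ‖u.fn‖ ^ 2 = c := hu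
  change ‖(dil 𝕜 N s u).fn‖ ^ 2 = c
  rw [norm_dil_fn, hu']

theorem dil_mem_radialMassSphere (s : ℝ) {u : H1 𝕜 N} (hu : u ∈ radialMassSphere 𝕜 N c) :
    dil 𝕜 N s u ∈ radialMassSphere 𝕜 N c :=
  ⟨dil_mem_massSphere s hu.1, dil_mem_radialSet s hu.2⟩

theorem fn_ne_zero (hc : 0 < c) {u : H1 𝕜 N} (hu : u ∈ massSphere 𝕜 N c) : u.fn ≠ 0 := by
  intro h
  have hu' : ‖u.fn‖ ^ 2 = c := hu
  rw [h] at hu'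
  norm_num at hu'
  linarith

theorem radialMassSphere_nonempty (𝕜 : Type*) [RCLike 𝕜] (N : ℕ) (hc : 0 < c) :
    (radialMassSphere 𝕜 N c).Nonempty := by
  obtain ⟨u, hu, hu0⟩ := exists_radial_ne_zero 𝕜 N
  refine ⟨(√c / ‖u.fn‖) • u, ?_, (radialSubmodule 𝕜 N).smul_mem _ hu⟩
  change ‖((√c / ‖u.fn‖) • u).fn‖ ^ 2 = c
  have : ‖u.fn‖ ≠ 0 := norm_ne_zero_iff.2 hu0
  rw [H1.smul_fn, norm_smul, Real.norm_of_nonneg (by positivity), div_mul_cancel₀ _ this,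
    Real.sq_sqrt hc.le]

theorem continuous_dil_right (u : H1 𝕜 N) : Continuous fun s => dil 𝕜 N s u :=
  continuous_dil.comp (Continuous.prodMk_right u)

/-- Data of the problem in the regime where the energy has a potential well. -/
structure Regime (𝕜 : Type*) [RCLike 𝕜] (N : ℕ) (q μ c : ℝ) : Prop where
  hN : 3 ≤ N
  hq : 2 < q
  hq' : q < 2 + 4 / N
  hμ : 0 < μ
  hc : 0 < c
  hc' : c < massThreshold 𝕜 N q μ

namespace Regime

theorem wellFun_pos (h : Regime 𝕜 N q μ c) : 0 < wellFun 𝕜 N q μ c (rhoZero 𝕜 N q μ) :=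
  wellFun_rhoZero_pos h.hN h.hq h.hq' h.hμ h.hc h.hc'

theorem rhoZero_pos (h : Regime 𝕜 N q μ c) : 0 < rhoZero 𝕜 N q μ :=
  NormalizedNLS.rhoZero_pos 𝕜 h.hN h.hq h.hq' h.hμ

theorem coeff_pos (h : Regime 𝕜 N q μ c) {u : H1 𝕜 N} (hu : u ∈ massSphere 𝕜 N c) :
    0 < ‖u.grad‖ ^ 2 ∧ 0 < μ / q * powInt q u ∧ 0 < 1 / critExp N * powInt (critExp N) u := by
  have h0 := fn_ne_zero h.hc hu
  have := powInt_critExp_pos h.hN h0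
  have := powInt_subcritical_pos h.hN h.hq (lt_critExp h.hN h.hq') h0
  have := grad_ne_zero h.hN h0
  have := two_lt_critExp h.hN
  have := h.hμ
  have := h.hq
  exact ⟨by positivity, by positivity, by positivity⟩

theorem energy_pos_of_grad_eq (h : Regime 𝕜 N q μ c) {u : H1 𝕜 N} (hu : u ∈ massSphere 𝕜 N c)
    (hg : ‖u.grad‖ ^ 2 = rhoZero 𝕜 N q μ) :
    wellFun 𝕜 N q μ c (rhoZero 𝕜 N q μ) ≤ energy q μ u := by
  rw [← hg]
  exact wellFun_le_energy h.hN h.hq h.hq' h.hμ hu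

theorem exists_dil_grad_eq (h : Regime 𝕜 N q μ c) {u : H1 𝕜 N} (hu : u ∈ massSphere 𝕜 N c) :
    ∃ s, Real.exp (2 * s) = rhoZero 𝕜 N q μ / ‖u.grad‖ ^ 2 ∧
      0 < energy q μ (dil 𝕜 N s u) := by
  have hA := (h.coeff_pos hu).1
  have hs : Real.exp (2 * (Real.log (rhoZero 𝕜 N q μ / ‖u.grad‖ ^ 2) / 2))
      = rhoZero 𝕜 N q μ / ‖u.grad‖ ^ 2 := by
    rw [mul_div_cancel₀ _ two_ne_zero, Real.exp_log (div_pos h.rhoZero_pos hA)]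
  refine ⟨_, hs, h.wellFun_pos.trans_le (h.energy_pos_of_grad_eq (dil_mem_massSphere _ hu) ?_)⟩
  rw [norm_dil_grad_sq, hs, div_mul_cancel₀ _ hA.ne']

theorem bddBelow_energy_wellSet (h : Regime 𝕜 N q μ c) :
    BddBelow (energy q μ '' wellSet 𝕜 N q μ c) := by
  obtain ⟨h1, h2, h3, h4, -, -⟩ := alpha_facts h.hN h.hq h.hq'
  have hS := sobolevConst_pos 𝕜 h.hN
  have hC := gagliardoConst_nonneg 𝕜 N q
  have hp := two_lt_critExp h.hN
  have hμ := h.hμ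
  have hc := h.hc
  have hq := h.hq
  set ρ := rhoZero 𝕜 N q μ
  refine ⟨-(μ / q * gagliardoConst 𝕜 N q ^ q * (ρ ^ (1 + alphaZero N q) * c ^ alphaOne N q))
    - 1 / critExp N * (1 / sobolevConst 𝕜 N ^ (critExp N / 2)) * ρ ^ (1 + alphaTwo N), ?_⟩
  rintro _ ⟨u, ⟨hu, hr⟩, rfl⟩
  refine le_trans ?_ (wellFun_le_energy h.hN h.hq h.hq' h.hμ hu)
  rw [wellFun]
  have e1 : (‖u.grad‖ ^ 2) ^ (1 + alphaZero N q) ≤ ρ ^ (1 + alphaZero N q) :=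
    Real.rpow_le_rpow (by positivity) hr.le (by linarith)
  have e2 : (‖u.grad‖ ^ 2) ^ (1 + alphaTwo N) ≤ ρ ^ (1 + alphaTwo N) :=
    Real.rpow_le_rpow (by positivity) hr.le (by linarith)
  have e3 : μ / q * gagliardoConst 𝕜 N q ^ q * ((‖u.grad‖ ^ 2) ^ (1 + alphaZero N q) * c ^ alphaOne N q)
      ≤ μ / q * gagliardoConst 𝕜 N q ^ q * (ρ ^ (1 + alphaZero N q) * c ^ alphaOne N q) := by
    gcongr
  have e4 : 1 / critExp N * (1 / sobolevConst 𝕜 N ^ (critExp N / 2)) * (‖u.grad‖ ^ 2) ^ (1 + alphaTwo N)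
      ≤ 1 / critExp N * (1 / sobolevConst 𝕜 N ^ (critExp N / 2)) * ρ ^ (1 + alphaTwo N) := by
    gcongr
  have : 0 ≤ 1 / 2 * ‖u.grad‖ ^ 2 := by positivity
  linarith

theorem wellLevel_neg (h : Regime 𝕜 N q μ c) : wellLevel 𝕜 N q μ c < 0 := by
  obtain ⟨h1, h2, h3, h4, -, -⟩ := alpha_facts h.hN h.hq h.hq'
  obtain ⟨u, hu, -⟩ := radialMassSphere_nonempty 𝕜 N h.hc
  obtain ⟨hA, ha, hb⟩ := h.coeff_pos hu
  have ht := (tendsto_exp_mul_atBot two_pos).mul_const (‖u.grad‖ ^ 2)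
  rw [zero_mul] at ht
  obtain ⟨s, hs, hs'⟩ := ((eventually_fiberFun_neg (l := alphaTwo N) (A := ‖u.grad‖ ^ 2) h2 ha hb.le).and
    (ht.eventually_lt_const h.rhoZero_pos)).exists
  refine (csInf_le h.bddBelow_energy_wellSet ⟨dil 𝕜 N s u, ⟨dil_mem_massSphere s hu, ?_⟩, rfl⟩).trans_lt ?_
  · rwa [norm_dil_grad_sq]
  · rwa [energy_dil h.hN]

/-- Inside the barrier the energy is at least `m(c)`, and `m(c) > 2 m(c)` as `m(c) < 0`. -/
theorem rhoZero_le (h : Regime 𝕜 N q μ c) {u : H1 𝕜 N} (hu : u ∈ lowEnergySet 𝕜 N q μ c) :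
    rhoZero 𝕜 N q μ ≤ ‖u.grad‖ ^ 2 := by
  by_contra! hlt
  have h1 : wellLevel 𝕜 N q μ c ≤ energy q μ u :=
    csInf_le h.bddBelow_energy_wellSet ⟨u, ⟨hu.1, hlt⟩, rfl⟩
  linarith [hu.2, h.wellLevel_neg]

/-- Otherwise some `s ≤ 0` dilates `u` onto the barrier, where the energy is positive, while
`fiberFun_le` keeps it negative. -/
theorem lt_rhoZero (h : Regime 𝕜 N q μ c) {u : H1 𝕜 N} (hu : u ∈ radialLambdaMinus 𝕜 N q μ c) :
    ‖u.grad‖ ^ 2 < rhoZero 𝕜 N q μ := by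
  by_contra! hle
  obtain ⟨⟨⟨hm, hQ⟩, hF⟩, -⟩ := hu
  obtain ⟨hA, ha, hb⟩ := h.coeff_pos hm
  obtain ⟨s, hs, hpos⟩ := h.exists_dil_grad_eq hm
  have hs0 : s ≤ 0 := by
    have : Real.exp (2 * s) ≤ 1 := by rw [hs, div_le_one hA]; exact hle
    rw [Real.exp_le_one_iff] at this
    linarith
  rw [pohozaev_eq h.hN h.hq] at hQ
  rw [energy_dil h.hN] at hpos
  have hF' : 1 / 2 * ‖u.grad‖ ^ 2 - μ / q * powInt q u - 1 / critExp N * powInt (critExp N) u < 0 := hF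
  have := fiberFun_le (k := alphaZero N q) (l := alphaTwo N) ha.le hb.le (by linarith) hF'.le hs0
  linarith [mul_neg_of_pos_of_neg (Real.exp_pos (2 * s)) hF']

theorem exists_dil_mem_radialLambdaMinus (h : Regime 𝕜 N q μ c) {u : H1 𝕜 N}
    (hu : u ∈ radialMassSphere 𝕜 N c) : ∃ s, dil 𝕜 N s u ∈ radialLambdaMinus 𝕜 N q μ c := by
  obtain ⟨h1, h2, h3, h4, -, -⟩ := alpha_facts h.hN h.hq h.hq'
  obtain ⟨hA, ha, hb⟩ := h.coeff_pos hu.1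
  obtain ⟨σ, -, hσ⟩ := h.exists_dil_grad_eq hu.1
  rw [energy_dil h.hN] at hσ
  obtain ⟨s, hs, hd⟩ := exists_fiberFun_crit h1 h2 h4 ha hb.le hσ
  have hu' := dil_mem_radialMassSphere s hu
  refine ⟨s, ⟨⟨hu'.1, ?_⟩, by rwa [energy_dil h.hN]⟩, hu'.2⟩
  rw [← hd, ← (hasDerivAt_energy_dil h.hN h.hq s u).deriv]
  simp_rw [energy_dil h.hN]

theorem eventually_dil_mem_lowEnergySet (h : Regime 𝕜 N q μ c) {u : H1 𝕜 N}
    (hu : u ∈ massSphere 𝕜 N c) : ∃ T : ℝ, ∀ s, T ≤ s → dil 𝕜 N s u ∈ lowEnergySet 𝕜 N q μ c := by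
  obtain ⟨-, -, -, h4, -, -⟩ := alpha_facts h.hN h.hq h.hq'
  obtain ⟨hA, ha, hb⟩ := h.coeff_pos hu
  obtain ⟨T, hT⟩ := ((tendsto_fiberFun_atTop (k := alphaZero N q) (A := ‖u.grad‖ ^ 2) ha.le h4
    hb).eventually_lt_atBot (2 * wellLevel 𝕜 N q μ c)).exists_forall_of_atTop
  exact ⟨T, fun s hs => ⟨dil_mem_massSphere s hu, (energy_dil h.hN s u).trans_lt (hT s hs)⟩⟩

/-- The dilations of one radial function, starting at a negative critical value of the fiber map,
form a path whose energy tends to `-∞`. -/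
theorem radialPaths_nonempty (h : Regime 𝕜 N q μ c) : (radialPaths 𝕜 N q μ c).Nonempty := by
  obtain ⟨u, hu⟩ := radialMassSphere_nonempty 𝕜 N h.hc
  obtain ⟨s, hs⟩ := h.exists_dil_mem_radialLambdaMinus hu
  obtain ⟨T, hT⟩ := h.eventually_dil_mem_lowEnergySet hu.1
  have hst : Continuous fun t : ℝ≥0 => (s + t : ℝ) := by fun_prop
  have hcont : Continuous fun t : ℝ≥0 => dil 𝕜 N (s + t) u := (continuous_dil_right u).comp hst
  have h0 : dil 𝕜 N (s + (0 : ℝ≥0)) u ∈ radialLambdaMinus 𝕜 N q μ c := by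
    rwa [NNReal.coe_zero, add_zero]
  have h1 : ∃ T : ℝ≥0, ∀ t, T ≤ t → dil 𝕜 N (s + t) u ∈ lowEnergySet 𝕜 N q μ c := by
    refine ⟨(T - s).toNNReal, fun t ht => hT _ ?_⟩
    linarith [Real.toNNReal_le_iff_le_coe.1 ht]
  have h2 : ∀ t : ℝ≥0, dil 𝕜 N (s + t) u ∈ radialMassSphere 𝕜 N c :=
    fun t => dil_mem_radialMassSphere _ hu
  exact ⟨ContinuousMap.mk _ hcont, h2, h0, h1⟩

theorem continuous_energy (h : Regime 𝕜 N q μ c) : Continuous (energy q μ : H1 𝕜 N → ℝ) :=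
  (contDiff_energy h.hN μ h.hq (lt_critExp h.hN h.hq')).continuous

/-- Compactness bounds the energy up to time `T`, and `E_c` bounds it afterwards, so the supremum
over the noncompact half-line is a genuine one. -/
theorem bddAbove_energy_path (h : Regime 𝕜 N q μ c) {g : C(ℝ≥0, H1 𝕜 N)}
    (hg : g ∈ radialPaths 𝕜 N q μ c) : BddAbove (Set.range fun t => energy q μ (g t)) := by
  obtain ⟨-, -, T, hT⟩ := hg
  obtain ⟨B, hB⟩ := (isCompact_Icc (a := (0 : ℝ≥0)) (b := T)).bddAbove_image
    (h.continuous_energy.comp g.continuous).continuousOn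
  refine ⟨max B (2 * wellLevel 𝕜 N q μ c), ?_⟩
  rintro _ ⟨t, rfl⟩
  rcases le_total t T with ht | ht
  · exact le_max_of_le_left (hB ⟨t, ⟨zero_le, ht⟩, rfl⟩)
  · exact le_max_of_le_right (hT t ht).2.le

/-- The path starts inside the barrier and is eventually not inside; by continuity of the gradient
norm it meets the barrier. -/
theorem wellFun_le_iSup (h : Regime 𝕜 N q μ c) {g : C(ℝ≥0, H1 𝕜 N)}
    (hg : g ∈ radialPaths 𝕜 N q μ c) :
    wellFun 𝕜 N q μ c (rhoZero 𝕜 N q μ) ≤ ⨆ t, energy q μ (g t) := by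
  have hb := h.bddAbove_energy_path hg
  obtain ⟨hS, h0, T, hT⟩ := hg
  have hcont : Continuous fun t => ‖(g t).grad‖ ^ 2 :=
    ((gradL 𝕜 N).continuous.comp g.continuous).norm.pow 2
  obtain ⟨t, ht⟩ := mem_range_of_exists_le_of_exists_ge hcont ⟨0, (h.lt_rhoZero h0).le⟩
    ⟨T, h.rhoZero_le (hT T le_rfl)⟩
  exact (h.energy_pos_of_grad_eq (hS t).1 ht).trans (le_ciSup hb t)

theorem bddBelow_iSup (h : Regime 𝕜 N q μ c) :
    BddBelow ((fun g : C(ℝ≥0, H1 𝕜 N) => ⨆ t : ℝ≥0, energy q μ (g t)) '' radialPaths 𝕜 N q μ c) := by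
  refine ⟨wellFun 𝕜 N q μ c (rhoZero 𝕜 N q μ), ?_⟩
  rintro _ ⟨g, hg, rfl⟩
  exact h.wellFun_le_iSup hg

theorem mountainPassLevel_pos (h : Regime 𝕜 N q μ c) : 0 < mountainPassLevel 𝕜 N q μ c := by
  refine h.wellFun_pos.trans_le (le_csInf (h.radialPaths_nonempty.image _) ?_)
  rintro _ ⟨g, hg, rfl⟩
  exact h.wellFun_le_iSup hg

theorem mountainPassLevel_le (h : Regime 𝕜 N q μ c) {g : C(ℝ≥0, H1 𝕜 N)}
    (hg : g ∈ radialPaths 𝕜 N q μ c) : mountainPassLevel 𝕜 N q μ c ≤ ⨆ t, energy q μ (g t) :=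
  csInf_le h.bddBelow_iSup ⟨g, hg, rfl⟩

theorem exists_path_le (h : Regime 𝕜 N q μ c) {ε : ℝ} (hε : 0 < ε) :
    ∃ g ∈ radialPaths 𝕜 N q μ c, ∀ t, energy q μ (g t) ≤ mountainPassLevel 𝕜 N q μ c + ε := by
  obtain ⟨_, ⟨g, hg, rfl⟩, hlt⟩ := exists_lt_of_csInf_lt (h.radialPaths_nonempty.image _)
    (lt_add_of_pos_right (mountainPassLevel 𝕜 N q μ c) hε)
  exact ⟨g, hg, fun t => (le_ciSup (h.bddAbove_energy_path hg) t).trans hlt.le⟩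

end Regime

end Geometry

/-! ### The minimax principle on a subspace, with a dilation parameter. -/

/-- The minimax principle `exists_almost_critical` inside a closed subspace. -/
theorem exists_almost_critical_of_submodule {E W : Type*} [NormedAddCommGroup E]
    [InnerProductSpace ℝ E] [NormedAddCommGroup W] [InnerProductSpace ℝ W] [CompleteSpace W]
    (R : Submodule ℝ E) [CompleteSpace R] (L : E →L[ℝ] W) {Φ : E × ℝ → ℝ} (hΦ : ContDiff ℝ 1 Φ)
    {c l ε : ℝ} (hc : 0 < c) (hε : 0 < ε) (γ : C(unitInterval, E × ℝ)) (hR : ∀ t, (γ t).1 ∈ R)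
    (hγ : ∀ t, ‖L (γ t).1‖ ^ 2 = c) (h0 : Φ (γ 0) < l) (h1 : Φ (γ 1) < l)
    (hle : ∀ t, Φ (γ t) ≤ l + ε ^ 2)
    (hmin : ∀ g : C(unitInterval, E × ℝ), (∀ t, (g t).1 ∈ R) → (∀ t, ‖L (g t).1‖ ^ 2 = c) →
      g 0 = γ 0 → g 1 = γ 1 → ∃ t, l ≤ Φ (g t)) :
    ∃ p : E × ℝ, p.1 ∈ R ∧ ‖L p.1‖ ^ 2 = c ∧ (∃ t, dist (γ t) p ≤ ε) ∧ l ≤ Φ p ∧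
      Φ p ≤ l + ε ^ 2 ∧ |fderiv ℝ Φ p (0, 1)| ≤ 2 * ε ∧
      ∀ v ∈ R, inner ℝ (L p.1) (L v) = 0 → |fderiv ℝ Φ p (v, 0)| ≤ 2 * ε * ‖v‖ := by
  let J : R × ℝ →L[ℝ] E × ℝ := R.subtypeL.prodMap (ContinuousLinearMap.id ℝ ℝ)
  have hJ : ContDiff ℝ 1 (Φ ∘ J) := hΦ.comp J.contDiff
  have hcont : Continuous fun t => ((⟨(γ t).1, hR t⟩ : R), (γ t).2) :=
    ((continuous_fst.comp γ.continuous).subtype_mk _).prodMk (continuous_snd.comp γ.continuous)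
  obtain ⟨p, hp, ⟨t, ht⟩, hl, hu, hs, hv⟩ := exists_almost_critical (L.comp R.subtypeL) hJ hc hε
    ⟨_, hcont⟩ hγ h0 h1 hle fun g hg hg0 hg1 => hmin ⟨fun t => J (g t), J.continuous.comp g.continuous⟩
      (fun t => (g t).1.2) hg (congrArg J hg0) (congrArg J hg1)
  have hd : ∀ x, fderiv ℝ (Φ ∘ J) p x = fderiv ℝ Φ (J p) (J x) := fun x => by
    rw [fderiv_comp p (hΦ.differentiable one_ne_zero _) J.differentiableAt, J.fderiv]
    rfl
  refine ⟨J p, p.1.2, hp, ⟨t, ht⟩, hl, hu, ?_, fun v hvR hv0 => ?_⟩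
  · rwa [hd] at hs
  · have := hv ⟨v, hvR⟩ hv0
    rwa [hd] at this

/-- The minimax principle for a function composed with a family of maps. -/
theorem exists_almost_critical_of_family {E W : Type*} [NormedAddCommGroup E]
    [InnerProductSpace ℝ E] [NormedAddCommGroup W] [InnerProductSpace ℝ W] [CompleteSpace W]
    (R : Submodule ℝ E) [CompleteSpace R] (L : E →L[ℝ] W) {F : E → ℝ} {D : ℝ → E → E}
    (hΦ : ContDiff ℝ 1 fun p : E × ℝ => F (D p.2 p.1)) (hD : ∀ u, D 0 u = u)
    {c l ε : ℝ} (hc : 0 < c) (hε : 0 < ε) (g : C(unitInterval, E)) (hR : ∀ t, g t ∈ R)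
    (hg : ∀ t, ‖L (g t)‖ ^ 2 = c) (h0 : F (g 0) < l) (h1 : F (g 1) < l)
    (hle : ∀ t, F (g t) ≤ l + ε ^ 2)
    (hmin : ∀ f : C(unitInterval, E × ℝ), (∀ t, (f t).1 ∈ R) → (∀ t, ‖L (f t).1‖ ^ 2 = c) →
      f 0 = (g 0, 0) → f 1 = (g 1, 0) → ∃ t, l ≤ F (D (f t).2 (f t).1)) :
    ∃ p : E × ℝ, p.1 ∈ R ∧ ‖L p.1‖ ^ 2 = c ∧ |p.2| ≤ ε ∧ l ≤ F (D p.2 p.1) ∧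
      F (D p.2 p.1) ≤ l + ε ^ 2 ∧ |fderiv ℝ (fun p : E × ℝ => F (D p.2 p.1)) p (0, 1)| ≤ 2 * ε ∧
      ∀ v ∈ R, inner ℝ (L p.1) (L v) = 0 →
        |fderiv ℝ (fun p : E × ℝ => F (D p.2 p.1)) p (v, 0)| ≤ 2 * ε * ‖v‖ := by
  have hcont : Continuous fun t => (g t, (0 : ℝ)) := g.continuous.prodMk continuous_const
  obtain ⟨p, hpR, hpc, ⟨t, ht⟩, hl, hu, hs, hv⟩ := exists_almost_critical_of_submodule R L hΦ hc hε
    ⟨_, hcont⟩ hR hg (by simpa [hD] using h0) (by simpa [hD] using h1)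
    (fun t => by simpa [hD] using hle t) hmin
  refine ⟨p, hpR, hpc, ?_, hl, hu, hs, hv⟩
  -- The starting path has second component `0`, and the distance on the product is the maximum of
  -- the two distances.
  have h2 : dist (0 : ℝ) p.2 ≤ ε := (le_max_right (dist (g t) p.1) (dist 0 p.2)).trans ht
  rwa [dist_comm, Real.dist_0_eq_abs] at h2

variable {𝕜 : Type*} [RCLike 𝕜] {N : ℕ} {q μ c : ℝ}

theorem _root_.Continuous.dil {X : Type*} [TopologicalSpace X] {f : X → H1 𝕜 N} {s : X → ℝ}
    (hf : Continuous f) (hs : Continuous s) : Continuous fun x => dil 𝕜 N (s x) (f x) :=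
  continuous_dil.comp (hf.prodMk hs)

/-- Joint continuity of `(u, s) ↦ s ⋆ u` into `H¹` would not give this. The composed energy is `C¹`
because each term is an exponential in `s` times a `C¹` function of `u`. -/
theorem contDiff_energy_dil (hN : 3 ≤ N) (μ : ℝ) (hq : 2 < q) (hq' : q < critExp N) :
    ContDiff ℝ 1 fun p : H1 𝕜 N × ℝ => energy q μ (dil 𝕜 N p.2 p.1) := by
  have hs : ∀ r : ℝ, ContDiff ℝ 1 fun p : H1 𝕜 N × ℝ => Real.exp (r * p.2) :=
    fun r => (contDiff_const.mul contDiff_snd).exp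
  simp_rw [energy_dil hN, fiberFun]
  exact ((contDiff_const.mul ((hs 2).mul (contDiff_norm_grad_sq.comp contDiff_fst))).sub
    ((hs _).mul (contDiff_const.mul ((contDiff_powInt hN hq hq').comp contDiff_fst)))).sub
    ((hs _).mul (contDiff_const.mul ((contDiff_powInt_critExp hN).comp contDiff_fst)))

theorem fderiv_apply_snd {E : Type*} [NormedAddCommGroup E] [NormedSpace ℝ E] {Φ : E × ℝ → ℝ}
    {p : E × ℝ} (hd : DifferentiableAt ℝ Φ p) {d : ℝ}
    (h : HasDerivAt (fun s => Φ (p.1, s)) d p.2) : fderiv ℝ Φ p (0, 1) = d := by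
  have h1 : HasDerivAt (fun s => (p.1, s)) (0, (1 : ℝ)) p.2 :=
    (hasDerivAt_const p.2 p.1).prodMk (hasDerivAt_id p.2)
  have h2 : HasDerivAt (Φ ∘ fun s => (p.1, s)) _ p.2 :=
    HasFDerivAt.comp_hasDerivAt p.2 (f := fun s => (p.1, s)) hd.hasFDerivAt h1
  exact h2.unique h

theorem fderiv_apply_fst {E : Type*} [NormedAddCommGroup E] [NormedSpace ℝ E] {F : E → ℝ}
    {D : ℝ → E →L[ℝ] E} {p : E × ℝ} (hd : DifferentiableAt ℝ (fun p : E × ℝ => F (D p.2 p.1)) p)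
    (he : DifferentiableAt ℝ F (D p.2 p.1)) (w : E) :
    fderiv ℝ (fun p : E × ℝ => F (D p.2 p.1)) p (w, 0) = fderiv ℝ F (D p.2 p.1) (D p.2 w) := by
  have h2 := HasFDerivAt.comp p.1 (f := fun u : E => (u, p.2)) hd.hasFDerivAt
    (hasFDerivAt_prodMk_left p.1 p.2)
  have h3 := HasFDerivAt.comp p.1 he.hasFDerivAt (D p.2).hasFDerivAt
  exact congrArg (fun ℓ => ℓ w) (h2.unique h3)

/-! ### Palais–Smale sequences at the mountain pass level -/

section PalaisSmale

variable {𝕜 : Type*} [RCLike 𝕜] {N : ℕ} {q μ c : ℝ}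

theorem tendsto_norm_comp_subtypeL {E : Type*} [NormedAddCommGroup E] [NormedSpace ℝ E]
    {p : ℕ → Submodule ℝ E} {f : ℕ → E →L[ℝ] ℝ} {b : ℕ → ℝ}
    (h : ∀ n, ‖(f n).comp (p n).subtypeL‖ ≤ b n) (hb : Tendsto b atTop (𝓝 0)) :
    Tendsto (fun n => ‖(f n).comp (p n).subtypeL‖) atTop (𝓝 0) :=
  squeeze_zero (fun n => norm_nonneg ((f n).comp (p n).subtypeL)) h hb

theorem dil_zero (u : H1 𝕜 N) : dil 𝕜 N 0 u = u := by
  refine H1.ext_of_fn (Lp.ext ?_)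
  filter_upwards [dilL2_ae 0 u.fn] with x hx
  rw [dil_fn, hx]
  simp

namespace Regime

/-- A path on `[0, 1]` is extended to `[0, ∞)` by its final value; the supremum of the energy is
then a maximum over `[0, 1]`. -/
theorem exists_mountainPassLevel_le (h : Regime 𝕜 N q μ c) (g : C(unitInterval, H1 𝕜 N))
    (hg : ∀ t, g t ∈ radialMassSphere 𝕜 N c) (h0 : g 0 ∈ radialLambdaMinus 𝕜 N q μ c)
    (h1 : g 1 ∈ lowEnergySet 𝕜 N q μ c) : ∃ t, mountainPassLevel 𝕜 N q μ c ≤ energy q μ (g t) := by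
  have hp : Continuous fun t : ℝ≥0 => Set.projIcc (0 : ℝ) 1 zero_le_one (t : ℝ) :=
    continuous_projIcc.comp NNReal.continuous_coe
  let f : C(ℝ≥0, H1 𝕜 N) := g.comp ⟨_, hp⟩
  have e0 : f 0 = g 0 := congrArg g (Set.projIcc_left zero_le_one)
  have e1 : ∀ t : ℝ≥0, 1 ≤ t → f t = g 1 := fun t ht =>
    congrArg g (Set.projIcc_of_right_le zero_le_one (by exact_mod_cast ht))
  have hf : f ∈ radialPaths 𝕜 N q μ c :=
    ⟨fun t => hg _, by rwa [e0], 1, fun t ht => by rwa [e1 t ht]⟩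
  obtain ⟨t, -, ht⟩ := isCompact_univ.exists_isMaxOn Set.univ_nonempty
    (h.continuous_energy.comp g.continuous).continuousOn
  exact ⟨t, (h.mountainPassLevel_le hf).trans (ciSup_le fun s => ht (Set.mem_univ _))⟩

/-- Applying the dilations turns a path in `S_r(c) × ℝ` into one in `S_r(c)`, so the additional
variable does not lower the minimax level. -/
theorem exists_mountainPassLevel_le_dil (h : Regime 𝕜 N q μ c) (f : C(unitInterval, H1 𝕜 N × ℝ))
    (hf : ∀ t, (f t).1 ∈ radialMassSphere 𝕜 N c)
    (h0 : dil 𝕜 N (f 0).2 (f 0).1 ∈ radialLambdaMinus 𝕜 N q μ c)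
    (h1 : dil 𝕜 N (f 1).2 (f 1).1 ∈ lowEnergySet 𝕜 N q μ c) :
    ∃ t, mountainPassLevel 𝕜 N q μ c ≤ energy q μ (dil 𝕜 N (f t).2 (f t).1) := by
  have hc1 : Continuous fun t => (f t).1 := continuous_fst.comp f.continuous
  have hc2 : Continuous fun t => (f t).2 := continuous_snd.comp f.continuous
  have hS : ∀ t, dil 𝕜 N (f t).2 (f t).1 ∈ radialMassSphere 𝕜 N c :=
    fun t => dil_mem_radialMassSphere _ (hf t)
  exact h.exists_mountainPassLevel_le (ContinuousMap.mk _ (hc1.dil hc2)) hS h0 h1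

set_option maxHeartbeats 2000000 in
theorem exists_almost_critical_augmented (h : Regime 𝕜 N q μ c) {ε : ℝ} (hε : 0 < ε)
    (g : C(unitInterval, H1 𝕜 N)) (hg : ∀ t, g t ∈ radialMassSphere 𝕜 N c)
    (h0 : g 0 ∈ radialLambdaMinus 𝕜 N q μ c) (h1 : g 1 ∈ lowEnergySet 𝕜 N q μ c)
    (hle : ∀ t, energy q μ (g t) ≤ mountainPassLevel 𝕜 N q μ c + ε ^ 2) :
    ∃ p : H1 𝕜 N × ℝ, p.1 ∈ radialMassSphere 𝕜 N c ∧ |p.2| ≤ ε ∧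
      mountainPassLevel 𝕜 N q μ c ≤ energy q μ (dil 𝕜 N p.2 p.1) ∧
      energy q μ (dil 𝕜 N p.2 p.1) ≤ mountainPassLevel 𝕜 N q μ c + ε ^ 2 ∧
      |fderiv ℝ (fun p : H1 𝕜 N × ℝ => energy q μ (dil 𝕜 N p.2 p.1)) p (0, 1)| ≤ 2 * ε ∧
      ∀ v ∈ radialSet 𝕜 N, inner ℝ p.1.fn v.fn = 0 →
        |fderiv ℝ (fun p : H1 𝕜 N × ℝ => energy q μ (dil 𝕜 N p.2 p.1)) p (v, 0)|
          ≤ 2 * ε * ‖v‖ := by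
  have hM := h.mountainPassLevel_pos
  have hΦ := contDiff_energy_dil (𝕜 := 𝕜) h.hN μ h.hq (lt_critExp h.hN h.hq')
  have hmin : ∀ f : C(unitInterval, H1 𝕜 N × ℝ), (∀ t, (f t).1 ∈ radialSubmodule 𝕜 N) →
      (∀ t, ‖fnL 𝕜 N (f t).1‖ ^ 2 = c) → f 0 = (g 0, 0) → f 1 = (g 1, 0) →
      ∃ t, mountainPassLevel 𝕜 N q μ c ≤ energy q μ (dil 𝕜 N (f t).2 (f t).1) := by
    intro f hR hc hf0 hf1
    refine h.exists_mountainPassLevel_le_dil f (fun t => ⟨hc t, hR t⟩) ?_ ?_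
    · rw [hf0, dil_zero]; exact h0
    · rw [hf1, dil_zero]; exact h1
  have hmass : ∀ t, ‖fnL 𝕜 N (g t)‖ ^ 2 = c := fun t => (hg t).1
  -- Both endpoints have negative energy, the second one even below `2 m(c)`, whereas `M⁰(c) > 0`.
  obtain ⟨p, hpR, hpc, hps, hp⟩ := exists_almost_critical_of_family (E := H1 𝕜 N)
    (radialSubmodule 𝕜 N) (fnL 𝕜 N) (F := energy q μ) (D := fun s u => dil 𝕜 N s u) hΦ dil_zero
    h.hc hε g (fun t => (hg t).2) hmass
    (h0.1.2.trans hM) (by linarith [h1.2, h.wellLevel_neg]) hle hmin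
  exact ⟨p, ⟨hpc, hpR⟩, hps, hp⟩

theorem exists_unitInterval_path (h : Regime 𝕜 N q μ c) {ε : ℝ} (hε : 0 < ε) :
    ∃ g : C(unitInterval, H1 𝕜 N), (∀ t, g t ∈ radialMassSphere 𝕜 N c) ∧
      g 0 ∈ radialLambdaMinus 𝕜 N q μ c ∧ g 1 ∈ lowEnergySet 𝕜 N q μ c ∧
      ∀ t, energy q μ (g t) ≤ mountainPassLevel 𝕜 N q μ c + ε := by
  obtain ⟨g, ⟨hgS, hg0, T, hT⟩, hgle⟩ := h.exists_path_le hε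
  have hcont : Continuous fun t : unitInterval => T * unitInterval.toNNReal t :=
    continuous_const.mul unitInterval.toNNReal_continuous
  refine ⟨g.comp ⟨_, hcont⟩, fun t => hgS _, ?_, ?_, fun t => hgle _⟩
  · change g (T * unitInterval.toNNReal 0) ∈ _
    rwa [unitInterval.toNNReal_zero, mul_zero]
  · change g (T * unitInterval.toNNReal 1) ∈ _
    rw [unitInterval.toNNReal_one, mul_one]
    exact hT T le_rfl

/-- For an almost critical `(u, s)` of `Φ`, the function `s ⋆ u` has `Q_μ(s ⋆ u) = ∂ₛΦ`, and its
differential is the differential of `Φ` in `u` transported by the dilation. -/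
theorem exists_almost_palaisSmale (h : Regime 𝕜 N q μ c) {ε : ℝ} (hε : 0 < ε) :
    ∃ v ∈ radialMassSphere 𝕜 N c, mountainPassLevel 𝕜 N q μ c ≤ energy q μ v ∧
      energy q μ v ≤ mountainPassLevel 𝕜 N q μ c + ε ^ 2 ∧ |pohozaev q μ v| ≤ 2 * ε ∧
      ‖(fderiv ℝ (energy q μ) v).comp (tangentSpace v).subtypeL‖ ≤ 2 * ε * Real.exp ε := by
  obtain ⟨g, hg, hg0, hg1, hgle⟩ := h.exists_unitInterval_path (pow_pos hε 2)
  have hqc := lt_critExp h.hN h.hq'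
  obtain ⟨p, hpS, hps, hl, hu, hs, hv⟩ := h.exists_almost_critical_augmented hε g hg hg0 hg1 hgle
  have hvS := dil_mem_radialMassSphere p.2 hpS
  have hpd := (contDiff_energy_dil (𝕜 := 𝕜) h.hN μ h.hq hqc).differentiable one_ne_zero p
  have hFd := (contDiff_energy h.hN μ h.hq hqc).differentiable one_ne_zero (dil 𝕜 N p.2 p.1)
  refine ⟨dil 𝕜 N p.2 p.1, hvS, hl, hu, ?_, ?_⟩
  · rwa [fderiv_apply_snd hpd (hasDerivAt_energy_dil h.hN h.hq p.2 p.1)] at hs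
  · refine norm_fderiv_energy_tangent_le (by positivity) hFd hvS.2 (fn_ne_zero h.hc hvS.1)
      fun w hw hw0 => ?_
    -- A radial tangent direction at `s ⋆ u` is `s ⋆ w'`, with `w'` radial and tangent at `u`.
    -- Undoing the dilation costs at most `e^ε`, as `|s| ≤ ε`.
    have e : dil 𝕜 N p.2 (dil 𝕜 N (-p.2) w) = w := dil_dil_neg p.2 w
    have h3 : inner ℝ p.1.fn (dil 𝕜 N (-p.2) w).fn = 0 := by
      rw [← inner_dil_fn p.2, e, hw0]
    have h4 := hv _ (dil_mem_radialSet (-p.2) hw) h3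
    rw [fderiv_apply_fst hpd hFd, e] at h4
    refine h4.trans ?_
    rw [mul_assoc (2 * ε)]
    refine mul_le_mul_of_nonneg_left ((norm_dil_le _ _).trans ?_) (by positivity)
    refine mul_le_mul_of_nonneg_right (max_le (Real.one_le_exp hε.le) (Real.exp_le_exp.2 ?_))
      (norm_nonneg _)
    exact (neg_le_abs _).trans hps

theorem exists_palaisSmale (h : Regime 𝕜 N q μ c) :
    ∃ u : ℕ → H1 𝕜 N, (∀ n, u n ∈ radialMassSphere 𝕜 N c) ∧
      IsPalaisSmale q μ c (mountainPassLevel 𝕜 N q μ c) u ∧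
      Tendsto (fun n => pohozaev q μ (u n)) atTop (𝓝 0) := by
  choose u hS hl hu hQ hd using fun n : ℕ => h.exists_almost_palaisSmale (Nat.one_div_pos_of_nat (α := ℝ) (n := n))
  have hε : Tendsto (fun n : ℕ => 1 / ((n : ℝ) + 1)) atTop (𝓝 0) :=
    tendsto_one_div_add_atTop_nhds_zero_nat
  have h2ε : Tendsto (fun n : ℕ => 2 * (1 / ((n : ℝ) + 1))) atTop (𝓝 0) := by
    simpa using hε.const_mul 2
  refine ⟨u, hS, ⟨fun n => (hS n).1, ?_, fun n => ?_, ?_⟩, ?_⟩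
  · refine tendsto_of_tendsto_of_tendsto_of_le_of_le tendsto_const_nhds ?_ hl hu
    simpa using (hε.pow 2).const_add (mountainPassLevel 𝕜 N q μ c)
  · exact (contDiff_energy h.hN μ h.hq (lt_critExp h.hN h.hq')).differentiable one_ne_zero _
  · refine tendsto_norm_comp_subtypeL hd ?_
    simpa using h2ε.mul ((Real.continuous_exp.tendsto 0).comp hε)
  · exact squeeze_zero_norm hQ h2ε

/-- A bound for the gradient in terms of the energy and of the Pohozaev functional. -/
theorem norm_grad_sq_le (h : Regime 𝕜 N q μ c) :
    ∃ C : ℝ, 0 ≤ C ∧ ∀ u ∈ massSphere 𝕜 N c, 1 / N * ‖u.grad‖ ^ 2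
      ≤ energy q μ u - 1 / critExp N * pohozaev q μ u
        + C * (‖u.grad‖ ^ 2) ^ (1 + alphaZero N q) := by
  obtain ⟨h1, h2, h3, h4, h5, -⟩ := alpha_facts h.hN h.hq h.hq'
  obtain ⟨hN2, h7, -⟩ := critExp_facts h.hN
  have hp := two_lt_critExp h.hN
  have hμ := h.hμ
  have hc := h.hc
  have hq := h.hq
  have hC := gagliardoConst_nonneg 𝕜 N q
  refine ⟨μ / q * (gagliardoConst 𝕜 N q ^ q * c ^ alphaOne N q), by positivity, fun u hu => ?_⟩
  have hP := powInt_le_gagliardo h.hN hq (lt_critExp h.hN h.hq') u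
  have hu' : ‖u.fn‖ ^ 2 = c := hu
  rw [hu'] at hP
  have hP0 := powInt_nonneg q u
  have hP1 := mul_le_mul_of_nonneg_left hP (by positivity : 0 ≤ μ / q)
  have e : 1 / 2 - 1 / critExp N = 1 / (N : ℝ) := by
    rw [critExp]
    have : (N : ℝ) - 2 ≠ 0 := by linarith
    field_simp
    ring
  -- The multiplier `1 / 2*` is the one that cancels the critical term.
  have e2 : energy q μ u - 1 / critExp N * pohozaev q μ u = (1 / 2 - 1 / critExp N) * ‖u.grad‖ ^ 2
      - μ / q * powInt q u + 1 / critExp N * (2 * (1 + alphaZero N q) * (μ / q * powInt q u)) := by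
    rw [energy, pohozaev, gammaExp, alphaZero]
    field_simp
    ring
  have e3 : 0 ≤ 1 / critExp N * (2 * (1 + alphaZero N q) * (μ / q * powInt q u)) := by
    have : 0 < 1 + alphaZero N q := by linarith
    positivity
  rw [e2, e]
  linarith

theorem exists_norm_le (h : Regime 𝕜 N q μ c) {l : ℝ} {u : ℕ → H1 𝕜 N}
    (hS : ∀ n, u n ∈ massSphere 𝕜 N c) (hF : Tendsto (fun n => energy q μ (u n)) atTop (𝓝 l))
    (hQ : Tendsto (fun n => pohozaev q μ (u n)) atTop (𝓝 0)) : ∃ B : ℝ, ∀ n, ‖u n‖ ≤ B := by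
  obtain ⟨h1, h2, -, -, -, -⟩ := alpha_facts h.hN h.hq h.hq'
  have hN2 := (critExp_facts h.hN).1
  obtain ⟨C, hC0, hC⟩ := h.norm_grad_sq_le
  obtain ⟨D, hD⟩ := (hF.sub (hQ.const_mul (1 / critExp N))).bddAbove_range
  have ht : Tendsto (fun ρ : ℝ => C * ρ ^ alphaZero N q) atTop (𝓝 0) := by
    have := (tendsto_rpow_neg_atTop (neg_pos.2 h2)).const_mul C
    simpa using this
  -- As `α₀ < 0`, for large `ρ` the term `C ρ^{1+α₀}` is absorbed by half of `ρ / N`.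
  obtain ⟨R, hR⟩ := ((ht.eventually_lt_const (by positivity : (0 : ℝ) < 1 / (2 * N))).and
    (eventually_gt_atTop 0)).exists_forall_of_atTop
  have hb : ∀ n, ‖(u n).grad‖ ^ 2 ≤ max R (2 * N * D) := by
    intro n
    rcases le_total (‖(u n).grad‖ ^ 2) R with hn | hn
    · exact hn.trans (le_max_left _ _)
    · refine le_trans ?_ (le_max_right _ _)
      obtain ⟨hr, hpos⟩ := hR _ hn
      have hCn := hC _ (hS n)
      have hDn : energy q μ (u n) - 1 / critExp N * pohozaev q μ (u n) ≤ D := hD ⟨n, rfl⟩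
      rw [Real.rpow_add hpos, Real.rpow_one] at hCn
      have hm := mul_le_mul_of_nonneg_right hr.le hpos.le
      have e : 1 / (N : ℝ) = 2 * (1 / (2 * N)) := by field_simp
      rw [e] at hCn
      have : 1 / (2 * (N : ℝ)) * ‖(u n).grad‖ ^ 2 ≤ D := by linarith
      rw [one_div_mul_eq_div, div_le_iff₀ (by positivity)] at this
      linarith
  refine ⟨√(c + max R (2 * N * D)), fun n => Real.le_sqrt_of_sq_le ?_⟩
  have hn : ‖(u n).fn‖ ^ 2 = c := hS n
  rw [norm_sq_eq, hn]
  linarith [hb n]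

end Regime

end PalaisSmale

end NormalizedNLS

end

theorem proposition1p6 {𝕜 : Type*} [RCLike 𝕜] (N : ℕ) (hN : 3 ≤ N)
    (q μ c : ℝ) (hq : 2 < q) (hq' : q < 2 + 4 / N) (hμ : 0 < μ)
    (hc : 0 < c) (hc' : c < NormalizedNLS.massThreshold 𝕜 N q μ) :
    (∃ u : ℕ → NormalizedNLS.H1 𝕜 N,
      (∀ n, u n ∈ NormalizedNLS.radialMassSphere 𝕜 N c) ∧
      NormalizedNLS.IsPalaisSmale q μ c (NormalizedNLS.mountainPassLevel 𝕜 N q μ c) u ∧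
      Tendsto (fun n => NormalizedNLS.pohozaev q μ (u n)) atTop (𝓝 0)) ∧
    (∀ u : ℕ → NormalizedNLS.H1 𝕜 N,
      NormalizedNLS.IsPalaisSmale q μ c (NormalizedNLS.mountainPassLevel 𝕜 N q μ c) u →
      Tendsto (fun n => NormalizedNLS.pohozaev q μ (u n)) atTop (𝓝 0) →
      ∃ B : ℝ, ∀ n, ‖u n‖ ≤ B) := by
  have h : NormalizedNLS.Regime 𝕜 N q μ c := ⟨hN, hq, hq', hμ, hc, hc'⟩
  exact ⟨h.exists_palaisSmale, fun u hu hQ => h.exists_norm_le hu.1 hu.2.1 hQ⟩
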